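/- Let $G$ be a simply connected three-dimensional Lie group of Bianchi type I to VIII (i.e. its Lie algebra is not isomorphic to $\mathfrak{so}(3)$, which is type IX), $(e_i)$ a left-invariant frame with dual frame $(e^i)$ and structure constants $[e_i,e_j]=C^k_{ij}e_k$. Let $m>0$ and $\Lambda\in\mathbb R$. Consider on $M=[0,\infty)\times G$ the Lorentzian metric $\tilde g=-dt^2+g_{ij}(t)\,e^i\otimes e^j$, with $(g_{ij}(t))$ symmetric positive definite, coupled to spatially homogeneous fields: a symmetric tensor $k_{ij}$, an electric field $E^i$, an antisymmetric magnetic field $F_{ij}$, a matter velocity $u^i$ with $u^0=\sqrt{1+g_{ij}u^iu^j}$, a scalar field $\Phi$, $U\ge 0$, a matter density $\rho>0$ and a charge density $e$. Indices are moved with $g$ (so $u_i=g_{ij}u^j$, $u_0=-u^0$). Put $H=g^{ij}k_{ij}$, $$\gamma^l_{ij}=\tfrac12 g^{lk}\big[-C^m_{jk}g_{im}+C^m_{ki}g_{jm}+C^m_{ij}g_{km}\big],\qquad R_{ij}=\gamma^l_{lm}\gamma^m_{ji}-\gamma^m_{jl}\gamma^l_{mi}-C^l_{mj}\gamma^m_{li},\qquad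 R=g^{ij}R_{ij},$$ $$T_{00}=U+\tfrac12m^2\Phi^2,\qquad T_{0i}=0,\qquad T_{ij}=\tfrac12 g_{ij}(2U-m^2\Phi^2),$$ $$\tau_{00}=\tfrac12 g_{ij}E^iE^j+\tfrac14F^{ij}F_{ij},\qquad \tau_{0j}=-E^kF_{jk},\qquad \tau_{ij}=\tfrac12g_{ij}E^kE_k-E_iE_j-\tfrac14g_{ij}F^{kl}F_{kl}+g^{kl}F_{ik}F_{jl}.$$ Suppose that $(g,k,E,F,u,\Phi,U,\rho,e)$ solves on $[0,\infty)$ the evolution system of the Einstein-Maxwell-massive scalar field equations, $$\dot g_{ij}=-2k_{ij},$$ $$\dot k_{ij}=R_{ij}+Hk_{ij}-2k^l_jk_{il}-8\pi(T_{ij}+\tau_{ij}+\rho u_iu_j)+4\pi\big[-T_{00}-\rho u_0^2+g^{lm}(T_{lm}+\rho u_lu_m)\big]g_{ij}-\Lambda g_{ij},$$ $$\dot E^i=HE^i-\big(C^j_{jk}g^{kl}g^{im}+\tfrac12C^i_{jk}g^{jl}g^{km}\big)F_{lm}+4\pi eu^i,\qquad \dot F_{ij}=C^k_{ij}g_{kl}E^l,$$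 $$\dot u^i=2k^i_ju^j-\gamma^i_{jk}\frac{u^ju^k}{u^0}-4\pi\frac e\rho E^i+4\pi\frac e\rho\frac{g^{il}F_{jl}u^j}{u^0},\qquad \dot\Phi=\sqrt{2U},\qquad \dot U=2HU-m^2\Phi\sqrt{2U},$$ $$\dot\rho=-\Big[k_{ij}\frac{u^iu^j}{(u^0)^2}+C^i_{ij}\frac{u^j}{u^0}-H\Big]\rho+4\pi e\,\frac{g_{ij}E^ju^i}{(u^0)^2},\qquad \dot e=-\Big[k_{ij}\frac{u^iu^j}{(u^0)^2}+C^i_{ij}\frac{u^j}{u^0}-H\Big]e+4\pi\frac{g_{ij}E^ju^i}{(u^0)^2}\frac{e^2}\rho,$$ with initial data at $t=0$ such that $\Phi(0)>0$, $U(0)>0$, $\rho(0)>0$, $e(0)\ge0$ and the constraints $$R-k_{ij}k^{ij}+H^2=16\pi(T_{00}+\tau_{00}+\rho u_0^2)+2\Lambda,\qquad \nabla^ik_{ij}=-8\pi(T_{0j}+\tau_{0j}+\rho u_0u_j),$$ $$C^l_{ij}F_{kl}+C^l_{ki}F_{jl}+C^l_{jk}F_{il}=0,\qquad C^i_{ik}E^k+4\pi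 eu^0=0$$ hold at $t=0$, where $\nabla$ is the Levi-Civita connection of $g(0)$ on $G$. Suppose that $\Lambda>-4\pi m^2\Phi(0)^2$ and $H(0)<0$. Then $(M,\tilde g)$ is future geodesically complete: every future-directed causal (time-like or null) geodesic defined on a bounded interval $[0,b)$ of its affine parameter $s$ extends to such a geodesic on $[0,\infty)$. Moreover, along every future-directed causal geodesic defined on $[0,\infty)$, with spatial velocity components $w^i$ in the frame $(e_i)$, $g_{ij}w^iw^j$ is bounded and there are constants $A>0$ and $D$ with $s\ge A\,t(s)+D$ for all $s\ge 0$; and $g_{ij}u^iu^j$ is bounded on $[0,\infty)$ for the matter velocity $u$. -/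

import Mathlib

open Set
open scoped Manifold ContDiff Matrix

noncomputable section

namespace Bianchi

/-! ### Left-invariant geometry of a three-dimensional Lie group -/

/-- The model space of three-dimensional manifolds. -/
abbrev E3 : Type := EuclideanSpace ℝ (Fin 3)

/-- The Lie algebra of a three-dimensional Lie group: the tangent space at the identity, with the
bracket of left-invariant vector fields. -/
abbrev LieAlg (G : Type*) [TopologicalSpace G] [ChartedSpace E3 G] [Group G] : Type :=
  GroupLieAlgebra 𝓘(ℝ, E3) G

/-- `G` is of Bianchi type IX: its Lie algebra is `so(3)`, that is, it has a basis with
`[b₁, b₂] = b₃` and cyclic permutations. The types I to VIII are all the other ones. -/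
def IsTypeIX (G : Type*) [TopologicalSpace G] [ChartedSpace E3 G] [Group G] : Prop :=
  ∃ b : Module.Basis (Fin 3) ℝ (LieAlg G),
    ⁅b 0, b 1⁆ = b 2 ∧ ⁅b 1, b 2⁆ = b 0 ∧ ⁅b 2, b 0⁆ = b 1

/-- Structure constants: `C k i j` is `C^k_{ij}`. -/
abbrev StructConst : Type := Fin 3 → Fin 3 → Fin 3 → ℝ

/-- The structure constants of a left-invariant frame, `[e_i, e_j] = C^k_{ij} e_k`. -/
def structConst {G : Type*} [TopologicalSpace G] [ChartedSpace E3 G] [Group G]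
    (e : Module.Basis (Fin 3) ℝ (LieAlg G)) : StructConst :=
  fun k i j => e.repr ⁅e i, e j⁆ k

abbrev Mat3 : Type := Matrix (Fin 3) (Fin 3) ℝ

/-- The coefficients `γ^l_{ij}` of the Levi-Civita connection of the left-invariant metric `g` in
the frame `e`, `∇_{e_i} e_j = γ^l_{ij} e_l`. -/
def connCoeff (C : StructConst) (g : Mat3) (l i j : Fin 3) : ℝ :=
  (1 / 2) * ∑ k, g⁻¹ l k *
    ∑ m, (-(C m j k * g i m) + C m k i * g j m + C m i j * g k m)

/-- The Ricci tensor `R_{ij}` of the left-invariant metric `g`. -/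
def ricci (C : StructConst) (g : Mat3) (i j : Fin 3) : ℝ :=
  ∑ l, ∑ m, (connCoeff C g l l m * connCoeff C g m j i
    - connCoeff C g m j l * connCoeff C g l m i
    - C l m j * connCoeff C g m l i)

/-- The scalar curvature `R = g^{ij} R_{ij}`. -/
def scalarCurv (C : StructConst) (g : Mat3) : ℝ := ∑ i, ∑ j, g⁻¹ i j * ricci C g i j

/-- The divergence `∇^i k_{ij} = g^{il} ∇_l k_{ij}` of a left-invariant symmetric tensor `k`. -/
def divergence (C : StructConst) (g k : Mat3) (j : Fin 3) : ℝ :=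
  ∑ i, ∑ l, g⁻¹ i l *
    (-(∑ p, connCoeff C g p l i * k p j) - ∑ p, connCoeff C g p l j * k i p)

/-! ### The unknowns at a given time and the quantities built from them -/

/-- The unknowns `(g_{ij}, k_{ij}, E^i, F_{ij}, u^i, Φ, U, ρ, e)` at one time. -/
structure State where
  /-- first fundamental form `g_{ij}` -/
  g : Mat3
  /-- second fundamental form `k_{ij}` -/
  k : Mat3
  /-- electric part `E^i = F^{0i}` -/
  E : Fin 3 → ℝ
  /-- magnetic part `F_{ij}` -/
  F : Mat3
  /-- spatial matter velocity `u^i` -/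
  u : Fin 3 → ℝ
  /-- scalar field -/
  Φ : ℝ
  /-- half of the square of the time derivative of the scalar field -/
  U : ℝ
  /-- proper matter density -/
  ρ : ℝ
  /-- proper charge density -/
  e : ℝ

namespace State

variable (C : StructConst) (m Λ : ℝ) (v : State)

/-- The mean curvature `H = g^{ij} k_{ij}`. -/
def H : ℝ := ∑ i, ∑ j, v.g⁻¹ i j * v.k i j

/-- `k_{ij} k^{ij}`. -/
def normSqK : ℝ := ∑ i, ∑ j, ∑ a, ∑ b, v.g⁻¹ i a * v.g⁻¹ j b * v.k i j * v.k a b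

/-- `g_{ij} u^i u^j`. -/
def normSqU : ℝ := ∑ i, ∑ j, v.g i j * v.u i * v.u j

/-- `u^0 = (1 + g_{ij} u^i u^j)^{1/2}`, so that `u` is unit, time-like and future pointing. -/
def u0 : ℝ := Real.sqrt (1 + v.normSqU)

/-- `u_i = g_{ij} u^j`. -/
def uLow (i : Fin 3) : ℝ := ∑ j, v.g i j * v.u j

/-- `E_i = g_{ij} E^j`. -/
def ELow (i : Fin 3) : ℝ := ∑ j, v.g i j * v.E j

/-- `g_{ij} u^i E^j`. -/
def uE : ℝ := ∑ i, v.u i * v.ELow i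

/-- `F^{ij} = g^{ia} g^{jb} F_{ab}`. -/
def FUp (i j : Fin 3) : ℝ := ∑ a, ∑ b, v.g⁻¹ i a * v.g⁻¹ j b * v.F a b

/-- `F^{ij} F_{ij}`. -/
def normSqF : ℝ := ∑ i, ∑ j, v.FUp i j * v.F i j

/-- `g_{ij} E^i E^j`. -/
def normSqE : ℝ := ∑ i, v.E i * v.ELow i

/-- Scalar field tensor, `T_{00}`, with `(dΦ/dt)² = 2U`. -/
def T00 : ℝ := v.U + (1 / 2) * m ^ 2 * v.Φ ^ 2

/-- Scalar field tensor, `T_{ij}`; the components `T_{0i}` vanish. -/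
def T (i j : Fin 3) : ℝ := (1 / 2) * v.g i j * (2 * v.U - m ^ 2 * v.Φ ^ 2)

/-- Maxwell tensor, `τ_{00}`. -/
def τ00 : ℝ := (1 / 2) * v.normSqE + (1 / 4) * v.normSqF

/-- Maxwell tensor, `τ_{0j}`. -/
def τ0 (j : Fin 3) : ℝ := -∑ k, v.E k * v.F j k

/-- Maxwell tensor, `τ_{ij}`. -/
def τ (i j : Fin 3) : ℝ :=
  (1 / 2) * v.g i j * v.normSqE - v.ELow i * v.ELow j - (1 / 4) * v.g i j * v.normSqF
    + ∑ a, ∑ b, v.g⁻¹ a b * v.F i a * v.F j b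

/-- `k_{ij} u^i u^j / (u^0)² + C^i_{ij} u^j / u^0 - k^i_i`. -/
def dilution : ℝ :=
  (∑ i, ∑ j, v.k i j * v.u i * v.u j) / v.u0 ^ 2 + (∑ i, ∑ j, C i i j * v.u j) / v.u0 - v.H

/-! ### The right-hand sides of the evolution equations -/

/-- Right-hand side of the Einstein evolution equation for `k_{ij}` (here `u_0² = (u^0)²`). -/
def kDot (i j : Fin 3) : ℝ :=
  ricci C v.g i j + v.H * v.k i j - 2 * (∑ l, ∑ n, v.g⁻¹ l n * v.k j n * v.k i l)
    - 8 * Real.pi * (v.T m i j + v.τ i j + v.ρ * v.uLow i * v.uLow j)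
    + 4 * Real.pi * (-v.T00 m - v.ρ * v.u0 ^ 2
        + ∑ a, ∑ b, v.g⁻¹ a b * (v.T m a b + v.ρ * v.uLow a * v.uLow b)) * v.g i j
    - Λ * v.g i j

/-- Right-hand side of the Maxwell equation for `E^i`. -/
def EDot (i : Fin 3) : ℝ :=
  v.H * v.E i - (∑ j, ∑ k, C j j k * v.FUp k i) - (1 / 2) * (∑ j, ∑ k, C i j k * v.FUp j k)
    + 4 * Real.pi * v.e * v.u i

/-- Right-hand side of the Maxwell equation for `F_{ij}`. -/
def FDot (i j : Fin 3) : ℝ := ∑ k, C k i j * v.ELow k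

/-- Right-hand side of the equation of current flow for `u^i`. -/
def uDot (i : Fin 3) : ℝ :=
  2 * (∑ l, ∑ j, v.g⁻¹ i l * v.k l j * v.u j)
    - (∑ j, ∑ k, connCoeff C v.g i j k * v.u j * v.u k) / v.u0
    - 4 * Real.pi * (v.e / v.ρ) * v.E i
    + 4 * Real.pi * (v.e / v.ρ) * (∑ l, ∑ j, v.g⁻¹ i l * v.F j l * v.u j) / v.u0

/-- Right-hand side of the equation for `U`. -/
def UDot : ℝ := 2 * v.H * v.U - m ^ 2 * v.Φ * Real.sqrt (2 * v.U)

/-- Right-hand side of the equation for `ρ`. -/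
def ρDot : ℝ := -v.dilution C * v.ρ + 4 * Real.pi * v.e * v.uE / v.u0 ^ 2

/-- Right-hand side of the equation for `e`. -/
def eDot : ℝ :=
  -v.dilution C * v.e + 4 * Real.pi * (v.uE / v.u0 ^ 2) * (v.e ^ 2 / v.ρ)

/-! ### Initial data and solutions -/

/-- The Hamiltonian, momentum and two Maxwell constraints (here `u_0 = -u^0`). -/
structure Constraints : Prop where
  hamiltonian : scalarCurv C v.g - v.normSqK + v.H ^ 2
    = 16 * Real.pi * (v.T00 m + v.τ00 + v.ρ * v.u0 ^ 2) + 2 * Λ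
  momentum : ∀ j, divergence C v.g v.k j
    = -(8 * Real.pi * (v.τ0 j + v.ρ * (-v.u0) * v.uLow j))
  magnetic : ∀ i j k, (∑ l, (C l i j * v.F k l + C l k i * v.F j l + C l j k * v.F i l)) = 0
  electric : (∑ i, ∑ k, C i i k * v.E k) + 4 * Real.pi * v.e * v.u0 = 0

/-- Admissible initial data. -/
structure IsInitialData : Prop where
  g_posDef : v.g.PosDef
  k_symm : v.k.IsSymm
  F_antisymm : v.Fᵀ = -v.F
  Φ_pos : 0 < v.Φ
  U_pos : 0 < v.U
  ρ_pos : 0 < v.ρ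
  e_nonneg : 0 ≤ v.e
  constraints : v.Constraints C m Λ

end State

/-- `v` is a solution on `[0, ∞)` of the evolution system of the Einstein-Maxwell-massive scalar
field equations with mass `m` and cosmological constant `Λ`. The derivative at `t = 0` is
one-sided. -/
structure IsGlobalSolution (C : StructConst) (m Λ : ℝ) (v : ℝ → State) : Prop where
  g_posDef : ∀ t, 0 ≤ t → (v t).g.PosDef
  k_symm : ∀ t, 0 ≤ t → (v t).k.IsSymm
  F_antisymm : ∀ t, 0 ≤ t → (v t).Fᵀ = -(v t).F
  U_nonneg : ∀ t, 0 ≤ t → 0 ≤ (v t).U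
  ρ_pos : ∀ t, 0 ≤ t → 0 < (v t).ρ
  g_eq : ∀ t, 0 ≤ t → ∀ i j,
    HasDerivWithinAt (fun s => (v s).g i j) (-2 * (v t).k i j) (Ici 0) t
  k_eq : ∀ t, 0 ≤ t → ∀ i j,
    HasDerivWithinAt (fun s => (v s).k i j) ((v t).kDot C m Λ i j) (Ici 0) t
  E_eq : ∀ t, 0 ≤ t → ∀ i,
    HasDerivWithinAt (fun s => (v s).E i) ((v t).EDot C i) (Ici 0) t
  F_eq : ∀ t, 0 ≤ t → ∀ i j,
    HasDerivWithinAt (fun s => (v s).F i j) ((v t).FDot C i j) (Ici 0) t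
  u_eq : ∀ t, 0 ≤ t → ∀ i,
    HasDerivWithinAt (fun s => (v s).u i) ((v t).uDot C i) (Ici 0) t
  Φ_eq : ∀ t, 0 ≤ t →
    HasDerivWithinAt (fun s => (v s).Φ) (Real.sqrt (2 * (v t).U)) (Ici 0) t
  U_eq : ∀ t, 0 ≤ t →
    HasDerivWithinAt (fun s => (v s).U) ((v t).UDot m) (Ici 0) t
  ρ_eq : ∀ t, 0 ≤ t →
    HasDerivWithinAt (fun s => (v s).ρ) ((v t).ρDot C) (Ici 0) t
  e_eq : ∀ t, 0 ≤ t →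
    HasDerivWithinAt (fun s => (v s).e) ((v t).eDot C) (Ici 0) t

/-! ### Geodesics of the space-time `[0, ∞) × G` with metric `-dt² + g_{ij}(t) e^i ⊗ e^j` -/

/-- The second fundamental form `-(1/2) ∂_t g_{ij}` of the slice at time `t`. -/
def sndFundForm (g : ℝ → Mat3) (t : ℝ) : Mat3 :=
  Matrix.of fun i j => -(1 / 2) * derivWithin (fun r => g r i j) (Ici 0) t

/-- The coefficients `γ^λ_{αβ}` of the Levi-Civita connection of `-dt² + g_{ij}(t) e^i ⊗ e^j` in the
frame `(∂_t, e_i)`, `∇_{e_α} e_β = γ^λ_{αβ} e_λ`. The index `none` is the time index `0` and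
`some i` is the spatial index `i`. -/
def spacetimeConn (C : StructConst) (g : ℝ → Mat3) (t : ℝ) :
    Option (Fin 3) → Option (Fin 3) → Option (Fin 3) → ℝ
  | some l, some i, some j => connCoeff C (g t) l i j
  | none, some i, some j => -sndFundForm g t i j
  | some j, some i, none => -∑ p, (g t)⁻¹ j p * sndFundForm g t i p
  | some j, none, some i => -∑ p, (g t)⁻¹ j p * sndFundForm g t i p
  | _, _, _ => 0

/-- `s ↦ (t s, x s)`, defined for `s` in the interval `S`, is an affinely parametrized
future-directed causal (time-like or null) geodesic of the space-time
`[0, ∞) × G`, `-dt² + g_{ij}(t) e^i ⊗ e^j`, and `w s` is its velocity in the frame `(∂_t, e_i)`. -/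
structure IsFutureCausalGeodesicOn {G : Type*} [TopologicalSpace G] [ChartedSpace E3 G] [Group G]
    (e : Module.Basis (Fin 3) ℝ (LieAlg G)) (g : ℝ → Mat3) (S : Set ℝ)
    (t : ℝ → ℝ) (x : ℝ → G) (w : ℝ → Option (Fin 3) → ℝ) : Prop where
  time_nonneg : ∀ s ∈ S, 0 ≤ t s
  time_deriv : ∀ s ∈ S, HasDerivWithinAt t (w s none) S s
  space_deriv : ∀ s ∈ S, HasMFDerivWithinAt 𝓘(ℝ, ℝ) 𝓘(ℝ, E3) x S s
    ((1 : ℝ →L[ℝ] ℝ).smulRight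
      (∑ i, w s (some i) • (mulInvariantVectorField (e i) (x s) : TangentSpace 𝓘(ℝ, E3) (x s))))
  geodesic : ∀ s ∈ S, ∀ l, HasDerivWithinAt (fun r => w r l)
    (-∑ α, ∑ β, spacetimeConn (structConst e) g (t s) l α β * w s α * w s β) S s
  causal : ∀ s ∈ S, (∑ i, ∑ j, g (t s) i j * w s (some i) * w s (some j)) ≤ w s none ^ 2
  future : ∀ s ∈ S, 0 < w s none

/-- Future geodesic completeness of `[0, ∞) × G`, `-dt² + g_{ij}(t) e^i ⊗ e^j`: every
future-directed causal geodesic defined on a bounded interval `[0, b)` of its affine parameter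
extends to such a geodesic on `[0, ∞)`. -/
def FutureGeodesicallyComplete {G : Type*} [TopologicalSpace G] [ChartedSpace E3 G] [Group G]
    (e : Module.Basis (Fin 3) ℝ (LieAlg G)) (g : ℝ → Mat3) : Prop :=
  ∀ (b : ℝ) (t : ℝ → ℝ) (x : ℝ → G) (w : ℝ → Option (Fin 3) → ℝ), 0 < b →
    IsFutureCausalGeodesicOn e g (Ico 0 b) t x w →
    ∃ (t' : ℝ → ℝ) (x' : ℝ → G) (w' : ℝ → Option (Fin 3) → ℝ),
      IsFutureCausalGeodesicOn e g (Ici 0) t' x' w' ∧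
      ∀ s ∈ Ico 0 b, t' s = t s ∧ x' s = x s

end Bianchi

end

/-! Write σ = |k|² - H²/3 for the squared norm of the trace-free part of k. With the Hamiltonian
constraint, the excess Z = (2/3)H² - 2(Λ + 4πm²Φ²) equals σ - R + 16π(U + τ₀₀ + ρ(u⁰)²). Outside
type IX a left-invariant metric has R ≤ 0 (`scalarCurv_nonpos`), so Z ≥ 0 and Z dominates both σ and
the Maxwell energy. Since Φ is nondecreasing and positive, H² ≥ 3(Λ + 4πm²Φ(0)²) > 0; hence H cannot
change sign and stays below a negative constant. Eliminating R from the equation of H gives Ḣ ≥ Z/2,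
whence Ż ≤ (2/3)HZ and Z decays exponentially in t (`Expanding.excess_decay`).

Thus k(w,w) ≤ (H/3 + √Z)|w|² ≤ A e^{-ct}|w|², and |E| ≤ A e^{-ct}. Along a geodesic d|w|²/ds =
2k(w,w) dt/ds, and A e^{-ct} dt has total mass at most A/c whatever the length of the parameter
interval; so |w|² is bounded. As (w⁰)² - |w|² is conserved, w⁰ = dt/ds is bounded too, which gives t
≤ t(0) + W s. The same Grönwall estimate, with e/ρ constant and the decay of E, bounds the matter
velocity.

The constraints are assumed only at t = 0. Their defects satisfy a triangular system of linear
homogeneous equations (magnetic, electric, momentum, Hamiltonian), so they vanish for all time. This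
rests on the Jacobi identity, the contracted Bianchi identity, the first variation of R and the
conservation of energy and momentum. The tensorial facts are reduced to an orthonormal frame, where
they become polynomial identities in the structure constants.

For completeness, the equations of (t, w) do not involve the position in G. The a priori bounds,
including a positive lower bound for w⁰ on bounded intervals, confine (t, w) to a compact box; a
globally Lipschitz truncation of the equations then provides solutions on every [0, N]. The position
is recovered by integrating a time-dependent left-invariant field, which is possible for all time
because left translations make the local existence time independent of the starting point.
Uniqueness identifies the result with the given geodesic. -/

noncomputable section
namespace Bianchi

/-! ### Bilinear operations given by three-index arrays, and changes of frame -/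

/-- The bilinear operation `(x, y) ↦ T^l_{ij} x^i y^j`. -/
def app (T : StructConst) (x y : Fin 3 → ℝ) : Fin 3 → ℝ :=
  fun l => ∑ i, ∑ j, T l i j * x i * y j

/-- The matrix of `y ↦ T^l_{ij} x^i y^j`. -/
def lft (T : StructConst) (x : Fin 3 → ℝ) : Mat3 := Matrix.of fun l j => ∑ i, T l i j * x i

/-- The matrix of `x ↦ T^l_{ij} x^i y^j`. -/
def rgt (T : StructConst) (y : Fin 3 → ℝ) : Mat3 := Matrix.of fun l i => ∑ j, T l i j * y j

lemma lft_mulVec (T : StructConst) (x y : Fin 3 → ℝ) : lft T x *ᵥ y = app T x y := by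
  ext l
  simp only [lft, app, Matrix.mulVec, dotProduct, Matrix.of_apply, Finset.sum_mul]
  exact Finset.sum_comm

lemma rgt_mulVec (T : StructConst) (x y : Fin 3 → ℝ) : rgt T y *ᵥ x = app T x y := by
  ext l
  simp only [rgt, app, Matrix.mulVec, dotProduct, Matrix.of_apply, Finset.sum_mul]
  refine Finset.sum_congr rfl fun i _ => Finset.sum_congr rfl fun j _ => by ring

/-- The arrays `T` and `T'` are the components of the same bilinear operation in two frames
related by the matrix `P`. -/
def FrameChange (P : Mat3) (T T' : StructConst) : Prop :=
  ∀ x y, app T (P *ᵥ x) (P *ᵥ y) = P *ᵥ app T' x y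

lemma matrix_ext_mulVec {A B : Mat3} (h : ∀ x, A *ᵥ x = B *ᵥ x) : A = B := by
  apply Matrix.ext_of_mulVec_single
  intro i
  exact h _

lemma FrameChange.lft_mul {P : Mat3} {T T' : StructConst} (h : FrameChange P T T')
    (x : Fin 3 → ℝ) : lft T (P *ᵥ x) * P = P * lft T' x := by
  apply matrix_ext_mulVec
  intro y
  rw [← Matrix.mulVec_mulVec, ← Matrix.mulVec_mulVec, lft_mulVec, lft_mulVec, h]

lemma FrameChange.rgt_mul {P : Mat3} {T T' : StructConst} (h : FrameChange P T T')
    (y : Fin 3 → ℝ) : rgt T (P *ᵥ y) * P = P * rgt T' y := by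
  apply matrix_ext_mulVec
  intro x
  rw [← Matrix.mulVec_mulVec, ← Matrix.mulVec_mulVec, rgt_mulVec, rgt_mulVec, h]

lemma trace_eq_of_mul_eq {P A B : Mat3} (hP : IsUnit P.det) (h : A * P = P * B) :
    A.trace = B.trace := by
  have : A = P * B * P⁻¹ := by rw [← h, Matrix.mul_nonsing_inv_cancel_right _ _ hP]
  rw [this, Matrix.trace_mul_comm, Matrix.nonsing_inv_mul_cancel_left _ _ hP]

lemma sum_metric_mul_connCoeff (C : StructConst) {g : Mat3} (hg : IsUnit g.det) (p i j : Fin 3) :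
    ∑ l, g p l * connCoeff C g l i j
      = (1 / 2) * ∑ m, (-(C m j p * g i m) + C m p i * g j m + C m i j * g p m) := by
  have h := congrFun (congrArg (fun A : Mat3 => A *ᵥ fun k =>
    ∑ m, (-(C m j k * g i m) + C m k i * g j m + C m i j * g k m))
    (Matrix.mul_nonsing_inv g hg)) p
  simp only [← Matrix.mulVec_mulVec, Matrix.one_mulVec] at h
  rw [← h]
  simp only [connCoeff, Matrix.mulVec, dotProduct, Finset.mul_sum]
  refine Finset.sum_congr rfl fun l _ => Finset.sum_congr rfl fun k _ => ?_
  refine Finset.sum_congr rfl fun m _ => by ring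

/-- The Koszul formula. -/
lemma koszul (C : StructConst) {g : Mat3} (hg : IsUnit g.det) (x y z : Fin 3 → ℝ) :
    z ⬝ᵥ (g *ᵥ app (connCoeff C g) x y) = (1 / 2) * (-(x ⬝ᵥ (g *ᵥ app C y z))
      + y ⬝ᵥ (g *ᵥ app C z x) + z ⬝ᵥ (g *ᵥ app C x y)) := by
  have h : z ⬝ᵥ (g *ᵥ app (connCoeff C g) x y)
      = ∑ p, ∑ i, ∑ j, z p * x i * y j * ∑ l, g p l * connCoeff C g l i j := by
    simp only [dotProduct, Matrix.mulVec, app, Finset.mul_sum]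
    simp only [Fin.sum_univ_three]
    ring
  rw [h]
  simp only [sum_metric_mul_connCoeff C hg, dotProduct, Matrix.mulVec, app, Fin.sum_univ_three]
  ring

/-- The Koszul formula determines the connection by the bracket and the metric alone, so it
transforms like the bracket. -/
lemma FrameChange.connCoeff {P g : Mat3} {C C' : StructConst} (h : FrameChange P C C')
    (hP : IsUnit P.det) (hg : IsUnit g.det) :
    FrameChange P (connCoeff C g) (connCoeff C' (Pᵀ * g * P)) := by
  intro x y
  have hg' : IsUnit (Pᵀ * g * P).det := by
    rw [Matrix.det_mul, Matrix.det_mul, Matrix.det_transpose]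
    exact (hP.mul hg).mul hP
  have key : ∀ z, z ⬝ᵥ (g *ᵥ app (Bianchi.connCoeff C g) (P *ᵥ x) (P *ᵥ y))
      = z ⬝ᵥ (g *ᵥ (P *ᵥ app (Bianchi.connCoeff C' (Pᵀ * g * P)) x y)) := by
    intro z
    obtain ⟨z, rfl⟩ : ∃ z', P *ᵥ z' = z := ⟨P⁻¹ *ᵥ z, by
      rw [Matrix.mulVec_mulVec, Matrix.mul_nonsing_inv _ hP, Matrix.one_mulVec]⟩
    have hq : ∀ a b : Fin 3 → ℝ, (P *ᵥ a) ⬝ᵥ (g *ᵥ (P *ᵥ b)) = a ⬝ᵥ ((Pᵀ * g * P) *ᵥ b) := by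
      intro a b
      rw [← Matrix.vecMul_transpose, ← Matrix.dotProduct_mulVec, Matrix.mulVec_mulVec,
        Matrix.mulVec_mulVec, mul_assoc]
    rw [koszul C hg, h, h, h, hq, hq, hq, hq, koszul C' hg']
  have := dotProduct_eq _ _ fun z =>
    (dotProduct_comm _ _).trans ((key z).trans (dotProduct_comm _ _))
  have h2 := congrArg (fun v => g⁻¹ *ᵥ v) this
  simpa only [Matrix.mulVec_mulVec, Matrix.nonsing_inv_mul _ hg, Matrix.one_mulVec,
    ← mul_assoc, one_mul] using h2

/-- Each contraction becomes the trace of an endomorphism. A change of frame conjugates these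
endomorphisms and leaves their traces alone, which is how the tensor character of Ricci is proved.
-/
lemma ricci_form (C : StructConst) (g : Mat3) (x y : Fin 3 → ℝ) :
    x ⬝ᵥ (Matrix.of (ricci C g) *ᵥ y) = (rgt (connCoeff C g) (app (connCoeff C g) y x)).trace
      - (lft (connCoeff C g) y * rgt (connCoeff C g) x).trace
      - (rgt C y * rgt (connCoeff C g) x).trace := by
  generalize hγ : connCoeff C g = γ
  simp only [dotProduct, Matrix.mulVec, ricci, hγ, Matrix.trace, Matrix.diag, Matrix.mul_apply,
    rgt, lft, app, Matrix.of_apply]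
  simp only [Fin.sum_univ_three]
  ring

lemma FrameChange.ricci {P g : Mat3} {C C' : StructConst} (h : FrameChange P C C')
    (hP : IsUnit P.det) (hg : IsUnit g.det) :
    Matrix.of (ricci C' (Pᵀ * g * P)) = Pᵀ * Matrix.of (ricci C g) * P := by
  have hγ := h.connCoeff hP hg
  apply matrix_ext_mulVec
  intro y
  refine dotProduct_eq _ _ fun x => ?_
  rw [dotProduct_comm, dotProduct_comm _ x, ← Matrix.mulVec_mulVec, ← Matrix.mulVec_mulVec,
    Matrix.dotProduct_mulVec x Pᵀ, Matrix.vecMul_transpose, ricci_form, ricci_form, hγ,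
    trace_eq_of_mul_eq hP (hγ.rgt_mul _)]
  congr 1
  · congr 1
    refine (trace_eq_of_mul_eq hP ?_).symm
    rw [mul_assoc, hγ.rgt_mul, ← mul_assoc, hγ.lft_mul, mul_assoc]
  · refine (trace_eq_of_mul_eq hP ?_).symm
    rw [mul_assoc, hγ.rgt_mul, ← mul_assoc, h.rgt_mul, mul_assoc]

lemma inv_conj (P g : Mat3) :
    (Pᵀ * g * P)⁻¹ = P⁻¹ * g⁻¹ * P⁻¹ᵀ := by
  rw [Matrix.mul_inv_rev, Matrix.mul_inv_rev, Matrix.transpose_nonsing_inv, mul_assoc]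

/-- The trace of a bilinear form with respect to the metric. -/
lemma scalarCurv_eq_trace (C : StructConst) (g : Mat3) :
    scalarCurv C g = (g⁻¹ᵀ * Matrix.of (ricci C g)).trace := by
  simp only [scalarCurv, Matrix.trace, Matrix.diag, Matrix.mul_apply, Matrix.transpose_apply,
    Matrix.of_apply]
  exact Finset.sum_comm

lemma FrameChange.scalarCurv {P g : Mat3} {C C' : StructConst} (h : FrameChange P C C')
    (hP : IsUnit P.det) (hg : IsUnit g.det) :
    scalarCurv C' (Pᵀ * g * P) = scalarCurv C g := by
  rw [scalarCurv_eq_trace, scalarCurv_eq_trace, h.ricci hP hg, inv_conj]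
  symm
  apply trace_eq_of_mul_eq hP
  simp only [Matrix.transpose_mul, Matrix.transpose_transpose]
  have hP' : P⁻¹ᵀ * Pᵀ = 1 := by
    rw [← Matrix.transpose_mul, Matrix.mul_nonsing_inv _ hP, Matrix.transpose_one]
  calc g⁻¹ᵀ * Matrix.of (Bianchi.ricci C g) * P
      = g⁻¹ᵀ * 1 * Matrix.of (Bianchi.ricci C g) * P := by rw [mul_one]
    _ = 1 * g⁻¹ᵀ * (P⁻¹ᵀ * Pᵀ) * Matrix.of (Bianchi.ricci C g) * P := by rw [hP', one_mul]
    _ = _ := by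
      rw [← Matrix.mul_nonsing_inv _ hP]
      simp only [mul_assoc]

/-- The trace `A_k = C^i_{ik}`. -/
def trC (C : StructConst) (k : Fin 3) : ℝ := ∑ i, C i i k

/-- The divergence of a left-invariant endomorphism field, in terms of the structure constants. -/
def mixedDiv (C : StructConst) (K : Mat3) (j : Fin 3) : ℝ :=
  (∑ k, trC C k * K k j) - ∑ l, ∑ m, K l m * C m l j

/-- As for `ricci_form`, rewriting through traces makes the behaviour under a change of frame
immediate. -/
lemma mixedDiv_dotProduct (C : StructConst) (K : Mat3) (y : Fin 3 → ℝ) :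
    mixedDiv C K ⬝ᵥ y = (rgt C (K *ᵥ y)).trace - (K * rgt C y).trace := by
  simp only [dotProduct, Matrix.mulVec, Matrix.trace, Matrix.diag, Matrix.mul_apply, rgt,
    Matrix.of_apply, mixedDiv, trC, Fin.sum_univ_three]
  ring

lemma FrameChange.mixedDiv {P : Mat3} {C C' : StructConst} (h : FrameChange P C C')
    (hP : IsUnit P.det) (K : Mat3) :
    mixedDiv C' (P⁻¹ * K * P) = Pᵀ *ᵥ mixedDiv C K := by
  refine dotProduct_eq _ _ fun y => ?_
  rw [Matrix.mulVec_transpose, ← Matrix.dotProduct_mulVec, mixedDiv_dotProduct,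
    mixedDiv_dotProduct]
  have h1 : P *ᵥ ((P⁻¹ * K * P) *ᵥ y) = K *ᵥ (P *ᵥ y) := by
    rw [Matrix.mulVec_mulVec, Matrix.mulVec_mulVec, mul_assoc,
      Matrix.mul_nonsing_inv_cancel_left _ _ hP]
  rw [← h1, trace_eq_of_mul_eq hP (h.rgt_mul _)]
  congr 1
  refine (trace_eq_of_mul_eq hP ?_).symm
  rw [mul_assoc, h.rgt_mul, ← mul_assoc, ← mul_assoc, ← mul_assoc, ← mul_assoc,
    Matrix.mul_nonsing_inv _ hP, one_mul]

lemma FrameChange.trC {P : Mat3} {C C' : StructConst} (h : FrameChange P C C')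
    (hP : IsUnit P.det) : trC C' = Pᵀ *ᵥ trC C := by
  have hd : ∀ (C : StructConst) (y : Fin 3 → ℝ), Bianchi.trC C ⬝ᵥ y = (rgt C y).trace := by
    intro C y
    simp only [dotProduct, Matrix.trace, Matrix.diag, rgt, Matrix.of_apply, Bianchi.trC,
      Fin.sum_univ_three]
    ring
  refine dotProduct_eq _ _ fun y => ?_
  rw [Matrix.mulVec_transpose, ← Matrix.dotProduct_mulVec, hd, hd,
    trace_eq_of_mul_eq hP (h.rgt_mul _)]

end Bianchi
end

noncomputable section
namespace Bianchi

/-! ### Three-dimensional Lie algebras -/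

/-- `C` are the structure constants of a Lie algebra. -/
structure IsLie (C : StructConst) : Prop where
  antisymm : ∀ x y, app C x y = -app C y x
  jacobi : ∀ x y z, app C (app C x y) z + app C (app C y z) x + app C (app C z x) y = 0

lemma FrameChange.isLie {P : Mat3} {C C' : StructConst} (h : FrameChange P C C')
    (hP : IsUnit P.det) (hC : IsLie C) : IsLie C' := by
  have inj : ∀ x y, P *ᵥ x = P *ᵥ y → x = y := fun x y hxy => by
    have := congrArg (fun v => P⁻¹ *ᵥ v) hxy
    simpa only [Matrix.mulVec_mulVec, Matrix.nonsing_inv_mul _ hP, Matrix.one_mulVec] using this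
  refine ⟨fun x y => inj _ _ ?_, fun x y z => inj _ _ ?_⟩
  · rw [Matrix.mulVec_neg, ← h, ← h, hC.antisymm]
  · have hh : ∀ x y z, P *ᵥ app C' (app C' x y) z = app C (app C (P *ᵥ x) (P *ᵥ y)) (P *ᵥ z) :=
      fun x y z => by rw [h x y, h]
    rw [Matrix.mulVec_add, Matrix.mulVec_add, hh, hh, hh, Matrix.mulVec_zero, hC.jacobi]

lemma app_single (C : StructConst) (i j k : Fin 3) :
    app C (Pi.single i 1) (Pi.single j 1) k = C k i j := by
  simp [app, Pi.single_apply]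

lemma IsLie.anti {C : StructConst} (h : IsLie C) (k i j : Fin 3) : C k i j = -C k j i := by
  have := congrFun (h.antisymm (Pi.single i 1) (Pi.single j 1)) k
  simpa only [Pi.neg_apply, app_single] using this

lemma IsLie.self {C : StructConst} (h : IsLie C) (k i : Fin 3) : C k i i = 0 := by
  have := h.anti k i i
  linarith

lemma IsLie.jac {C : StructConst} (h : IsLie C) (i j k l : Fin 3) :
    ∑ m, (C m i j * C l m k + C m j k * C l m i + C m k i * C l m j) = 0 := by
  have key : ∀ i j k, app C (app C (Pi.single i 1) (Pi.single j 1)) (Pi.single k 1) l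
      = ∑ m, C m i j * C l m k := by
    intro i j k
    have h1 : app C (Pi.single i 1) (Pi.single j 1) = fun m => C m i j :=
      funext fun m => app_single C i j m
    rw [h1]
    simp [app, Pi.single_apply, mul_comm]
  have := congrFun (h.jacobi (Pi.single i 1) (Pi.single j 1) (Pi.single k 1)) l
  simp only [Pi.add_apply, key, Pi.zero_apply] at this
  simpa only [Finset.sum_add_distrib] using this


lemma connCoeff_one (C : StructConst) (l i j : Fin 3) :
    connCoeff C 1 l i j = (1 / 2) * (-C i j l + C j l i + C l i j) := by
  simp [connCoeff, Matrix.one_apply, Finset.sum_add_distrib]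

/-- A positive matrix factors as `Bᵀ * B`; the columns of `B⁻¹` are orthonormal for it. -/
lemma exists_orthonormal_frame {g : Mat3} (hg : g.PosDef) :
    ∃ P : Mat3, IsUnit P.det ∧ Pᵀ * g * P = 1 := by
  open scoped MatrixOrder in
  obtain ⟨B, hB⟩ := CStarAlgebra.nonneg_iff_eq_star_mul_self.mp hg.posSemidef.nonneg
  have hBt : star B = Bᵀ := by
    ext i j
    simp [Matrix.star_apply]
  rw [hBt] at hB
  have hdet : IsUnit B.det := by
    have h1 := hg.det_pos
    rw [hB, Matrix.det_mul, Matrix.det_transpose] at h1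
    exact isUnit_iff_ne_zero.mpr fun h0 => by simp [h0] at h1
  refine ⟨B⁻¹, by rw [Matrix.det_nonsing_inv]; exact hdet.ringInverse, ?_⟩
  rw [hB, mul_assoc, mul_assoc, Matrix.mul_nonsing_inv _ hdet, mul_one,
    ← Matrix.transpose_mul, Matrix.mul_nonsing_inv _ hdet, Matrix.transpose_one]

/-- The structure constants in the frame given by the columns of `P`. -/
def changeFrame (P : Mat3) (C : StructConst) : StructConst :=
  fun k i j => (P⁻¹ *ᵥ app C (P *ᵥ Pi.single i 1) (P *ᵥ Pi.single j 1)) k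

lemma app_sum (C : StructConst) (P : Mat3) (x y : Fin 3 → ℝ) :
    app C (P *ᵥ x) (P *ᵥ y)
      = ∑ i, ∑ j, (x i * y j) • app C (P *ᵥ Pi.single i 1) (P *ᵥ Pi.single j 1) := by
  ext l
  simp only [← rgt_mulVec C _ (P *ᵥ y), Finset.sum_apply, Pi.smul_apply, smul_eq_mul]
  simp only [rgt_mulVec, app, Matrix.mulVec_single_one, Matrix.col_apply]
  simp only [Matrix.mulVec, dotProduct, Fin.sum_univ_three]
  ring

lemma frameChange_changeFrame {P : Mat3} (hP : IsUnit P.det) (C : StructConst) :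
    FrameChange P C (changeFrame P C) := by
  intro x y
  have h : app (changeFrame P C) x y = P⁻¹ *ᵥ app C (P *ᵥ x) (P *ᵥ y) := by
    rw [app_sum]
    simp only [Matrix.mulVec_sum, Matrix.mulVec_smul]
    ext l
    simp only [Finset.sum_apply, Pi.smul_apply, smul_eq_mul, app, changeFrame]
    refine Finset.sum_congr rfl fun i _ => Finset.sum_congr rfl fun j _ => by ring
  rw [h, Matrix.mulVec_mulVec, Matrix.mul_nonsing_inv _ hP, Matrix.one_mulVec]

/-- The contracted Bianchi identity in an orthonormal frame. -/
lemma mixedDiv_ricci_one {C : StructConst} (hC : IsLie C) :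
    mixedDiv C (Matrix.of (ricci C 1)) = 0 := by
  have hJ0 := hC.jac 0 1 2 0
  have hJ1 := hC.jac 0 1 2 1
  have hJ2 := hC.jac 0 1 2 2
  ext j
  simp only [Pi.zero_apply, mixedDiv, trC, ricci, connCoeff_one, Matrix.of_apply]
  simp only [Fin.sum_univ_three, hC.self, fun k => hC.anti k 1 0, fun k => hC.anti k 2 1,
    fun k => hC.anti k 0 2] at hJ0 hJ1 hJ2 ⊢
  -- In general div Ric = dR/2, and R is constant on the slice. In terms of the nine independent
  -- structure constants the claim is cubic, and it is a quadratic combination of the three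
  -- components of the Jacobi identity.
  fin_cases j <;> simp only [Fin.zero_eta, Fin.mk_one, Fin.reduceFinMk, hC.self,
    fun k => hC.anti k 1 0, fun k => hC.anti k 2 1, fun k => hC.anti k 0 2]
  · linear_combination (-1) * C 0 1 2 * hJ0 + (-1) * C 1 1 2 * hJ1 + (-1) * C 2 1 2 * hJ2 + (-1) * C 0 2 0 * hJ1 + (1) * C 1 2 0 * hJ0 + (-1) * C 0 0 1 * hJ2 + (1) * C 2 0 1 * hJ0
  · linear_combination (1) * C 0 1 2 * hJ1 + (-1) * C 1 1 2 * hJ0 + (-1) * C 0 2 0 * hJ0 + (-1) * C 1 2 0 * hJ1 + (-1) * C 2 2 0 * hJ2 + (-1) * C 1 0 1 * hJ2 + (1) * C 2 0 1 * hJ1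
  · linear_combination (1) * C 0 1 2 * hJ2 + (-1) * C 2 1 2 * hJ0 + (1) * C 1 2 0 * hJ2 + (-1) * C 2 2 0 * hJ1 + (-1) * C 0 0 1 * hJ0 + (-1) * C 1 0 1 * hJ1 + (-1) * C 2 0 1 * hJ2

lemma mul_inv_transpose_conj {P g : Mat3} (hP : IsUnit P.det) (R : Mat3) :
    (Pᵀ * g * P)⁻¹ * (Pᵀ * R * P) = P⁻¹ * (g⁻¹ * R) * P := by
  have hP' : P⁻¹ᵀ * Pᵀ = 1 := by
    rw [← Matrix.transpose_mul, Matrix.mul_nonsing_inv _ hP, Matrix.transpose_one]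
  calc (Pᵀ * g * P)⁻¹ * (Pᵀ * R * P) = P⁻¹ * g⁻¹ * (P⁻¹ᵀ * Pᵀ) * R * P := by
        rw [inv_conj]; simp only [mul_assoc]
    _ = _ := by rw [hP', mul_one]; simp only [mul_assoc]

/-- The contracted Bianchi identity. -/
lemma mixedDiv_ricci {C : StructConst} (hC : IsLie C) {g : Mat3} (hg : g.PosDef) :
    mixedDiv C (g⁻¹ * Matrix.of (ricci C g)) = 0 := by
  obtain ⟨P, hP, hPg⟩ := exists_orthonormal_frame hg
  have h := frameChange_changeFrame hP C
  have h1 : mixedDiv (changeFrame P C)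
      ((Pᵀ * g * P)⁻¹ * Matrix.of (ricci (changeFrame P C) (Pᵀ * g * P))) = 0 := by
    rw [hPg, inv_one, one_mul]
    exact mixedDiv_ricci_one (h.isLie hP hC)
  rw [h.ricci hP hg.det_pos.ne'.isUnit, mul_inv_transpose_conj hP, h.mixedDiv hP] at h1
  have hT : IsUnit Pᵀ.det := by rwa [Matrix.det_transpose]
  have := congrArg (fun v => (Pᵀ)⁻¹ *ᵥ v) h1
  simpa only [Matrix.mulVec_mulVec, Matrix.nonsing_inv_mul _ hT, Matrix.one_mulVec,
    Matrix.mulVec_zero] using this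

/-- The scalar curvature in an orthonormal frame. -/
lemma scalarCurv_one {C : StructConst} (hC : IsLie C) :
    ∃ (N : Mat3) (a : Fin 3 → ℝ), N.IsSymm ∧ N *ᵥ a = 0 ∧
      scalarCurv C 1 = -6 * (a ⬝ᵥ a) - (N * N).trace + (1 / 2) * N.trace ^ 2 ∧
      ∀ x y, app C x y = N *ᵥ (crossProduct x y) + (a ⬝ᵥ x) • y - (a ⬝ᵥ y) • x := by
  -- The dual of `C` on its lower indices is a 3×3 matrix: `N` is its symmetric part, and `a`, which
  -- encodes the antisymmetric part, is -1/2 times `trC C`. The Jacobi identity reduces to N a = 0.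
  refine ⟨!![C 0 1 2, (C 1 1 2 + C 0 2 0) / 2, (C 2 1 2 + C 0 0 1) / 2;
    (C 1 1 2 + C 0 2 0) / 2, C 1 2 0, (C 2 2 0 + C 1 0 1) / 2;
    (C 2 1 2 + C 0 0 1) / 2, (C 2 2 0 + C 1 0 1) / 2, C 2 0 1],
    ![(C 1 0 1 - C 2 2 0) / 2, (C 2 1 2 - C 0 0 1) / 2, (C 0 2 0 - C 1 1 2) / 2], ?_, ?_, ?_, ?_⟩
  · ext i j
    fin_cases i <;> fin_cases j <;> simp
  · have hJ0 := hC.jac 0 1 2 0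
    have hJ1 := hC.jac 0 1 2 1
    have hJ2 := hC.jac 0 1 2 2
    simp only [Fin.sum_univ_three, hC.self, fun k => hC.anti k 1 0, fun k => hC.anti k 2 1,
      fun k => hC.anti k 0 2] at hJ0 hJ1 hJ2
    ext l
    fin_cases l <;> simp [Matrix.mulVec, dotProduct, Fin.sum_univ_three]
    · linear_combination (1 / 2) * hJ0
    · linear_combination (1 / 2) * hJ1
    · linear_combination (1 / 2) * hJ2
  · simp only [scalarCurv, ricci, connCoeff_one, inv_one, Fin.sum_univ_three, hC.self,
      fun k => hC.anti k 1 0, fun k => hC.anti k 2 1, fun k => hC.anti k 0 2, Matrix.one_apply]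
    simp [Matrix.trace, dotProduct, Fin.sum_univ_three]
    ring
  · intro x y
    ext l
    fin_cases l <;> simp [app, dotProduct, Fin.sum_univ_three, crossProduct,
      hC.self, fun k => hC.anti k 1 0, fun k => hC.anti k 2 1, fun k => hC.anti k 0 2] <;> ring

end Bianchi
end

noncomputable section
namespace Bianchi

/-! ### The sign of the scalar curvature -/

lemma transpose_mulVec_cross (L : Mat3) (x y : Fin 3 → ℝ) :
    Lᵀ *ᵥ (crossProduct (L *ᵥ x) (L *ᵥ y)) = L.det • crossProduct x y := by
  ext l
  fin_cases l <;>
    simp [crossProduct, Matrix.mulVec, dotProduct, Fin.sum_univ_three, Matrix.det_fin_three] <;>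
    ring

/-- A symmetric matrix `N` with `2 tr N² < (tr N)²` is definite. -/
lemma trace_mul_quadForm_pos {N : Mat3} (hN : N.IsSymm)
    (h : (N * N).trace < (1 / 2) * N.trace ^ 2) {x : Fin 3 → ℝ} (hx : x ≠ 0) :
    0 < N.trace * (x ⬝ᵥ (N *ᵥ x)) := by
  have hxx : 0 < x ⬝ᵥ x := by
    have := Matrix.dotProduct_star_self_pos_iff.mpr hx
    simpa using this
  set t := N.trace with ht
  -- Cauchy-Schwarz for N - (t/2)·1 against x ⊗ x. By hypothesis |N - (t/2)·1|² = tr N² - t²/4 <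
  -- t²/4, so x·Nx differs from (t/2)|x|² by less than |t||x|²/2 and has the sign of t.
  have cs := Finset.sum_mul_sq_le_sq_mul_sq (Finset.univ : Finset (Fin 3 × Fin 3))
    (fun p => N p.1 p.2 - t / 2 * (1 : Mat3) p.1 p.2) (fun p => x p.1 * x p.2)
  have e1 : ∑ p : Fin 3 × Fin 3, (N p.1 p.2 - t / 2 * (1 : Mat3) p.1 p.2) * (x p.1 * x p.2)
      = x ⬝ᵥ (N *ᵥ x) - t / 2 * (x ⬝ᵥ x) := by
    simp [Fintype.sum_prod_type, Matrix.mulVec, dotProduct, Fin.sum_univ_three, Matrix.one_apply]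
    ring
  have e2 : ∑ p : Fin 3 × Fin 3, (N p.1 p.2 - t / 2 * (1 : Mat3) p.1 p.2) ^ 2
      = (N * N).trace - t ^ 2 / 4 := by
    have h10 := hN.apply 0 1
    have h20 := hN.apply 0 2
    have h21 := hN.apply 1 2
    rw [ht]
    simp [Fintype.sum_prod_type, Fin.sum_univ_three, Matrix.one_apply, Matrix.trace,
      Matrix.mul_apply, h10, h20, h21]
    ring
  have e3 : ∑ p : Fin 3 × Fin 3, (x p.1 * x p.2) ^ 2 = (x ⬝ᵥ x) ^ 2 := by
    simp [Fintype.sum_prod_type, dotProduct, Fin.sum_univ_three]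
    ring
  rw [e1, e2, e3] at cs
  have h4 : ((N * N).trace - t ^ 2 / 4) * (x ⬝ᵥ x) ^ 2 < (t ^ 2 / 4) * (x ⬝ᵥ x) ^ 2 :=
    mul_lt_mul_of_pos_right (by linarith) (by positivity)
  have h5 : 0 < (t * (x ⬝ᵥ (N *ᵥ x))) * (x ⬝ᵥ x) := by
    nlinarith [sq_nonneg (x ⬝ᵥ (N *ᵥ x))]
  exact (pos_iff_pos_of_mul_pos h5).mpr hxx

lemma exists_so3_of_posDef {N : Mat3} (hN : N.PosDef) :
    ∃ L : Mat3, IsUnit L.det ∧ N = L * Lᵀ := by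
  obtain ⟨P, hP, hPN⟩ := exists_orthonormal_frame hN
  have hT : IsUnit Pᵀ.det := by rwa [Matrix.det_transpose]
  refine ⟨(Pᵀ)⁻¹, by rw [Matrix.det_nonsing_inv]; exact hT.ringInverse, ?_⟩
  rw [Matrix.transpose_nonsing_inv, Matrix.transpose_transpose]
  calc N = (Pᵀ)⁻¹ * (Pᵀ * N * P) * P⁻¹ := by
        rw [mul_assoc, mul_assoc, mul_assoc, Matrix.mul_nonsing_inv _ hP, mul_one,
          Matrix.nonsing_inv_mul_cancel_left _ _ hT]
    _ = _ := by rw [hPN, mul_one]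

/-- `C` are the structure constants of a Lie algebra isomorphic to `so(3)`. -/
def IsSO3 (C : StructConst) : Prop :=
  ∃ L : Mat3, IsUnit L.det ∧ ∀ x y, app C (L *ᵥ x) (L *ᵥ y) = L *ᵥ crossProduct x y

/-- Since Lᵀ(Lx × Ly) = (det L) x × y, the matrix sL intertwines the bracket with the cross product
once s ε det L = 1; this fixes s = ε / det L. -/
lemma isSO3_of_definite {C : StructConst} {L : Mat3} (hL : IsUnit L.det) {ε : ℝ} (hε : ε ^ 2 = 1)
    (h : ∀ x y, app C x y = ε • ((L * Lᵀ) *ᵥ crossProduct x y)) : IsSO3 C := by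
  have hd : L.det ≠ 0 := hL.ne_zero
  have hε0 : ε ≠ 0 := fun h0 => by simp [h0] at hε
  refine ⟨(ε / L.det) • L, ?_, fun x y => ?_⟩
  · rw [Matrix.det_smul]
    exact isUnit_iff_ne_zero.mpr (mul_ne_zero (pow_ne_zero _ (div_ne_zero hε0 hd)) hd)
  · rw [h]
    simp only [Matrix.smul_mulVec, map_smul, LinearMap.smul_apply, Matrix.mulVec_smul,
      ← Matrix.mulVec_mulVec, transpose_mulVec_cross, smul_smul]
    congr 1
    field_simp
    rw [hε]

/-- In an orthonormal frame R = -6|a|² - tr N² + (tr N)²/2. If R > 0 then N is definite, so N a = 0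
forces a = 0 and the bracket is N(x × y), a form of so(3). -/
lemma scalarCurv_nonpos {C : StructConst} (hC : IsLie C) (hso : ¬ IsSO3 C) {g : Mat3}
    (hg : g.PosDef) : scalarCurv C g ≤ 0 := by
  by_contra! hpos
  obtain ⟨P, hP, hPg⟩ := exists_orthonormal_frame hg
  have h := frameChange_changeFrame hP C
  rw [← h.scalarCurv hP hg.det_pos.ne'.isUnit, hPg] at hpos
  obtain ⟨N, a, hN, hNa, hR, happ⟩ := scalarCurv_one (h.isLie hP hC)
  rw [hR] at hpos
  have haa : 0 ≤ a ⬝ᵥ a := by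
    simpa using dotProduct_self_star_nonneg a
  have hlt : (N * N).trace < (1 / 2) * N.trace ^ 2 := by linarith
  have ha : a = 0 := by
    by_contra ha
    have := trace_mul_quadForm_pos hN hlt ha
    simp [hNa] at this
  have ht : N.trace ≠ 0 := fun h0 => by
    have := trace_mul_quadForm_pos hN hlt (x := Pi.single 0 1) (by simp)
    simp [h0] at this
  subst ha
  simp only [zero_dotProduct, zero_smul, add_zero, sub_zero] at happ
  have hH : N.IsHermitian := by
    rw [Matrix.IsHermitian, Matrix.conjTranspose_eq_transpose_of_trivial]
    exact hN
  suffices hs : IsSO3 (changeFrame P C) by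
    obtain ⟨L, hL, hLx⟩ := hs
    refine hso ⟨P * L, by rw [Matrix.det_mul]; exact hP.mul hL, fun x y => ?_⟩
    rw [← Matrix.mulVec_mulVec, ← Matrix.mulVec_mulVec, h, hLx, Matrix.mulVec_mulVec]
  rcases lt_or_gt_of_ne ht with ht | ht
  · have hpd : (-N).PosDef := by
      refine .of_dotProduct_mulVec_pos hH.neg fun x hx => ?_
      have := trace_mul_quadForm_pos hN hlt hx
      simp only [star_trivial, Matrix.neg_mulVec, dotProduct_neg]
      nlinarith
    obtain ⟨L, hL, hNL⟩ := exists_so3_of_posDef hpd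
    refine isSO3_of_definite hL (ε := -1) (by norm_num) fun x y => ?_
    rw [happ, ← hNL, Matrix.neg_mulVec, smul_neg, neg_smul, one_smul, neg_neg]
  · have hpd : N.PosDef := by
      refine .of_dotProduct_mulVec_pos hH fun x hx => ?_
      have := trace_mul_quadForm_pos hN hlt hx
      simp only [star_trivial]
      exact (pos_iff_pos_of_mul_pos this).mp ht
    obtain ⟨L, hL, hNL⟩ := exists_so3_of_posDef hpd
    refine isSO3_of_definite hL (ε := 1) (by norm_num) fun x y => ?_
    rw [happ, ← hNL, one_smul]

/-! ### The Lie algebra of a Lie group -/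

section LieGroup

variable {G : Type*} [TopologicalSpace G] [ChartedSpace E3 G] [Group G]
    [LieGroup 𝓘(ℝ, E3) ∞ G] (e : Module.Basis (Fin 3) ℝ (LieAlg G))

lemma lieGroup_minSmoothness : LieGroup 𝓘(ℝ, E3) (minSmoothness ℝ 3) G := by
  rw [minSmoothness_of_isRCLikeNormedField]
  exact LieGroup.of_le (n := ∞) (WithTop.coe_le_coe.mpr le_top)

lemma repr_bracket (x y : LieAlg G) :
    ⇑(e.repr ⁅x, y⁆) = app (structConst e) (e.repr x) (e.repr y) := by
  have : LieGroup 𝓘(ℝ, E3) (minSmoothness ℝ 3) G := lieGroup_minSmoothness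
  conv_lhs => rw [← e.sum_repr x, ← e.sum_repr y]
  ext k
  simp only [sum_lie, lie_sum, smul_lie, lie_smul, map_sum, map_smul, Finsupp.coe_finsetSum,
    Finset.sum_apply, Finsupp.coe_smul, Pi.smul_apply, smul_eq_mul, app, structConst]
  simp only [Finset.mul_sum]
  rw [Finset.sum_comm]
  refine Finset.sum_congr rfl fun i _ => Finset.sum_congr rfl fun j _ => by ring

lemma isLie_structConst : IsLie (structConst e) := by
  have : LieGroup 𝓘(ℝ, E3) (minSmoothness ℝ 3) G := lieGroup_minSmoothness
  have hx : ∀ x : Fin 3 → ℝ, ∃ X : LieAlg G, ⇑(e.repr X) = x := fun x =>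
    ⟨e.equivFun.symm x, by rw [← e.equivFun_apply, LinearEquiv.apply_symm_apply]⟩
  refine ⟨fun x y => ?_, fun x y z => ?_⟩
  · obtain ⟨X, rfl⟩ := hx x
    obtain ⟨Y, rfl⟩ := hx y
    rw [← repr_bracket, ← repr_bracket, ← lie_skew X Y, map_neg, Finsupp.coe_neg]
  · obtain ⟨X, rfl⟩ := hx x
    obtain ⟨Y, rfl⟩ := hx y
    obtain ⟨Z, rfl⟩ := hx z
    simp only [← repr_bracket, ← Finsupp.coe_add, ← map_add]
    have := lie_jacobi Z X Y
    rw [← lie_skew ⁅X, Y⁆ Z, ← lie_skew ⁅Y, Z⁆ X, ← lie_skew ⁅Z, X⁆ Y, ← neg_add, ← neg_add]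
    rw [this]
    simp

lemma isTypeIX_of_isSO3 (h : IsSO3 (structConst e)) : IsTypeIX G := by
  obtain ⟨L, hL, hLx⟩ := h
  let b := e.map (Matrix.toLinearEquiv e L hL)
  have hb : ∀ i, ⇑(e.repr (b i)) = L *ᵥ Pi.single i 1 := by
    intro i
    simp [b, Matrix.toLinearEquiv]
    ext k
    simp [Finset.sum_apply, Finsupp.single_apply]
  have key : ∀ i j k, crossProduct (Pi.single i (1 : ℝ)) (Pi.single j 1) = Pi.single k 1 →
      ⁅b i, b j⁆ = b k := by
    intro i j k hc
    apply e.repr.injective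
    apply DFunLike.coe_injective
    rw [repr_bracket, hb, hb, hb, hLx, hc]
  refine ⟨b, key _ _ _ ?_, key _ _ _ ?_, key _ _ _ ?_⟩ <;>
  · ext i
    fin_cases i <;> simp [crossProduct]

end LieGroup
end Bianchi
end

noncomputable section
namespace Bianchi

/-! ### Time derivatives of the metric quantities -/

lemma hasDerivWithinAt_inv_apply {g : ℝ → Mat3} {g' : Mat3} {s : Set ℝ} {t : ℝ}
    (hg : IsUnit (g t).det) (h : ∀ i j, HasDerivWithinAt (fun r => g r i j) (g' i j) s t)
    (i j : Fin 3) :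
    HasDerivWithinAt (fun r => (g r)⁻¹ i j) ((-((g t)⁻¹ * g' * (g t)⁻¹)) i j) s t := by
  -- Any Banach algebra norm on matrices serves here: it gives access to the derivative of
  -- inversion, and the result is read off entrywise.
  let _ : NormedRing Mat3 := Matrix.linftyOpNormedRing
  let _ : NormedAlgebra ℝ Mat3 := Matrix.linftyOpNormedAlgebra
  have h1 : HasDerivWithinAt g g' s t :=
    hasDerivWithinAt_pi.mpr fun i => hasDerivWithinAt_pi.mpr fun j => h i j
  have hu : IsUnit (g t) := (Matrix.isUnit_iff_isUnit_det _).mpr hg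
  obtain ⟨u, hu⟩ := hu
  have h2 := hasFDerivAt_ringInverse (𝕜 := ℝ) u
  rw [hu] at h2
  have h3 := h2.comp_hasDerivWithinAt t h1
  have hi : (↑u⁻¹ : Mat3) = (g t)⁻¹ := by
    rw [Matrix.nonsing_inv_eq_ringInverse, ← hu, Ring.inverse_unit]
  rw [hi] at h3
  have h4 := hasDerivWithinAt_pi.mp (hasDerivWithinAt_pi.mp h3 i) j
  simpa [Matrix.nonsing_inv_eq_ringInverse, Function.comp_def] using h4

lemma hasDerivWithinAt_connCoeff (C : StructConst) {g : ℝ → Mat3} {g' h' : Mat3} {s : Set ℝ}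
    {t : ℝ} (h : ∀ i j, HasDerivWithinAt (fun r => g r i j) (g' i j) s t)
    (hi : ∀ i j, HasDerivWithinAt (fun r => (g r)⁻¹ i j) (h' i j) s t) (l i j : Fin 3) :
    HasDerivWithinAt (fun r => connCoeff C (g r) l i j) ((1 / 2) * ∑ k, (h' l k *
      (∑ m, (-(C m j k * g t i m) + C m k i * g t j m + C m i j * g t k m)) + (g t)⁻¹ l k *
      ∑ m, (-(C m j k * g' i m) + C m k i * g' j m + C m i j * g' k m))) s t := by
  unfold connCoeff
  refine (HasDerivWithinAt.fun_sum fun k _ => (hi l k).mul ?_).const_mul _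
  refine HasDerivWithinAt.fun_sum fun m _ => ?_
  exact (((h i m).const_mul _).neg.add ((h j m).const_mul _)).add ((h k m).const_mul _)

lemma hasDerivWithinAt_ricci (C : StructConst) {g : ℝ → Mat3} {γ' : StructConst} {s : Set ℝ}
    {t : ℝ} (h : ∀ l i j, HasDerivWithinAt (fun r => connCoeff C (g r) l i j) (γ' l i j) s t)
    (i j : Fin 3) :
    HasDerivWithinAt (fun r => ricci C (g r) i j) (∑ l, ∑ m,
      ((γ' l l m * connCoeff C (g t) m j i + connCoeff C (g t) l l m * γ' m j i)
      - (γ' m j l * connCoeff C (g t) l m i + connCoeff C (g t) m j l * γ' l m i)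
      - C l m j * γ' m l i)) s t := by
  unfold ricci
  refine HasDerivWithinAt.fun_sum fun l _ => HasDerivWithinAt.fun_sum fun m _ => ?_
  exact (((h l l m).mul (h m j i)).sub ((h m j l).mul (h l m i))).sub ((h m l i).const_mul _)

/-- With ġ = -2k the classical variation is 2⟨k, Ric⟩ - 2∇ⁱ∇ʲk_{ij} plus a Laplacian of H, which
vanishes by homogeneity. The divergence of a left-invariant covector is its contraction with `trC
C`. At an instant with g = 1 all this is a polynomial identity. -/
lemma hasDerivWithinAt_scalarCurv_one {C : StructConst} (hC : IsLie C) {g : ℝ → Mat3} {k : Mat3}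
    {s : Set ℝ} {t : ℝ} (hk : k.IsSymm)
    (h : ∀ i j, HasDerivWithinAt (fun r => g r i j) (-2 * k i j) s t) (hg : g t = 1) :
    HasDerivWithinAt (fun r => scalarCurv C (g r))
      (2 * (k * Matrix.of (ricci C 1)).trace - 2 * (trC C ⬝ᵥ mixedDiv C k)) s t := by
  have hi : ∀ i j, HasDerivWithinAt (fun r => (g r)⁻¹ i j) (2 * k i j) s t := by
    intro i j
    have := hasDerivWithinAt_inv_apply (g := g) (g' := Matrix.of fun i j => -2 * k i j)
      (by rw [hg]; simp) (fun i j => by simpa using h i j) i j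
    rw [hg] at this
    simpa using this
  have h1 := hasDerivWithinAt_connCoeff (g' := Matrix.of fun i j => -2 * k i j)
    (h' := Matrix.of fun i j => 2 * k i j) C (fun i j => by simpa using h i j)
    (fun i j => by simpa using hi i j)
  have h2 := hasDerivWithinAt_ricci C h1
  unfold scalarCurv
  have h3 := HasDerivWithinAt.fun_sum (u := Finset.univ) fun i _ =>
    HasDerivWithinAt.fun_sum (u := Finset.univ) fun j _ => (hi i j).mul (h2 i j)
  refine h3.congr_deriv ?_
  have e1 : ∑ i, ∑ j, 2 * k i j * ricci C 1 i j
      = 2 * (k * Matrix.of (ricci C 1)).trace := by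
    simp only [Matrix.trace, Matrix.diag, Matrix.mul_apply, Matrix.of_apply, Finset.mul_sum]
    rw [Finset.sum_comm]
    refine Finset.sum_congr rfl fun i _ => Finset.sum_congr rfl fun j _ => ?_
    rw [← hk.apply i j, mul_assoc]
  have k10 := hk.apply 0 1
  have k20 := hk.apply 0 2
  have k21 := hk.apply 1 2
  simp only [hg, inv_one, Matrix.one_apply, ite_mul, zero_mul, one_mul, mul_ite, mul_zero,
    mul_one, Finset.sum_add_distrib, Finset.sum_ite_eq, Finset.mem_univ, if_true,
    Matrix.of_apply, connCoeff_one]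
  rw [e1, sub_eq_add_neg]
  congr 1
  simp only [Fin.sum_univ_three, hC.self, fun k => hC.anti k 1 0, fun k => hC.anti k 2 1,
    fun k => hC.anti k 0 2, dotProduct, mixedDiv, trC, k10, k20, k21, Fin.reduceEq, if_true,
    if_false]
  ring

/-- The variation of the scalar curvature. -/
lemma hasDerivWithinAt_scalarCurv {C : StructConst} (hC : IsLie C) {g : ℝ → Mat3} {k : Mat3}
    {s : Set ℝ} {t : ℝ} (hk : k.IsSymm) (hpd : ∀ r ∈ s, (g r).PosDef) (ht : t ∈ s)
    (h : ∀ i j, HasDerivWithinAt (fun r => g r i j) (-2 * k i j) s t) :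
    HasDerivWithinAt (fun r => scalarCurv C (g r))
      (2 * ((g t)⁻¹ * k * ((g t)⁻¹ * Matrix.of (ricci C (g t)))).trace
        - 2 * (trC C ⬝ᵥ ((g t)⁻¹ *ᵥ mixedDiv C ((g t)⁻¹ * k)))) s t := by
  obtain ⟨P, hP, hPg⟩ := exists_orthonormal_frame (hpd t ht)
  have hF := frameChange_changeFrame hP C
  have hdet : ∀ r ∈ s, IsUnit (g r).det := fun r hr => (hpd r hr).det_pos.ne'.isUnit
  have hd : ∀ i j, HasDerivWithinAt (fun r => (Pᵀ * g r * P) i j)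
      (-2 * (Pᵀ * k * P) i j) s t := by
    intro i j
    simp only [Matrix.mul_apply, Finset.mul_sum, Finset.sum_mul]
    refine HasDerivWithinAt.fun_sum fun a _ => HasDerivWithinAt.fun_sum fun b _ => ?_
    exact (((h b a).const_mul (Pᵀ i b)).mul_const (P a j)).congr_deriv (by ring)
  have hk' : (Pᵀ * k * P).IsSymm := by
    rw [Matrix.IsSymm, Matrix.transpose_mul, Matrix.transpose_mul, Matrix.transpose_transpose,
      hk, mul_assoc]
  have h1 := hasDerivWithinAt_scalarCurv_one (hF.isLie hP hC) hk' hd hPg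
  have h2 : HasDerivWithinAt (fun r => scalarCurv C (g r)) _ s t :=
    h1.congr (fun r hr => (hF.scalarCurv hP (hdet r hr)).symm) (hF.scalarCurv hP (hdet t ht)).symm
  refine h2.congr_deriv ?_
  have e1 : Matrix.of (ricci (changeFrame P C) 1) = Pᵀ * Matrix.of (ricci C (g t)) * P := by
    rw [← hF.ricci hP (hdet t ht), hPg]
  have e2 : ∀ R : Mat3, Pᵀ * R * P = P⁻¹ * ((g t)⁻¹ * R) * P := by
    intro R
    rw [← mul_inv_transpose_conj hP, hPg, inv_one, one_mul]
  have e3 : P * Pᵀ = (g t)⁻¹ := by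
    have := inv_conj P (g t)
    rw [hPg, inv_one] at this
    calc P * Pᵀ = P * (P⁻¹ * (g t)⁻¹ * P⁻¹ᵀ) * Pᵀ := by rw [← this, mul_one]
      _ = (P * P⁻¹) * (g t)⁻¹ * (P * P⁻¹)ᵀ := by
        rw [Matrix.transpose_mul]; simp only [mul_assoc]
      _ = _ := by rw [Matrix.mul_nonsing_inv _ hP, one_mul, Matrix.transpose_one, mul_one]
  congr 2
  · rw [e1, e2 k, e2]
    refine (trace_eq_of_mul_eq hP ?_).symm
    simp only [mul_assoc, Matrix.mul_nonsing_inv_cancel_left _ _ hP]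
  · rw [e2 k, hF.mixedDiv hP, hF.trC hP, ← e3, ← Matrix.mulVec_mulVec,
      Matrix.mulVec_transpose P (trC C), ← Matrix.dotProduct_mulVec]

end Bianchi
end

noncomputable section
namespace Bianchi

/-! ### Mixed components of the tensors -/

lemma mixedDiv_add (C : StructConst) (A B : Mat3) :
    mixedDiv C (A + B) = mixedDiv C A + mixedDiv C B := by
  ext j
  simp only [mixedDiv, Matrix.add_apply, Pi.add_apply, mul_add, add_mul, Finset.sum_add_distrib]
  ring

lemma mixedDiv_smul (C : StructConst) (a : ℝ) (A : Mat3) :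
    mixedDiv C (a • A) = a • mixedDiv C A := by
  ext j
  simp only [mixedDiv, Matrix.smul_apply, Pi.smul_apply, smul_eq_mul, mul_sub, Finset.mul_sum]
  congr 1
  · exact Finset.sum_congr rfl fun k _ => by ring
  · exact Finset.sum_congr rfl fun l _ => Finset.sum_congr rfl fun m _ => by ring

lemma mixedDiv_one (C : StructConst) : mixedDiv C 1 = 0 := by
  ext j
  simp [mixedDiv, trC, Matrix.one_apply]

namespace State

/-- The symmetries of the fields. -/
structure Regular (v : State) : Prop where
  g_posDef : v.g.PosDef
  k_symm : v.k.IsSymm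
  F_antisymm : v.Fᵀ = -v.F

/-- The second fundamental form with mixed indices. -/
def K (v : State) : Mat3 := v.g⁻¹ * v.k

/-- The total energy-momentum tensor `T_{ij} + τ_{ij} + ρ u_i u_j`. -/
def stress (m : ℝ) (v : State) : Mat3 :=
  Matrix.of fun i j => v.T m i j + v.τ i j + v.ρ * v.uLow i * v.uLow j

/-- The total energy density `T_{00} + τ_{00} + ρ (u_0)²`. -/
def energy (m : ℝ) (v : State) : ℝ := v.T00 m + v.τ00 + v.ρ * v.u0 ^ 2

/-- The total momentum density `τ_{0j} + ρ u_0 u_j`. -/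
def current (v : State) (j : Fin 3) : ℝ := v.τ0 j - v.ρ * v.u0 * v.uLow j

/-- `k_{ij} u^i u^j`. -/
def kuu (v : State) : ℝ := ∑ i, ∑ j, v.k i j * v.u i * v.u j

variable {v : State} {C : StructConst} {m Λ : ℝ}

lemma Regular.isUnit_det (hv : v.Regular) : IsUnit v.g.det := hv.g_posDef.det_pos.ne'.isUnit

lemma Regular.g_symm (hv : v.Regular) : v.g.IsSymm := by
  have := hv.g_posDef.isHermitian
  rwa [Matrix.IsHermitian, Matrix.conjTranspose_eq_transpose_of_trivial] at this

lemma Regular.inv_symm (hv : v.Regular) : v.g⁻¹.IsSymm := by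
  rw [Matrix.IsSymm, Matrix.transpose_nonsing_inv, hv.g_symm]

lemma Regular.g_mul_K (hv : v.Regular) : v.g * v.K = v.k := by
  rw [K, Matrix.mul_nonsing_inv_cancel_left _ _ hv.isUnit_det]

lemma Regular.K_mul_inv_symm (hv : v.Regular) : (v.K * v.g⁻¹).IsSymm := by
  rw [Matrix.IsSymm, K, Matrix.transpose_mul, Matrix.transpose_mul, hv.inv_symm, hv.k_symm,
    mul_assoc]

lemma Regular.F_anti (hv : v.Regular) (i j : Fin 3) : v.F i j = -v.F j i := by
  have := congrFun (congrFun hv.F_antisymm j) i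
  simpa using this

lemma Regular.H_eq (hv : v.Regular) : v.H = v.K.trace := by
  simp only [H, K, Matrix.trace, Matrix.diag, Matrix.mul_apply]
  exact Finset.sum_congr rfl fun i _ => Finset.sum_congr rfl fun j _ => by
    rw [hv.k_symm.apply]

lemma Regular.normSqK_eq (hv : v.Regular) : v.normSqK = (v.K * v.K).trace := by
  have hk := fun i j => hv.k_symm.apply i j
  have hh := fun i j => hv.inv_symm.apply i j
  simp only [normSqK, K, Matrix.trace, Matrix.diag, Matrix.mul_apply, Fin.sum_univ_three]
  simp only [hk 0 1, hk 0 2, hk 1 2, hh 0 1, hh 0 2, hh 1 2]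
  ring

lemma FUp_eq (hv : v.Regular) : Matrix.of v.FUp = v.g⁻¹ * v.F * v.g⁻¹ := by
  ext i j
  simp only [FUp, Matrix.mul_apply, Matrix.of_apply, Finset.sum_mul]
  rw [Finset.sum_comm]
  refine Finset.sum_congr rfl fun b _ => Finset.sum_congr rfl fun a _ => ?_
  rw [hv.inv_symm.apply b j]
  ring

lemma Regular.FUp_anti (hv : v.Regular) (i j : Fin 3) : v.FUp i j = -v.FUp j i := by
  simp only [FUp, ← Finset.sum_neg_distrib]
  rw [Finset.sum_comm]
  refine Finset.sum_congr rfl fun b _ => Finset.sum_congr rfl fun a _ => ?_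
  rw [hv.F_anti]
  ring

lemma uLow_eq : v.uLow = v.g *ᵥ v.u := rfl

lemma ELow_eq : v.ELow = v.g *ᵥ v.E := rfl

lemma Regular.inv_mul_uLow (hv : v.Regular) : v.g⁻¹ *ᵥ v.uLow = v.u := by
  rw [uLow_eq, Matrix.mulVec_mulVec, Matrix.nonsing_inv_mul _ hv.isUnit_det, Matrix.one_mulVec]

lemma Regular.inv_mul_ELow (hv : v.Regular) : v.g⁻¹ *ᵥ v.ELow = v.E := by
  rw [ELow_eq, Matrix.mulVec_mulVec, Matrix.nonsing_inv_mul _ hv.isUnit_det, Matrix.one_mulVec]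

lemma Regular.inv_mul_T (hv : v.Regular) :
    v.g⁻¹ * Matrix.of (v.T m) = ((1 / 2) * (2 * v.U - m ^ 2 * v.Φ ^ 2)) • 1 := by
  have : Matrix.of (v.T m) = ((1 / 2) * (2 * v.U - m ^ 2 * v.Φ ^ 2)) • v.g := by
    ext i j
    simp only [T, Matrix.of_apply, Matrix.smul_apply, smul_eq_mul]
    ring
  rw [this, Matrix.mul_smul, Matrix.nonsing_inv_mul _ hv.isUnit_det]

lemma Regular.inv_mul_τ (hv : v.Regular) :
    v.g⁻¹ * Matrix.of v.τ = ((1 / 2) * v.normSqE - (1 / 4) * v.normSqF) • 1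
      - Matrix.vecMulVec v.E v.ELow - Matrix.of v.FUp * v.F := by
  have h1 : Matrix.of v.τ = ((1 / 2) * v.normSqE - (1 / 4) * v.normSqF) • v.g
      - Matrix.vecMulVec v.ELow v.ELow - v.F * v.g⁻¹ * v.F := by
    ext i j
    simp only [τ, Matrix.of_apply, Matrix.smul_apply, smul_eq_mul, Matrix.sub_apply,
      Matrix.vecMulVec_apply]
    have : ∑ a, ∑ b, v.g⁻¹ a b * v.F i a * v.F j b = -(v.F * v.g⁻¹ * v.F) i j := by
      simp only [Matrix.mul_apply, Finset.sum_mul, ← Finset.sum_neg_distrib]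
      rw [Finset.sum_comm]
      refine Finset.sum_congr rfl fun b _ => Finset.sum_congr rfl fun a _ => ?_
      rw [hv.F_anti j b]
      ring
    rw [this]
    ring
  rw [h1, Matrix.mul_sub, Matrix.mul_sub, Matrix.mul_smul, Matrix.nonsing_inv_mul _ hv.isUnit_det,
    Matrix.mul_vecMulVec, hv.inv_mul_ELow, FUp_eq hv]
  simp only [mul_assoc]

lemma Regular.inv_mul_stress (hv : v.Regular) :
    v.g⁻¹ * v.stress m = v.g⁻¹ * Matrix.of (v.T m) + v.g⁻¹ * Matrix.of v.τ
      + v.ρ • Matrix.vecMulVec v.u v.uLow := by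
  have h1 : v.stress m = Matrix.of (v.T m) + Matrix.of v.τ
      + v.ρ • Matrix.vecMulVec v.uLow v.uLow := by
    ext i j
    simp [stress, Matrix.vecMulVec_apply, mul_assoc]
  rw [h1, Matrix.mul_add, Matrix.mul_add, Matrix.mul_smul, Matrix.mul_vecMulVec, hv.inv_mul_uLow]

/-- The coefficient of the metric in the evolution equation of `k`. -/
def traceCoeff (m Λ : ℝ) (v : State) : ℝ :=
  4 * Real.pi * ((v.g⁻¹ * v.stress m).trace - v.energy m) - Λ

lemma trace_of_mul (A : Mat3) (B : Fin 3 → Fin 3 → ℝ) (hA : A.IsSymm) :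
    ∑ a, ∑ b, A a b * B a b = (A * Matrix.of B).trace := by
  simp only [Matrix.trace, Matrix.diag, Matrix.mul_apply, Matrix.of_apply]
  rw [Finset.sum_comm]
  exact Finset.sum_congr rfl fun i _ => Finset.sum_congr rfl fun j _ => by rw [hA.apply]

lemma normSqE_eq : v.normSqE = v.E ⬝ᵥ v.ELow := rfl

lemma Regular.normSqF_eq (hv : v.Regular) : v.normSqF = -(Matrix.of v.FUp * v.F).trace := by
  simp only [normSqF, Matrix.trace, Matrix.diag, Matrix.mul_apply, Matrix.of_apply,
    ← Finset.sum_neg_distrib]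
  exact Finset.sum_congr rfl fun i _ => Finset.sum_congr rfl fun j _ => by
    rw [hv.F_anti i j]; ring

/-- The Maxwell tensor is trace-free in space-time. -/
lemma Regular.trace_τ (hv : v.Regular) : (v.g⁻¹ * Matrix.of v.τ).trace = v.τ00 := by
  rw [hv.inv_mul_τ, Matrix.trace_sub, Matrix.trace_sub, Matrix.trace_smul, Matrix.trace_vecMulVec,
    Matrix.trace_one, τ00, ← normSqE_eq]
  have := hv.normSqF_eq
  simp only [Fintype.card_fin, smul_eq_mul]
  push_cast
  linarith

lemma Regular.trace_stress (hv : v.Regular) : (v.g⁻¹ * v.stress m).trace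
    = (3 / 2) * (2 * v.U - m ^ 2 * v.Φ ^ 2) + v.τ00 + v.ρ * v.normSqU := by
  rw [hv.inv_mul_stress, Matrix.trace_add, Matrix.trace_add, hv.trace_τ, hv.inv_mul_T,
    Matrix.trace_smul, Matrix.trace_smul, Matrix.trace_one, Matrix.trace_vecMulVec]
  have : v.u ⬝ᵥ v.uLow = v.normSqU := by
    simp only [dotProduct, uLow, normSqU, Finset.mul_sum]
    exact Finset.sum_congr rfl fun i _ => Finset.sum_congr rfl fun j _ => by ring
  rw [this]
  simp only [Fintype.card_fin, smul_eq_mul]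
  push_cast
  ring

/-- The evolution equation leaves the Maxwell tensor out of this coefficient. Its trace and its
energy density cancel, so it may be included in both total stress and total energy. -/
lemma Regular.traceCoeff_eq (hv : v.Regular) : v.traceCoeff m Λ
    = 4 * Real.pi * (-v.T00 m - v.ρ * v.u0 ^ 2
        + ∑ a, ∑ b, v.g⁻¹ a b * (v.T m a b + v.ρ * v.uLow a * v.uLow b)) - Λ := by
  have h2 : Matrix.of (fun a b => v.T m a b + v.ρ * v.uLow a * v.uLow b)
      = v.stress m - Matrix.of v.τ := by
    ext i j
    simp only [stress, Matrix.of_apply, Matrix.sub_apply]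
    ring
  rw [trace_of_mul _ _ hv.inv_symm, h2, Matrix.mul_sub, Matrix.trace_sub, hv.trace_τ, traceCoeff,
    energy]
  ring

lemma Regular.inv_mul_kDot (hv : v.Regular) : v.g⁻¹ * Matrix.of (v.kDot C m Λ)
    = v.g⁻¹ * Matrix.of (ricci C v.g) + v.H • v.K - (2 : ℝ) • (v.K * v.K)
      - (8 * Real.pi) • (v.g⁻¹ * v.stress m) + v.traceCoeff m Λ • 1 := by
  have h1 : Matrix.of (v.kDot C m Λ) = Matrix.of (ricci C v.g) + v.H • v.k
      - (2 : ℝ) • (v.k * v.K) - (8 * Real.pi) • v.stress m + v.traceCoeff m Λ • v.g := by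
    ext i j
    simp only [kDot, Matrix.of_apply, Matrix.add_apply, Matrix.sub_apply, Matrix.smul_apply,
      smul_eq_mul, hv.traceCoeff_eq, stress]
    have : ∑ l, ∑ n, v.g⁻¹ l n * v.k j n * v.k i l = (v.k * v.K) i j := by
      simp only [K, Matrix.mul_apply, Finset.mul_sum]
      refine Finset.sum_congr rfl fun l _ => Finset.sum_congr rfl fun n _ => ?_
      rw [hv.k_symm.apply n j]
      ring
    rw [this]
    ring
  rw [h1]
  simp only [Matrix.mul_add, Matrix.mul_sub, Matrix.mul_smul, ← mul_assoc,
    Matrix.nonsing_inv_mul _ hv.isUnit_det]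
  rfl

/-- Contracting γ with the inverse metric leaves `-trC C`; contracting it with the symmetric tensor
K g⁻¹ removes one Koszul term and makes the other two equal. Afterwards only `K` depends on time, so
the divergence is differentiated without touching the connection. -/
lemma divergence_eq (hC : IsLie C) (hv : v.Regular) (j : Fin 3) :
    divergence C v.g v.k j = mixedDiv C v.K j := by
  set g := v.g with hg
  set K := v.K with hK
  have hgs := fun i j => hv.g_symm.apply i j
  have hhs := fun i j => hv.inv_symm.apply i j
  have hBs := fun i j => hv.K_mul_inv_symm.apply i j
  rw [← hK, ← hg] at hBs
  rw [← hg] at hgs hhs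
  set B := K * g⁻¹ with hB
  have hKB : K = B * g := by rw [hB, Matrix.nonsing_inv_mul_cancel_right _ _ hv.isUnit_det]
  have hγ := fun p l j => sum_metric_mul_connCoeff C hv.isUnit_det p l j
  rw [← hg] at hγ
  have hδ := fun i j => congrFun (congrFun (Matrix.nonsing_inv_mul g hv.isUnit_det) i) j
  simp only [Matrix.mul_apply] at hδ
  -- the divergence of the frame vectors
  have h1 : ∀ q, ∑ i, ∑ l, g⁻¹ i l * ∑ p, g q p * connCoeff C g p l i = -trC C q := by
    intro q
    have e1 : ∑ i, ∑ l, g⁻¹ i l * ∑ m, C m i q * g l m = trC C q := by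
      calc _ = ∑ i, ∑ m, C m i q * ∑ l, g⁻¹ i l * g l m := by
            simp only [Finset.mul_sum]
            refine Finset.sum_congr rfl fun i _ => ?_
            rw [Finset.sum_comm]
            exact Finset.sum_congr rfl fun l _ => Finset.sum_congr rfl fun m _ => by ring
        _ = _ := by simp only [hδ, Matrix.one_apply]; simp [trC]
    have e2 : ∑ i, ∑ l, g⁻¹ i l * ∑ m, C m q l * g i m = -trC C q := by
      rw [← e1, Finset.sum_comm, ← Finset.sum_neg_distrib]
      refine Finset.sum_congr rfl fun l _ => ?_
      rw [← Finset.sum_neg_distrib]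
      refine Finset.sum_congr rfl fun i _ => ?_
      rw [← mul_neg, ← Finset.sum_neg_distrib, hhs]
      congr 1
      exact Finset.sum_congr rfl fun m _ => by rw [hC.anti]; ring
    have e3 : ∑ i, ∑ l, g⁻¹ i l * ∑ m, C m l i * g q m = 0 := by
      have : ∑ i, ∑ l, g⁻¹ i l * ∑ m, C m l i * g q m
          = -∑ i, ∑ l, g⁻¹ i l * ∑ m, C m l i * g q m := by
        conv_lhs => rw [Finset.sum_comm]
        rw [← Finset.sum_neg_distrib]
        refine Finset.sum_congr rfl fun l _ => ?_
        rw [← Finset.sum_neg_distrib]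
        refine Finset.sum_congr rfl fun i _ => ?_
        rw [← mul_neg, ← Finset.sum_neg_distrib, hhs]
        congr 1
        exact Finset.sum_congr rfl fun m _ => by rw [hC.anti]; ring
      linarith
    have e4 : ∑ i, ∑ l, g⁻¹ i l * ∑ p, g q p * connCoeff C g p l i
        = (1 / 2) * (-(∑ i, ∑ l, g⁻¹ i l * ∑ m, C m i q * g l m)
          + (∑ i, ∑ l, g⁻¹ i l * ∑ m, C m q l * g i m)
          + ∑ i, ∑ l, g⁻¹ i l * ∑ m, C m l i * g q m) := by
      simp only [hγ, Finset.sum_add_distrib, Finset.sum_neg_distrib, mul_add, mul_neg,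
        Finset.mul_sum]
      congr 1
      · congr 1
        · congr 1
          exact Finset.sum_congr rfl fun i _ => Finset.sum_congr rfl fun l _ =>
            Finset.sum_congr rfl fun m _ => by ring
        · exact Finset.sum_congr rfl fun i _ => Finset.sum_congr rfl fun l _ =>
            Finset.sum_congr rfl fun m _ => by ring
      · exact Finset.sum_congr rfl fun i _ => Finset.sum_congr rfl fun l _ =>
            Finset.sum_congr rfl fun m _ => by ring
    rw [e4, e1, e2, e3]
    ring
  have h2 : ∑ i, ∑ l, g⁻¹ i l * ∑ p, connCoeff C g p l i * v.k p j
      = ∑ q, K q j * ∑ i, ∑ l, g⁻¹ i l * ∑ p, g q p * connCoeff C g p l i := by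
    rw [← hv.g_mul_K, ← hK, ← hg]
    generalize g⁻¹ = h
    generalize connCoeff C g = γ
    simp only [Matrix.mul_apply, Fin.sum_univ_three, hgs 0 1, hgs 0 2, hgs 1 2]
    ring
  have h3 : ∑ i, ∑ l, g⁻¹ i l * ∑ p, connCoeff C g p l j * v.k i p
      = ∑ l, ∑ q, B l q * ∑ p, g q p * connCoeff C g p l j := by
    have : ∀ l p, K l p = ∑ i, g⁻¹ i l * v.k i p := fun l p => by
      rw [hK, State.K, Matrix.mul_apply]
      exact Finset.sum_congr rfl fun i _ => by rw [← hg, hhs]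
    calc _ = ∑ l, ∑ p, connCoeff C g p l j * K l p := by
          simp only [this, Finset.mul_sum]
          rw [Finset.sum_comm]
          refine Finset.sum_congr rfl fun l _ => ?_
          rw [Finset.sum_comm]
          exact Finset.sum_congr rfl fun i _ => Finset.sum_congr rfl fun p _ => by ring
      _ = _ := by
          simp only [hKB, Matrix.mul_apply, Finset.mul_sum]
          refine Finset.sum_congr rfl fun l _ => ?_
          rw [Finset.sum_comm]
          exact Finset.sum_congr rfl fun i _ => Finset.sum_congr rfl fun p _ => by ring
  have h4 : ∑ l, ∑ q, B l q * ∑ p, g q p * connCoeff C g p l j = ∑ l, ∑ m, K l m * C m l j := by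
    simp only [hγ, hKB, Matrix.mul_apply, Fin.sum_univ_three, hBs 0 1, hBs 0 2, hBs 1 2,
      hC.anti _ j, hC.self, hC.anti _ 1 0, hC.anti _ 2 0, hC.anti _ 2 1, hgs 0 1, hgs 0 2, hgs 1 2]
    ring
  have h5 : divergence C g v.k j = -(∑ i, ∑ l, g⁻¹ i l * ∑ p, connCoeff C g p l i * v.k p j)
      - ∑ i, ∑ l, g⁻¹ i l * ∑ p, connCoeff C g p l j * v.k i p := by
    simp only [divergence, mul_sub, mul_neg, Finset.sum_sub_distrib, Finset.sum_neg_distrib]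
  rw [h5, h2, h3, h4, mixedDiv]
  simp only [h1]
  rw [← Finset.sum_neg_distrib]
  congr 1
  exact Finset.sum_congr rfl fun q _ => by ring

end State
end Bianchi
end

noncomputable section
namespace Bianchi

/-! ### Time derivatives along a solution -/

namespace State

variable {v : State} {C : StructConst} {m Λ : ℝ}

/-- The right-hand side of the evolution equation of `u_i`. -/
def uLowDot (C : StructConst) (v : State) (i : Fin 3) : ℝ :=
  (∑ a, ∑ b, C a b i * v.uLow a * v.u b) / v.u0 - 4 * Real.pi * (v.e / v.ρ) * v.ELow i
    + 4 * Real.pi * (v.e / v.ρ) * (∑ j, v.F j i * v.u j) / v.u0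

lemma u_dot_uLow : ∑ i, v.u i * v.uLow i = v.normSqU := by
  simp only [uLow, normSqU, Finset.mul_sum]
  exact Finset.sum_congr rfl fun i _ => Finset.sum_congr rfl fun j _ => by ring

lemma Regular.normSqU_nonneg (hv : v.Regular) : 0 ≤ v.normSqU := by
  have := hv.g_posDef.posSemidef.dotProduct_mulVec_nonneg v.u
  rw [← u_dot_uLow]
  simpa [dotProduct, uLow_eq] using this

lemma Regular.u0_pos (hv : v.Regular) : 0 < v.u0 :=
  Real.sqrt_pos.mpr (by linarith [hv.normSqU_nonneg])

/-- The left side is the derivative of g_{ij}uʲ. The contribution of ġ = -2k cancels the k-term of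
`uDot`, and the Koszul formula turns the connection term into structure constants. -/
lemma Regular.lower_uDot (hC : IsLie C) (hv : v.Regular) (i : Fin 3) :
    ∑ j, (-2 * v.k i j * v.u j + v.g i j * v.uDot C j) = v.uLowDot C i := by
  have h1 : ∀ X : Fin 3 → ℝ, ∑ j, v.g i j * (∑ l, v.g⁻¹ j l * X l) = X i := by
    intro X
    have := congrFun (Matrix.mulVec_mulVec X v.g v.g⁻¹) i
    rw [Matrix.mul_nonsing_inv _ hv.isUnit_det, Matrix.one_mulVec] at this
    simpa [Matrix.mulVec, dotProduct] using this
  have h2 : ∑ j, v.g i j * (∑ l, ∑ a, v.g⁻¹ j l * v.k l a * v.u a) = ∑ a, v.k i a * v.u a := by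
    rw [← h1 (fun l => ∑ a, v.k l a * v.u a)]
    simp only [Finset.mul_sum, mul_assoc]
  have h3 : ∑ j, v.g i j * (∑ l, ∑ a, v.g⁻¹ j l * v.F a l * v.u a) = ∑ a, v.F a i * v.u a := by
    rw [← h1 (fun l => ∑ a, v.F a l * v.u a)]
    simp only [Finset.mul_sum, mul_assoc]
  have h4 : ∑ j, v.g i j * (∑ a, ∑ b, connCoeff C v.g j a b * v.u a * v.u b)
      = -∑ a, ∑ b, C a b i * v.uLow a * v.u b := by
    have e1 : ∑ j, v.g i j * (∑ a, ∑ b, connCoeff C v.g j a b * v.u a * v.u b)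
        = ∑ a, ∑ b, v.u a * v.u b * ∑ j, v.g i j * connCoeff C v.g j a b := by
      simp only [Fin.sum_univ_three]
      ring
    have hgs := fun i j => hv.g_symm.apply i j
    rw [e1]
    simp only [sum_metric_mul_connCoeff C hv.isUnit_det, uLow, Fin.sum_univ_three, hC.self,
      hC.anti _ 1 0, hC.anti _ 2 0, hC.anti _ 2 1, hC.anti _ i, hgs 0 1, hgs 0 2, hgs 1 2]
    ring
  simp only [uDot, mul_add, mul_sub, Finset.sum_add_distrib, Finset.sum_sub_distrib]
  have e1 : ∑ j, v.g i j * (2 * ∑ l, ∑ a, v.g⁻¹ j l * v.k l a * v.u a)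
      = 2 * ∑ a, v.k i a * v.u a := by
    rw [← h2, Finset.mul_sum]
    exact Finset.sum_congr rfl fun j _ => by ring
  have e2 : ∑ j, v.g i j * ((∑ a, ∑ b, connCoeff C v.g j a b * v.u a * v.u b) / v.u0)
      = -(∑ a, ∑ b, C a b i * v.uLow a * v.u b) / v.u0 := by
    rw [← h4, Finset.sum_div]
    exact Finset.sum_congr rfl fun j _ => by ring
  have e3 : ∑ j, v.g i j * (4 * Real.pi * (v.e / v.ρ) * v.E j)
      = 4 * Real.pi * (v.e / v.ρ) * v.ELow i := by
    rw [ELow, Finset.mul_sum]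
    exact Finset.sum_congr rfl fun j _ => by ring
  have e4 : ∑ j, v.g i j * (4 * Real.pi * (v.e / v.ρ)
        * (∑ l, ∑ a, v.g⁻¹ j l * v.F a l * v.u a) / v.u0)
      = 4 * Real.pi * (v.e / v.ρ) * (∑ j, v.F j i * v.u j) / v.u0 := by
    rw [← h3, Finset.mul_sum, Finset.sum_div]
    exact Finset.sum_congr rfl fun j _ => by ring
  rw [e1, e2, e3, e4, uLowDot]
  have e5 : ∑ j, -2 * v.k i j * v.u j = -2 * ∑ a, v.k i a * v.u a := by
    rw [Finset.mul_sum]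
    exact Finset.sum_congr rfl fun j _ => by ring
  rw [e5]
  ring

/-- By antisymmetry the bracket term and the magnetic force do no work; only the electric force
remains. -/
lemma Regular.u_dot_uLowDot (hC : IsLie C) (hv : v.Regular) :
    ∑ i, v.u i * v.uLowDot C i = -(4 * Real.pi * (v.e / v.ρ) * v.uE) := by
  have h1 : ∑ i, v.u i * (∑ a, ∑ b, C a b i * v.uLow a * v.u b) = 0 := by
    simp only [Fin.sum_univ_three, hC.self, hC.anti _ 1 0, hC.anti _ 2 0, hC.anti _ 2 1]
    ring
  have h2 : ∑ i, v.u i * (∑ j, v.F j i * v.u j) = 0 := by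
    have h0 := hv.F_anti 0 0
    have h11 := hv.F_anti 1 1
    have h22 := hv.F_anti 2 2
    simp only [Fin.sum_univ_three, hv.F_anti 1 0, hv.F_anti 2 0, hv.F_anti 2 1]
    linear_combination (1 / 2) * v.u 0 ^ 2 * h0 + (1 / 2) * v.u 1 ^ 2 * h11
      + (1 / 2) * v.u 2 ^ 2 * h22
  have h3 : ∑ i, v.u i * v.uLowDot C i
      = (∑ i, v.u i * (∑ a, ∑ b, C a b i * v.uLow a * v.u b)) / v.u0
        - 4 * Real.pi * (v.e / v.ρ) * (∑ i, v.u i * v.ELow i)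
        + 4 * Real.pi * (v.e / v.ρ) * (∑ i, v.u i * (∑ j, v.F j i * v.u j)) / v.u0 := by
    simp only [uLowDot, Finset.mul_sum, Finset.sum_div, ← Finset.sum_add_distrib,
      ← Finset.sum_sub_distrib]
    refine Finset.sum_congr rfl fun i _ => ?_
    simp only [mul_add, mul_sub, ← Finset.mul_sum, ← Finset.sum_div]
    ring
  rw [h3, h1, h2, uE]
  ring

end State

namespace IsGlobalSolution

open State

variable {C : StructConst} {m Λ : ℝ} {v : ℝ → State} {t : ℝ}

lemma regular (hv : IsGlobalSolution C m Λ v) (ht : 0 ≤ t) : (v t).Regular :=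
  ⟨hv.g_posDef t ht, hv.k_symm t ht, hv.F_antisymm t ht⟩

lemma inv_eq (hv : IsGlobalSolution C m Λ v) (ht : 0 ≤ t) (i j : Fin 3) :
    HasDerivWithinAt (fun s => (v s).g⁻¹ i j) (2 * ((v t).K * (v t).g⁻¹) i j) (Ici 0) t := by
  have := hasDerivWithinAt_inv_apply (g := fun s => (v s).g) (g' := (-2 : ℝ) • (v t).k)
    (hv.regular ht).isUnit_det (fun i j => by simpa using hv.g_eq t ht i j) i j
  simpa [K] using this

/-- Raising an index removes the quadratic term: the derivative of g⁻¹ contributes 2K², which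
cancels -2K² in `kDot`. -/
lemma K_eq (hv : IsGlobalSolution C m Λ v) (ht : 0 ≤ t) (i j : Fin 3) :
    HasDerivWithinAt (fun s => (v s).K i j)
      (((v t).g⁻¹ * Matrix.of (ricci C (v t).g) + (v t).H • (v t).K
        - (8 * Real.pi) • ((v t).g⁻¹ * (v t).stress m) + (v t).traceCoeff m Λ • (1 : Mat3)) i j)
      (Ici 0) t := by
  have h1 : HasDerivWithinAt (fun s => (v s).K i j)
      (∑ a, (2 * ((v t).K * (v t).g⁻¹) i a * (v t).k a j
        + (v t).g⁻¹ i a * (v t).kDot C m Λ a j)) (Ici 0) t := by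
    simp only [K, Matrix.mul_apply]
    exact HasDerivWithinAt.fun_sum fun a _ => (hv.inv_eq ht i a).mul (hv.k_eq t ht a j)
  refine h1.congr_deriv ?_
  have h2 : ∑ a, (2 * ((v t).K * (v t).g⁻¹) i a * (v t).k a j
      + (v t).g⁻¹ i a * (v t).kDot C m Λ a j)
      = ((2 : ℝ) • ((v t).K * (v t).K) + (v t).g⁻¹ * Matrix.of ((v t).kDot C m Λ)) i j := by
    have hK : (v t).K * (v t).K = (v t).K * (v t).g⁻¹ * (v t).k := by
      rw [mul_assoc]
      rfl
    rw [hK]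
    simp only [Matrix.add_apply, Matrix.smul_apply, smul_eq_mul, Finset.sum_add_distrib]
    rw [Matrix.mul_apply (M := (v t).K * (v t).g⁻¹), Matrix.mul_apply (M := (v t).g⁻¹),
      Finset.mul_sum]
    simp only [Matrix.of_apply, mul_assoc]
  rw [h2, (hv.regular ht).inv_mul_kDot]
  simp only [Matrix.add_apply, Matrix.sub_apply, Matrix.smul_apply, smul_eq_mul]
  ring

lemma H_eq (hv : IsGlobalSolution C m Λ v) (ht : 0 ≤ t) :
    HasDerivWithinAt (fun s => (v s).H) (scalarCurv C (v t).g + (v t).H ^ 2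
        - 8 * Real.pi * ((v t).g⁻¹ * (v t).stress m).trace + 3 * (v t).traceCoeff m Λ)
      (Ici 0) t := by
  have h1 : HasDerivWithinAt (fun s => (v s).K.trace) _ (Ici 0) t :=
    HasDerivWithinAt.fun_sum fun i _ => hv.K_eq ht i i
  refine (h1.congr (fun s hs => (hv.regular hs).H_eq) (hv.regular ht).H_eq).congr_deriv ?_
  change Matrix.trace _ = _
  rw [Matrix.trace_add, Matrix.trace_sub, Matrix.trace_add, Matrix.trace_smul, Matrix.trace_smul,
    Matrix.trace_smul, Matrix.trace_one, ← (hv.regular ht).H_eq, scalarCurv_eq_trace,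
    (hv.regular ht).inv_symm]
  simp only [smul_eq_mul, Fintype.card_fin]
  push_cast
  ring

/-- The Ricci term drops out by the contracted Bianchi identity and the pure trace term because the
identity has zero divergence. -/
lemma mixedDiv_eq (hC : IsLie C) (hv : IsGlobalSolution C m Λ v) (ht : 0 ≤ t) (j : Fin 3) :
    HasDerivWithinAt (fun s => mixedDiv C (v s).K j)
      ((v t).H * mixedDiv C (v t).K j
        - 8 * Real.pi * mixedDiv C ((v t).g⁻¹ * (v t).stress m) j) (Ici 0) t := by
  have h1 : HasDerivWithinAt (fun s => mixedDiv C (v s).K j) (mixedDiv C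
      ((v t).g⁻¹ * Matrix.of (ricci C (v t).g) + (v t).H • (v t).K
        - (8 * Real.pi) • ((v t).g⁻¹ * (v t).stress m) + (v t).traceCoeff m Λ • (1 : Mat3)) j)
      (Ici 0) t := by
    unfold mixedDiv
    exact (HasDerivWithinAt.fun_sum fun k _ => (hv.K_eq ht k j).const_mul _).sub
      (HasDerivWithinAt.fun_sum fun l _ => HasDerivWithinAt.fun_sum fun n _ =>
        (hv.K_eq ht l n).mul_const _)
  refine h1.congr_deriv ?_
  rw [mixedDiv_add, sub_eq_add_neg, ← neg_smul, mixedDiv_add, mixedDiv_add, mixedDiv_smul,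
    mixedDiv_smul, mixedDiv_smul, mixedDiv_one, mixedDiv_ricci hC (hv.g_posDef t ht)]
  simp
  ring

lemma uLow_eq (hC : IsLie C) (hv : IsGlobalSolution C m Λ v) (ht : 0 ≤ t) (i : Fin 3) :
    HasDerivWithinAt (fun s => (v s).uLow i) ((v t).uLowDot C i) (Ici 0) t := by
  rw [← (hv.regular ht).lower_uDot hC]
  exact HasDerivWithinAt.fun_sum fun j _ => (hv.g_eq t ht i j).mul (hv.u_eq t ht j)

lemma normSqU_eq (hC : IsLie C) (hv : IsGlobalSolution C m Λ v) (ht : 0 ≤ t) :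
    HasDerivWithinAt (fun s => (v s).normSqU)
      (2 * (v t).kuu - 2 * (4 * Real.pi * ((v t).e / (v t).ρ) * (v t).uE)) (Ici 0) t := by
  have h1 : HasDerivWithinAt (fun s => ∑ i, (v s).u i * (v s).uLow i)
      (∑ i, ((v t).uDot C i * (v t).uLow i + (v t).u i * (v t).uLowDot C i)) (Ici 0) t :=
    HasDerivWithinAt.fun_sum fun i _ => (hv.u_eq t ht i).mul (hv.uLow_eq hC ht i)
  simp only [u_dot_uLow] at h1
  refine h1.congr_deriv ?_
  have hr := hv.regular ht
  have h2 : ∑ i, (v t).u i * (v t).uLowDot C i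
      = -2 * (v t).kuu + ∑ i, (v t).uDot C i * (v t).uLow i := by
    have hgs := fun i j => hr.g_symm.apply i j
    simp only [← hr.lower_uDot hC, kuu, State.uLow, Fin.sum_univ_three, hgs 0 1, hgs 0 2, hgs 1 2]
    ring
  have h3 := hr.u_dot_uLowDot hC
  rw [Finset.sum_add_distrib]
  linarith

lemma u0_eq (hC : IsLie C) (hv : IsGlobalSolution C m Λ v) (ht : 0 ≤ t) :
    HasDerivWithinAt (fun s => (v s).u0)
      (((v t).kuu - 4 * Real.pi * ((v t).e / (v t).ρ) * (v t).uE) / (v t).u0) (Ici 0) t := by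
  have h0 := (hv.regular ht).u0_pos
  have h1 : HasDerivWithinAt (fun s => 1 + (v s).normSqU) _ (Ici 0) t :=
    (hv.normSqU_eq hC ht).const_add 1
  have h2 := h1.sqrt (by linarith [(hv.regular ht).normSqU_nonneg])
  refine h2.congr_deriv ?_
  change _ / (2 * (v t).u0) = _
  field_simp

/-- Conservation of matter: the k-terms and the electric terms of the derivatives of ρ and u⁰ cancel
in the product. -/
lemma ρu0_eq (hC : IsLie C) (hv : IsGlobalSolution C m Λ v) (ht : 0 ≤ t) :
    HasDerivWithinAt (fun s => (v s).ρ * (v s).u0)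
      ((v t).H * ((v t).ρ * (v t).u0) - (v t).ρ * (trC C ⬝ᵥ (v t).u)) (Ici 0) t := by
  have h0 := (hv.regular ht).u0_pos
  have hρ := hv.ρ_pos t ht
  refine ((hv.ρ_eq t ht).mul (hv.u0_eq hC ht)).congr_deriv ?_
  have hA : trC C ⬝ᵥ (v t).u = ∑ i, ∑ j, C i i j * (v t).u j := by
    simp only [dotProduct, trC, Finset.sum_mul]
    exact Finset.sum_comm
  rw [hA, ρDot, dilution, ← kuu]
  field_simp
  ring

/-- e and ρ have the same logarithmic rate -dilution + 4π(e/ρ)·uE/(u⁰)². -/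
lemma charge_ratio_eq (hv : IsGlobalSolution C m Λ v) (ht : 0 ≤ t) :
    HasDerivWithinAt (fun s => (v s).e / (v s).ρ) 0 (Ici 0) t := by
  have hρ := hv.ρ_pos t ht
  refine ((hv.e_eq t ht).div (hv.ρ_eq t ht) hρ.ne').congr_deriv ?_
  rw [eDot, ρDot, div_eq_zero_iff]
  left
  field_simp
  ring

end IsGlobalSolution
end Bianchi
end

/-! ### Propagation of the constraints -/

noncomputable section
namespace Bianchi

namespace State

variable {v : State} {C : StructConst} {m Λ : ℝ}

/-- The left-hand side of the magnetic constraint. -/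
def magneticDefect (C : StructConst) (v : State) (i j k : Fin 3) : ℝ :=
  ∑ l, (C l i j * v.F k l + C l k i * v.F j l + C l j k * v.F i l)

/-- The left-hand side of the electric constraint. -/
def electricDefect (C : StructConst) (v : State) : ℝ :=
  trC C ⬝ᵥ v.E + 4 * Real.pi * v.e * v.u0

/-- The defect in the momentum constraint. -/
def momentumDefect (C : StructConst) (v : State) (j : Fin 3) : ℝ :=
  mixedDiv C v.K j + 8 * Real.pi * v.current j

/-- The defect in the Hamiltonian constraint. -/
def hamiltonianDefect (C : StructConst) (m Λ : ℝ) (v : State) : ℝ :=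
  scalarCurv C v.g - v.normSqK + v.H ^ 2 - 16 * Real.pi * v.energy m - 2 * Λ

/-- Up to sign `trC C` is the functional x ↦ tr ad x, which vanishes on brackets because ad[x, y] is
a commutator. -/
lemma trC_contract_bracket (hC : IsLie C) (j k : Fin 3) : ∑ i, trC C i * C i j k = 0 := by
  have hJ0 := hC.jac 0 1 2 0
  have hJ1 := hC.jac 0 1 2 1
  have hJ2 := hC.jac 0 1 2 2
  simp only [Fin.sum_univ_three, hC.self, fun k => hC.anti k 1 0, fun k => hC.anti k 2 1,
    fun k => hC.anti k 0 2, trC] at hJ0 hJ1 hJ2 ⊢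
  fin_cases j <;> fin_cases k <;> simp only [Fin.zero_eta, Fin.mk_one, Fin.reduceFinMk, hC.self,
    fun k => hC.anti k 1 0, fun k => hC.anti k 2 1, fun k => hC.anti k 0 2]
  · ring
  · linear_combination (-1) * hJ2
  · linear_combination hJ1
  · linear_combination hJ2
  · ring
  · linear_combination (-1) * hJ0
  · linear_combination (-1) * hJ1
  · linear_combination hJ0
  · ring

/-- Momentum balance of the electromagnetic field: the left side is the derivative of τ₀ⱼ. The terms
beyond the stress divergence and Hτ₀ⱼ are the magnetic force and the electric flux, which charges
compensate later. What remains is a multiple of the magnetic constraint. -/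
lemma Regular.mixedDiv_maxwell (hC : IsLie C) (hv : v.Regular)
    (hB : v.magneticDefect C 0 1 2 = 0) (j : Fin 3) :
    -∑ k, (v.EDot C k * v.F j k + v.E k * v.FDot C j k)
      = mixedDiv C (v.g⁻¹ * Matrix.of v.τ) j + v.H * v.τ0 j + (trC C ⬝ᵥ v.E) * v.ELow j
        - 4 * Real.pi * v.e * ∑ k, v.u k * v.F j k := by
  rw [hv.inv_mul_τ]
  have hD : mixedDiv C (((1 / 2) * v.normSqE - (1 / 4) * v.normSqF) • 1
      - Matrix.vecMulVec v.E v.ELow - Matrix.of v.FUp * v.F)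
      = -(mixedDiv C (Matrix.vecMulVec v.E v.ELow) + mixedDiv C (Matrix.of v.FUp * v.F)) := by
    rw [sub_sub, sub_eq_add_neg, ← neg_one_smul ℝ, mixedDiv_add, mixedDiv_smul, mixedDiv_smul,
      mixedDiv_one, mixedDiv_add]
    simp [add_comm]
  rw [hD]
  simp only [magneticDefect, EDot, FDot, τ0, mixedDiv, Matrix.mul_apply, Matrix.of_apply,
    Matrix.vecMulVec_apply, Pi.neg_apply, Pi.add_apply, dotProduct, trC] at hB ⊢
  have hF : ∀ i, v.F i i = 0 := fun i => by linarith [hv.F_anti i i]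
  have hf : ∀ i, v.FUp i i = 0 := fun i => by linarith [hv.FUp_anti i i]
  have F10 := hv.F_anti 1 0
  have F20 := hv.F_anti 2 0
  have F21 := hv.F_anti 2 1
  have f10 := hv.FUp_anti 1 0
  have f20 := hv.FUp_anti 2 0
  have f21 := hv.FUp_anti 2 1
  generalize v.FUp = f at f10 f20 f21 hf ⊢
  simp only [Fin.sum_univ_three, hF, F10, F20, F21] at hB
  fin_cases j <;> simp only [Fin.zero_eta, Fin.mk_one, Fin.reduceFinMk, Fin.sum_univ_three,
    hC.self, fun k => hC.anti k 1 0, fun k => hC.anti k 2 1, fun k => hC.anti k 0 2, hF, hf,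
    F10, F20, F21, f10, f20, f21]
  · linear_combination f 1 2 * hB
  · linear_combination -f 0 2 * hB
  · linear_combination f 0 1 * hB

/-- Poynting's identity: the left side is the derivative of τ₀₀. The two terms coupling E and F
through the bracket cancel, up to the flux paired with `trC C`. -/
lemma Regular.energy_maxwell (C : StructConst) (hv : v.Regular) :
    (∑ i, v.EDot C i * v.ELow i) - ∑ i, ∑ j, v.k i j * v.E i * v.E j
        + (1 / 2) * ∑ i, ∑ j, v.FUp i j * v.FDot C i j
        - (v.K * Matrix.of v.FUp * v.F).trace
      = v.H * v.τ00 + (v.K * (v.g⁻¹ * Matrix.of v.τ)).trace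
        + (v.g⁻¹ *ᵥ trC C) ⬝ᵥ v.τ0 + 4 * Real.pi * v.e * v.uE := by
  have h1 : ∑ i, ∑ j, v.k i j * v.E i * v.E j = v.ELow ⬝ᵥ (v.K *ᵥ v.E) := by
    have hgs := fun i j => hv.g_symm.apply i j
    rw [ELow_eq]
    conv_lhs => rw [← hv.g_mul_K]
    simp only [dotProduct, Matrix.mulVec, Matrix.mul_apply, Fin.sum_univ_three, hgs 0 1, hgs 0 2,
      hgs 1 2]
    ring
  have h2 : (v.g⁻¹ *ᵥ trC C) ⬝ᵥ v.τ0 = -(trC C ⬝ᵥ (Matrix.of v.FUp *ᵥ v.ELow)) := by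
    have e1 : v.τ0 = -(v.F *ᵥ v.E) := by
      ext j
      simp [τ0, Matrix.mulVec, dotProduct, mul_comm]
    rw [e1, FUp_eq hv, ← Matrix.mulVec_mulVec, hv.inv_mul_ELow, ← Matrix.mulVec_mulVec,
      Matrix.dotProduct_mulVec, ← Matrix.mulVec_transpose, hv.inv_symm, dotProduct_neg]
  have h3 := hv.normSqF_eq
  have h4 : v.K.trace = v.H := hv.H_eq.symm
  have h5 : (v.K * Matrix.vecMulVec v.E v.ELow).trace = v.ELow ⬝ᵥ (v.K *ᵥ v.E) := by
    rw [Matrix.mul_vecMulVec, Matrix.trace_vecMulVec, dotProduct_comm]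
  rw [h1, h2, hv.inv_mul_τ, mul_sub, mul_sub, Matrix.trace_sub, Matrix.trace_sub, Matrix.mul_smul,
    Matrix.trace_smul, mul_one, h4, h5, ← mul_assoc, τ00, uE, normSqE]
  have h6 : ∑ i, v.EDot C i * v.ELow i = v.H * (∑ i, v.E i * v.ELow i)
      - trC C ⬝ᵥ (Matrix.of v.FUp *ᵥ v.ELow)
      - (1 / 2) * (∑ i, ∑ j, v.FUp i j * v.FDot C i j)
      + 4 * Real.pi * v.e * ∑ i, v.u i * v.ELow i := by
    simp only [EDot, FDot, dotProduct, Matrix.mulVec, Matrix.of_apply, trC]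
    generalize v.FUp = f
    simp only [Fin.sum_univ_three]
    ring
  rw [h6, smul_eq_mul]
  ring

end State

namespace IsGlobalSolution

open State

variable {C : StructConst} {m Λ : ℝ} {v : ℝ → State} {t : ℝ}

/-- The derivative of F is, up to sign, the Lie algebra coboundary of the covector E, and the defect
measures the coboundary of F; the Jacobi identity says that the coboundary squares to zero. -/
lemma magneticDefect_eq (hC : IsLie C) (hv : IsGlobalSolution C m Λ v) (ht : 0 ≤ t) :
    HasDerivWithinAt (fun s => (v s).magneticDefect C 0 1 2) 0 (Ici 0) t := by
  have h1 : HasDerivWithinAt (fun s => (v s).magneticDefect C 0 1 2)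
      (∑ l, (C l 0 1 * (v t).FDot C 2 l + C l 2 0 * (v t).FDot C 1 l
        + C l 1 2 * (v t).FDot C 0 l)) (Ici 0) t :=
    HasDerivWithinAt.fun_sum fun l _ => (((hv.F_eq t ht 2 l).const_mul _).add
      ((hv.F_eq t ht 1 l).const_mul _)).add ((hv.F_eq t ht 0 l).const_mul _)
  refine h1.congr_deriv ?_
  have hJ := hC.jac 0 1 2
  simp only [FDot, Fin.sum_univ_three, hC.self, fun k => hC.anti k 1 0, fun k => hC.anti k 2 1,
    fun k => hC.anti k 0 2] at hJ ⊢
  linear_combination -(v t).ELow 0 * hJ 0 - (v t).ELow 1 * hJ 1 - (v t).ELow 2 * hJ 2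

/-- The magnetic terms vanish, one by antisymmetry of F, the other because `trC C` kills brackets.
The current term cancels against the derivative of e u⁰, computed as the constant e/ρ times ρu⁰. -/
lemma electricDefect_eq (hC : IsLie C) (hv : IsGlobalSolution C m Λ v) (ht : 0 ≤ t) :
    HasDerivWithinAt (fun s => (v s).electricDefect C)
      ((v t).H * (v t).electricDefect C) (Ici 0) t := by
  have hρ := hv.ρ_pos t ht
  have hr := hv.regular ht
  have h1 : HasDerivWithinAt (fun s => (trC C ⬝ᵥ (v s).E)
      + 4 * Real.pi * ((v s).e / (v s).ρ * ((v s).ρ * (v s).u0))) _ (Ici 0) t :=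
    (HasDerivWithinAt.fun_sum fun k _ => (hv.E_eq t ht k).const_mul (trC C k)).add
      (((hv.charge_ratio_eq ht).mul (hv.ρu0_eq hC ht)).const_mul _)
  have h2 : ∀ s ∈ Ici (0 : ℝ), (v s).electricDefect C = (trC C ⬝ᵥ (v s).E)
      + 4 * Real.pi * ((v s).e / (v s).ρ * ((v s).ρ * (v s).u0)) := by
    intro s hs
    have := hv.ρ_pos s hs
    rw [electricDefect]
    field_simp
  refine (h1.congr h2 (h2 t ht)).congr_deriv ?_
  rw [electricDefect]
  have hE : ∑ k, trC C k * (v t).EDot C k = (v t).H * (trC C ⬝ᵥ (v t).E)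
      + 4 * Real.pi * (v t).e * (trC C ⬝ᵥ (v t).u) := by
    have e1 : ∑ i, trC C i * ∑ j, ∑ k, C j j k * (v t).FUp k i = 0 := by
      have : ∀ i, ∑ j, ∑ k, C j j k * (v t).FUp k i = ∑ k, trC C k * (v t).FUp k i := by
        intro i
        rw [Finset.sum_comm]
        simp only [trC, Finset.sum_mul]
      rw [Finset.sum_congr rfl fun i _ => congrArg (trC C i * ·) (this i)]
      simp only [Fin.sum_univ_three, hr.FUp_anti 1 0, hr.FUp_anti 2 0, hr.FUp_anti 2 1]
      have h0 := hr.FUp_anti 0 0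
      have h11 := hr.FUp_anti 1 1
      have h22 := hr.FUp_anti 2 2
      linear_combination (1 / 2) * trC C 0 ^ 2 * h0 + (1 / 2) * trC C 1 ^ 2 * h11
        + (1 / 2) * trC C 2 ^ 2 * h22
    have e2 : ∑ i, trC C i * ∑ j, ∑ k, C i j k * (v t).FUp j k = 0 := by
      have : ∑ i, trC C i * ∑ j, ∑ k, C i j k * (v t).FUp j k
          = ∑ j, ∑ k, (∑ i, trC C i * C i j k) * (v t).FUp j k := by
        simp only [Fin.sum_univ_three]
        ring
      rw [this]
      simp only [trC_contract_bracket hC, zero_mul, Finset.sum_const_zero]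
    have e3 : ∑ k, trC C k * (v t).EDot C k = (v t).H * (∑ k, trC C k * (v t).E k)
        - ∑ i, trC C i * ∑ j, ∑ k, C j j k * (v t).FUp k i
        - (1 / 2) * ∑ i, trC C i * ∑ j, ∑ k, C i j k * (v t).FUp j k
        + 4 * Real.pi * (v t).e * ∑ k, trC C k * (v t).u k := by
      simp only [EDot, Finset.mul_sum (s := Finset.univ) (a := (v t).H),
        Finset.mul_sum (s := Finset.univ) (a := 4 * Real.pi * (v t).e),
        Finset.mul_sum (s := Finset.univ) (a := (1 / 2 : ℝ)) (f := fun i => trC C i * _),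
        ← Finset.sum_add_distrib, ← Finset.sum_sub_distrib]
      exact Finset.sum_congr rfl fun k _ => by ring
    rw [e3, e1, e2]
    simp only [dotProduct]
    ring
  rw [hE]
  field_simp
  ring

/-- The divergence of the stress in the equation of `mixedDiv C K` is balanced by the derivative of
the momentum density. The Lorentz force on matter offsets that on the field, except for a multiple
of the electric constraint. -/
lemma momentumDefect_eq (hC : IsLie C) (hv : IsGlobalSolution C m Λ v) (ht : 0 ≤ t)
    (hB : (v t).magneticDefect C 0 1 2 = 0) (hE : (v t).electricDefect C = 0) (j : Fin 3) :
    HasDerivWithinAt (fun s => (v s).momentumDefect C j)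
      ((v t).H * (v t).momentumDefect C j) (Ici 0) t := by
  have hr := hv.regular ht
  have hρ := hv.ρ_pos t ht
  have hu := hr.u0_pos
  have h1 : HasDerivWithinAt (fun s => (v s).τ0 j)
      (-∑ k, ((v t).EDot C k * (v t).F j k + (v t).E k * (v t).FDot C j k)) (Ici 0) t :=
    (HasDerivWithinAt.fun_sum fun k _ => (hv.E_eq t ht k).mul (hv.F_eq t ht j k)).neg
  have h2 := (hv.ρu0_eq hC ht).mul (hv.uLow_eq hC ht j)
  have h3 := (hv.mixedDiv_eq hC ht j).add ((h1.sub h2).const_mul (8 * Real.pi))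
  refine h3.congr_deriv ?_
  rw [hr.mixedDiv_maxwell hC hB, hr.inv_mul_stress, hr.inv_mul_T, mixedDiv_add, mixedDiv_add,
    mixedDiv_smul, mixedDiv_smul, mixedDiv_one, momentumDefect, current, uLowDot]
  have hD : mixedDiv C (Matrix.vecMulVec (v t).u (v t).uLow) j
      = (trC C ⬝ᵥ (v t).u) * (v t).uLow j
        - ∑ a, ∑ b, C a b j * (v t).uLow a * (v t).u b := by
    simp only [mixedDiv, Matrix.vecMulVec_apply, dotProduct, Finset.sum_mul]
    congr 1
    · exact Finset.sum_congr rfl fun k _ => by ring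
    · rw [Finset.sum_comm]
      exact Finset.sum_congr rfl fun a _ => Finset.sum_congr rfl fun b _ => by ring
  have hF : ∑ k, (v t).F k j * (v t).u k = -∑ k, (v t).u k * (v t).F j k := by
    rw [← Finset.sum_neg_distrib]
    exact Finset.sum_congr rfl fun k _ => by rw [hr.F_anti]; ring
  rw [electricDefect] at hE
  simp only [Pi.add_apply, Pi.smul_apply, smul_eq_mul, hD, hF, Pi.zero_apply]
  field_simp
  linear_combination 16 * Real.pi * (v t).ELow j * hE

/-- Conservation of energy: the work of the electric field on the charges appears in the Maxwell and
matter parts with opposite signs, and the scalar force cancels inside T₀₀. -/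
lemma energy_eq (hC : IsLie C) (hv : IsGlobalSolution C m Λ v) (ht : 0 ≤ t) :
    HasDerivWithinAt (fun s => (v s).energy m)
      ((v t).H * (v t).energy m + ((v t).K * ((v t).g⁻¹ * (v t).stress m)).trace
        + ((v t).g⁻¹ *ᵥ trC C) ⬝ᵥ (v t).current) (Ici 0) t := by
  have hr := hv.regular ht
  have hρ := hv.ρ_pos t ht
  have hu := hr.u0_pos
  have hU := hv.U_nonneg t ht
  have h1 : HasDerivWithinAt (fun s => (v s).T00 m) (2 * (v t).H * (v t).U) (Ici 0) t := by
    refine ((hv.U_eq t ht).add (((hv.Φ_eq t ht).pow 2).const_mul (1 / 2 * m ^ 2))).congr_deriv ?_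
    rw [UDot]
    push_cast
    ring
  have h2 : HasDerivWithinAt (fun s => (v s).ρ * (v s).u0 * (v s).u0) _ (Ici 0) t :=
    (hv.ρu0_eq hC ht).mul (hv.u0_eq hC ht)
  have hE : HasDerivWithinAt (fun s => (v s).normSqE) (2 * (∑ i, (v t).EDot C i * (v t).ELow i)
      - 2 * ∑ i, ∑ j, (v t).k i j * (v t).E i * (v t).E j) (Ici 0) t := by
    have e1 : HasDerivWithinAt (fun s => (v s).normSqE) _ (Ici 0) t :=
      HasDerivWithinAt.fun_sum fun i _ => (hv.E_eq t ht i).mul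
        (HasDerivWithinAt.fun_sum (u := Finset.univ) fun j _ =>
          (hv.g_eq t ht i j).mul (hv.E_eq t ht j))
    refine e1.congr_deriv ?_
    have hgs := fun i j => hr.g_symm.apply i j
    have hks := fun i j => hr.k_symm.apply i j
    simp only [State.ELow, Fin.sum_univ_three, hgs 0 1, hgs 0 2, hgs 1 2, hks 0 1, hks 0 2,
      hks 1 2]
    ring
  have hF : HasDerivWithinAt (fun s => (v s).normSqF)
      (2 * (∑ i, ∑ j, (v t).FUp i j * (v t).FDot C i j)
        - 4 * ((v t).K * Matrix.of (v t).FUp * (v t).F).trace) (Ici 0) t := by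
    have e1 : HasDerivWithinAt (fun s => (v s).normSqF) _ (Ici 0) t :=
      HasDerivWithinAt.fun_sum fun i _ => HasDerivWithinAt.fun_sum (u := Finset.univ) fun j _ =>
        (HasDerivWithinAt.fun_sum (u := Finset.univ) fun a _ =>
          HasDerivWithinAt.fun_sum (u := Finset.univ) fun b _ =>
            ((hv.inv_eq ht i a).mul (hv.inv_eq ht j b)).mul (hv.F_eq t ht a b)).mul
        (hv.F_eq t ht i j)
    refine e1.congr_deriv ?_
    have hhs := fun i j => hr.inv_symm.apply i j
    have e2 : ∀ i j, ∑ a, ∑ b, 2 * ((v t).K * (v t).g⁻¹) i a * (v t).g⁻¹ j b * (v t).F a b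
        = 2 * ((v t).K * Matrix.of (v t).FUp) i j := by
      intro i j
      simp only [Matrix.mul_apply, Matrix.of_apply, FUp]
      simp only [Fin.sum_univ_three]
      ring
    have e3 : ∀ i j, ∑ a, ∑ b, (v t).g⁻¹ i a * (2 * ((v t).K * (v t).g⁻¹) j b) * (v t).F a b
        = 2 * (Matrix.of (v t).FUp * (v t).Kᵀ) i j := by
      intro i j
      simp only [Matrix.mul_apply, Matrix.of_apply, FUp, Matrix.transpose_apply]
      simp only [Fin.sum_univ_three]
      ring
    have e4 : ∑ i, ∑ j, (∑ a, ∑ b, (v t).g⁻¹ i a * (v t).g⁻¹ j b * (v t).FDot C a b) * (v t).F i j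
        = ∑ i, ∑ j, (v t).FUp i j * (v t).FDot C i j := by
      simp only [FUp]
      generalize (v t).FDot C = D
      simp only [Fin.sum_univ_three, hhs 0 1, hhs 0 2, hhs 1 2]
      ring
    have e7 : ∑ i, ∑ j, (∑ a, ∑ b, (v t).g⁻¹ i a * (v t).g⁻¹ j b * (v t).F a b) * (v t).FDot C i j
        = ∑ i, ∑ j, (v t).FUp i j * (v t).FDot C i j := rfl
    simp only [Pi.mul_apply, add_mul, Finset.sum_add_distrib, e2, e3, e4, e7]
    have e5 : ∑ i, ∑ j, 2 * ((v t).K * Matrix.of (v t).FUp) i j * (v t).F i j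
        = -2 * ((v t).K * Matrix.of (v t).FUp * (v t).F).trace := by
      rw [Matrix.trace, Finset.mul_sum]
      refine Finset.sum_congr rfl fun i _ => ?_
      rw [Matrix.diag_apply, Matrix.mul_apply, Finset.mul_sum]
      exact Finset.sum_congr rfl fun j _ => by rw [hr.F_anti i j]; ring
    have e6 : ∑ i, ∑ j, 2 * (Matrix.of (v t).FUp * (v t).Kᵀ) i j * (v t).F i j
        = -2 * ((v t).K * Matrix.of (v t).FUp * (v t).F).trace := by
      rw [← e5, Finset.sum_comm]
      refine Finset.sum_congr rfl fun i _ => Finset.sum_congr rfl fun j _ => ?_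
      have : (Matrix.of (v t).FUp * (v t).Kᵀ) j i = -((v t).K * Matrix.of (v t).FUp) i j := by
        simp only [Matrix.mul_apply, Matrix.of_apply, Matrix.transpose_apply,
          ← Finset.sum_neg_distrib]
        exact Finset.sum_congr rfl fun c _ => by rw [hr.FUp_anti j c]; ring
      rw [this, hr.F_anti j i]
      ring
    rw [e5, e6]
    ring
  have h3 := (h1.add ((hE.const_mul (1 / 2)).add (hF.const_mul (1 / 4)))).add h2
  have h4 : HasDerivWithinAt (fun s => (v s).energy m) _ (Ici 0) t :=
    h3.congr (fun s _ => by simp only [energy, τ00, Pi.add_apply]; ring)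
      (by simp only [energy, τ00, Pi.add_apply]; ring)
  refine h4.congr_deriv ?_
  have hM := hr.energy_maxwell C
  have hu2 : ((v t).K * Matrix.vecMulVec (v t).u (v t).uLow).trace = (v t).kuu := by
    have hgs := fun i j => hr.g_symm.apply i j
    rw [Matrix.mul_vecMulVec, Matrix.trace_vecMulVec, State.uLow_eq, kuu]
    conv_rhs => rw [← hr.g_mul_K]
    simp only [dotProduct, Matrix.mulVec, Matrix.mul_apply, Fin.sum_univ_three, hgs 0 1, hgs 0 2,
      hgs 1 2]
    ring
  have hA : ((v t).g⁻¹ *ᵥ trC C) ⬝ᵥ (v t).uLow = trC C ⬝ᵥ (v t).u := by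
    conv_rhs => rw [← hr.inv_mul_uLow]
    rw [Matrix.dotProduct_mulVec, ← Matrix.mulVec_transpose, hr.inv_symm]
  have hcur : (v t).current = (v t).τ0 - ((v t).ρ * (v t).u0) • (v t).uLow := rfl
  rw [hr.inv_mul_stress, mul_add, mul_add, Matrix.trace_add, Matrix.trace_add, hr.inv_mul_T,
    Matrix.mul_smul, Matrix.mul_smul, Matrix.trace_smul, Matrix.trace_smul, mul_one, ← hr.H_eq,
    hu2, hcur, dotProduct_sub, dotProduct_smul, hA, energy, T00]
  simp only [smul_eq_mul]
  have hq : (v t).ρ * (v t).u0 * (((v t).kuu - 4 * Real.pi * ((v t).e / (v t).ρ) * (v t).uE)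
      / (v t).u0) = (v t).ρ * (v t).kuu - 4 * Real.pi * (v t).e * (v t).uE := by
    field_simp
  rw [hq]
  linear_combination hM

/-- The term 2 tr(K·Ric) from the variation of R cancels the one from |k|². The divergence term and
the energy flux combine into the momentum defect, and the remainder is a multiple of the defect
itself. -/
lemma hamiltonianDefect_eq (hC : IsLie C) (hv : IsGlobalSolution C m Λ v) (ht : 0 ≤ t) :
    HasDerivWithinAt (fun s => (v s).hamiltonianDefect C m Λ)
      (2 * (v t).H * (v t).hamiltonianDefect C m Λ
        - 2 * (((v t).g⁻¹ *ᵥ trC C) ⬝ᵥ (v t).momentumDefect C)) (Ici 0) t := by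
  have hr := hv.regular ht
  have h1 := hasDerivWithinAt_scalarCurv hC (hr.k_symm) (fun s hs => hv.g_posDef s hs) ht
    (hv.g_eq t ht)
  have h2 : HasDerivWithinAt (fun s => (v s).normSqK) (2 * ((v t).K * ((v t).g⁻¹
      * Matrix.of (ricci C (v t).g) + (v t).H • (v t).K
        - (8 * Real.pi) • ((v t).g⁻¹ * (v t).stress m)
        + (v t).traceCoeff m Λ • (1 : Mat3))).trace) (Ici 0) t := by
    have e1 : HasDerivWithinAt (fun s => ((v s).K * (v s).K).trace) _ (Ici 0) t :=
      HasDerivWithinAt.fun_sum fun i _ => HasDerivWithinAt.fun_sum (u := Finset.univ) fun j _ =>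
        (hv.K_eq ht i j).mul (hv.K_eq ht j i)
    refine (e1.congr (fun s hs => (hv.regular hs).normSqK_eq) hr.normSqK_eq).congr_deriv ?_
    generalize (v t).g⁻¹ * Matrix.of (ricci C (v t).g) + (v t).H • (v t).K
        - (8 * Real.pi) • ((v t).g⁻¹ * (v t).stress m)
        + (v t).traceCoeff m Λ • (1 : Mat3) = X
    simp only [Matrix.trace, Matrix.diag, Matrix.mul_apply, Fin.sum_univ_three]
    ring
  have h3 := (((h1.sub h2).add ((hv.H_eq ht).pow 2)).sub
    ((hv.energy_eq hC ht).const_mul (16 * Real.pi))).sub_const (2 * Λ)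
  refine h3.congr_deriv ?_
  have hm : (v t).momentumDefect C = mixedDiv C (v t).K + (8 * Real.pi) • (v t).current := rfl
  have hA : trC C ⬝ᵥ ((v t).g⁻¹ *ᵥ mixedDiv C (v t).K)
      = ((v t).g⁻¹ *ᵥ trC C) ⬝ᵥ mixedDiv C (v t).K := by
    rw [Matrix.dotProduct_mulVec, ← Matrix.mulVec_transpose, hr.inv_symm]
  change 2 * ((v t).K * ((v t).g⁻¹ * Matrix.of (ricci C (v t).g))).trace
    - 2 * (trC C ⬝ᵥ ((v t).g⁻¹ *ᵥ mixedDiv C (v t).K)) - _ + _ - _ = _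
  rw [hA, hm, dotProduct_add, dotProduct_smul, mul_add, mul_sub, mul_add, Matrix.trace_add,
    Matrix.trace_sub, Matrix.trace_add, Matrix.mul_smul, Matrix.mul_smul, Matrix.mul_smul,
    Matrix.trace_smul, Matrix.trace_smul, Matrix.trace_smul, mul_one, ← hr.H_eq,
    ← hr.normSqK_eq, hamiltonianDefect]
  simp only [smul_eq_mul, traceCoeff]
  push_cast
  ring

end IsGlobalSolution
end Bianchi
end

/-! ### Comparison lemmas, algebraic inequalities and the decay of the excess -/

noncomputable section
namespace Bianchi

lemma monotoneOn_of_hasDerivWithinAt {S : Set ℝ} (hS : Convex ℝ S) {f f' : ℝ → ℝ}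
    (h : ∀ t ∈ S, HasDerivWithinAt f (f' t) S t) (hn : ∀ t ∈ S, 0 ≤ f' t) : MonotoneOn f S :=
  monotoneOn_of_hasDerivWithinAt_nonneg hS (fun t ht => (h t ht).continuousWithinAt)
    (fun t ht => (h t (interior_subset ht)).mono interior_subset)
    (fun t ht => hn t (interior_subset ht))

lemma antitoneOn_of_hasDerivWithinAt {S : Set ℝ} (hS : Convex ℝ S) {f f' : ℝ → ℝ}
    (h : ∀ t ∈ S, HasDerivWithinAt f (f' t) S t) (hn : ∀ t ∈ S, f' t ≤ 0) : AntitoneOn f S := by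
  have := monotoneOn_of_hasDerivWithinAt hS (fun t ht => (h t ht).neg)
    (fun t ht => neg_nonneg.mpr (hn t ht))
  exact fun a ha b hb hab => neg_le_neg_iff.mp (this ha hb hab)

/-- A solution of a scalar linear homogeneous equation that vanishes initially is zero. -/
lemma eq_zero_of_linear_ode {y a : ℝ → ℝ} (ha : ContinuousOn a (Ici 0))
    (h : ∀ t, 0 ≤ t → HasDerivWithinAt y (a t * y t) (Ici 0) t) (h0 : y 0 = 0) {t : ℝ}
    (ht : 0 ≤ t) : y t = 0 := by
  obtain ⟨B, hB⟩ := isCompact_Icc.exists_bound_of_continuousOn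
    (ha.mono (Icc_subset_Ici_self : Icc 0 t ⊆ Ici 0))
  have hlip : ∀ s ∈ Ico 0 t, LipschitzOnWith (Real.toNNReal B) (fun x => a s * x) univ := by
    intro s hs
    refine (LipschitzWith.of_dist_le_mul fun x z => ?_).lipschitzOnWith
    rw [Real.dist_eq, Real.dist_eq, ← mul_sub, abs_mul]
    refine mul_le_mul_of_nonneg_right ?_ (abs_nonneg _)
    exact (hB s ⟨hs.1, hs.2.le⟩).trans (Real.le_coe_toNNReal B)
  have := ODE_solution_unique_of_mem_Icc_right (v := fun s x => a s * x) (f := y)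
    (g := fun _ => 0) (a := 0) (b := t) hlip
    (fun s hs => (h s hs.1).continuousWithinAt.mono Icc_subset_Ici_self)
    (fun s hs => (h s hs.1).mono (Ici_subset_Ici.mpr hs.1)) (fun _ _ => mem_univ _)
    continuousOn_const (fun s _ => by simpa using hasDerivWithinAt_const s (Ici s) (0 : ℝ))
    (fun _ _ => mem_univ _) h0
  exact this ⟨ht, le_rfl⟩

/-! ### Algebraic inequalities -/

lemma exists_frame {g : Mat3} (hg : g.PosDef) : ∃ P Q : Mat3, P * Q = 1 ∧ Q * P = 1 ∧
    g = Qᵀ * Q ∧ g⁻¹ = P * Pᵀ := by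
  obtain ⟨P, hP, hPg⟩ := exists_orthonormal_frame hg
  have hT : IsUnit Pᵀ.det := by rwa [Matrix.det_transpose]
  have h1 : g = P⁻¹ᵀ * P⁻¹ := by
    calc g = (Pᵀ)⁻¹ * (Pᵀ * g * P) * P⁻¹ := by
          rw [mul_assoc, mul_assoc, mul_assoc, Matrix.mul_nonsing_inv _ hP, mul_one,
            Matrix.nonsing_inv_mul_cancel_left _ _ hT]
      _ = _ := by rw [hPg, mul_one, Matrix.transpose_nonsing_inv]
  refine ⟨P, P⁻¹, Matrix.mul_nonsing_inv _ hP, Matrix.nonsing_inv_mul _ hP, h1, ?_⟩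
  rw [h1, Matrix.mul_inv_rev, Matrix.nonsing_inv_nonsing_inv _ hP, ← Matrix.transpose_nonsing_inv,
    Matrix.nonsing_inv_nonsing_inv _ hP]

lemma dotProduct_sq_le (x y : Fin 3 → ℝ) : (x ⬝ᵥ y) ^ 2 ≤ (x ⬝ᵥ x) * (y ⬝ᵥ y) := by
  have := Finset.sum_mul_sq_le_sq_mul_sq Finset.univ x y
  simpa only [dotProduct, sq] using this

lemma dotProduct_frame {Q : Mat3} (x y : Fin 3 → ℝ) :
    x ⬝ᵥ ((Qᵀ * Q) *ᵥ y) = (Q *ᵥ x) ⬝ᵥ (Q *ᵥ y) := by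
  rw [← Matrix.mulVec_mulVec, Matrix.dotProduct_mulVec, Matrix.vecMul_transpose]

namespace State

variable {v : State}

/-- In an orthonormal frame this is Cauchy-Schwarz between the trace-free part of k, whose squared
norm is |k|² - H²/3, and w ⊗ w. -/
lemma Regular.shear_bound (hv : v.Regular) (w : Fin 3 → ℝ) :
    (w ⬝ᵥ (v.k *ᵥ w) - v.H / 3 * (w ⬝ᵥ (v.g *ᵥ w))) ^ 2
      ≤ (v.normSqK - v.H ^ 2 / 3) * (w ⬝ᵥ (v.g *ᵥ w)) ^ 2 := by
  obtain ⟨P, Q, hPQ, hQP, hg, hi⟩ := exists_frame hv.g_posDef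
  set k' := Pᵀ * v.k * P with hk'
  have hks : k'.IsSymm := by
    rw [Matrix.IsSymm, hk', Matrix.transpose_mul, Matrix.transpose_mul, Matrix.transpose_transpose,
      hv.k_symm, mul_assoc]
  have hK : v.K = P * k' * Q := by
    rw [K, hi, hk']
    simp only [mul_assoc, hPQ, mul_one]
  have hH : v.H = k'.trace := by
    rw [hv.H_eq, hK, Matrix.trace_mul_comm, ← mul_assoc, hQP, one_mul]
  have hN : v.normSqK = (k' * k').trace := by
    rw [hv.normSqK_eq, hK]
    have : P * k' * Q * (P * k' * Q) = P * (k' * k' * Q) := by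
      calc _ = P * k' * (Q * P) * k' * Q := by simp only [mul_assoc]
        _ = _ := by rw [hQP, mul_one]; simp only [mul_assoc]
    rw [this, Matrix.trace_mul_comm, mul_assoc, hQP, mul_one]
  obtain ⟨x, rfl⟩ : ∃ x, P *ᵥ x = w := ⟨Q *ᵥ w, by
    rw [Matrix.mulVec_mulVec, hPQ, Matrix.one_mulVec]⟩
  have e1 : (P *ᵥ x) ⬝ᵥ (v.g *ᵥ (P *ᵥ x)) = x ⬝ᵥ x := by
    rw [hg, dotProduct_frame, Matrix.mulVec_mulVec, hQP, Matrix.one_mulVec]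
  have e2 : (P *ᵥ x) ⬝ᵥ (v.k *ᵥ (P *ᵥ x)) = x ⬝ᵥ (k' *ᵥ x) := by
    rw [hk', ← Matrix.mulVec_mulVec, ← Matrix.mulVec_mulVec, Matrix.dotProduct_mulVec x,
      Matrix.vecMul_transpose]
  rw [e1, e2, hN, hH]
  have cs := Finset.sum_mul_sq_le_sq_mul_sq (Finset.univ : Finset (Fin 3 × Fin 3))
    (fun p => k' p.1 p.2 - k'.trace / 3 * (1 : Mat3) p.1 p.2) (fun p => x p.1 * x p.2)
  refine (le_of_eq ?_).trans (cs.trans (le_of_eq ?_))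
  · congr 1
    simp [Fintype.sum_prod_type, Matrix.mulVec, dotProduct, Fin.sum_univ_three, Matrix.one_apply]
    ring
  · congr 1
    · have h10 := hks.apply 0 1
      have h20 := hks.apply 0 2
      have h21 := hks.apply 1 2
      simp [Fintype.sum_prod_type, Fin.sum_univ_three, Matrix.one_apply, Matrix.trace,
        Matrix.mul_apply, h10, h20, h21]
      ring
    · simp [Fintype.sum_prod_type, dotProduct, Fin.sum_univ_three]
      ring

lemma Regular.metric_pos (hv : v.Regular) {w : Fin 3 → ℝ} (hw : w ≠ 0) :
    0 < w ⬝ᵥ (v.g *ᵥ w) := by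
  simpa using hv.g_posDef.dotProduct_mulVec_pos hw

lemma Regular.metric_nonneg (hv : v.Regular) (w : Fin 3 → ℝ) : 0 ≤ w ⬝ᵥ (v.g *ᵥ w) := by
  simpa using hv.g_posDef.posSemidef.dotProduct_mulVec_nonneg w

lemma Regular.shear_nonneg (hv : v.Regular) : 0 ≤ v.normSqK - v.H ^ 2 / 3 := by
  have h1 := hv.metric_pos (w := Pi.single 0 1) (by simp)
  have h2 := (sq_nonneg _).trans (hv.shear_bound (Pi.single 0 1))
  exact nonneg_of_mul_nonneg_left h2 (by positivity)

lemma Regular.normSqE_nonneg (hv : v.Regular) : 0 ≤ v.normSqE := hv.metric_nonneg v.E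

lemma Regular.uE_sq_le (hv : v.Regular) : v.uE ^ 2 ≤ v.normSqU * v.normSqE := by
  obtain ⟨P, Q, -, -, hg, -⟩ := exists_frame hv.g_posDef
  have h1 : v.uE = v.u ⬝ᵥ (v.g *ᵥ v.E) := rfl
  have h2 : v.normSqE = v.E ⬝ᵥ (v.g *ᵥ v.E) := rfl
  have h3 : v.normSqU = v.u ⬝ᵥ (v.g *ᵥ v.u) := u_dot_uLow.symm
  rw [h1, h2, h3, hg, dotProduct_frame, dotProduct_frame, dotProduct_frame]
  exact dotProduct_sq_le _ _

lemma Regular.normSqF_nonneg (hv : v.Regular) : 0 ≤ v.normSqF := by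
  obtain ⟨P, Q, -, -, -, hi⟩ := exists_frame hv.g_posDef
  have h1 : v.normSqF = ((Pᵀ * v.F * P)ᵀ * (Pᵀ * v.F * P)).trace := by
    have h2 : (Pᵀ * v.F * P)ᵀ = -(Pᵀ * v.F * P) := by
      rw [Matrix.transpose_mul, Matrix.transpose_mul, Matrix.transpose_transpose, hv.F_antisymm,
        neg_mul, mul_neg, mul_assoc]
    rw [h2, neg_mul, Matrix.trace_neg, hv.normSqF_eq, FUp_eq hv, hi]
    congr 1
    rw [mul_assoc P, mul_assoc P, mul_assoc P, Matrix.trace_mul_comm]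
    simp only [mul_assoc]
  rw [h1, Matrix.trace]
  refine Finset.sum_nonneg fun i _ => ?_
  rw [Matrix.diag_apply, Matrix.mul_apply]
  exact Finset.sum_nonneg fun j _ => mul_self_nonneg _

lemma Regular.τ00_nonneg (hv : v.Regular) : 0 ≤ v.τ00 := by
  have := hv.normSqE_nonneg
  have := hv.normSqF_nonneg
  rw [τ00]
  linarith

end State

namespace IsGlobalSolution

open State

variable {C : StructConst} {m Λ : ℝ} {v : ℝ → State} {t : ℝ}

lemma H_continuousOn (hv : IsGlobalSolution C m Λ v) : ContinuousOn (fun t => (v t).H) (Ici 0) :=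
  fun _ ht => (hv.H_eq ht).continuousWithinAt

/-- The Hamiltonian constraint is propagated by the evolution equations. -/
lemma hamiltonianDefect_eq_zero (hC : IsLie C) (hv : IsGlobalSolution C m Λ v)
    (h0 : (v 0).Constraints C m Λ) (ht : 0 ≤ t) : (v t).hamiltonianDefect C m Λ = 0 := by
  -- The order matters: each defect satisfies a homogeneous linear equation once the preceding ones
  -- vanish. In dimension three one component carries the whole magnetic constraint.
  have hB : ∀ s, 0 ≤ s → (v s).magneticDefect C 0 1 2 = 0 := fun s hs =>
    eq_zero_of_linear_ode (y := fun s => (v s).magneticDefect C 0 1 2) (a := fun _ => 0)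
      continuousOn_const (fun s hs => by simpa using hv.magneticDefect_eq hC hs)
      (h0.magnetic 0 1 2) hs
  have hE : ∀ s, 0 ≤ s → (v s).electricDefect C = 0 := fun s hs =>
    eq_zero_of_linear_ode (y := fun s => (v s).electricDefect C) hv.H_continuousOn
      (fun s hs => hv.electricDefect_eq hC hs) (by
      refine Eq.trans ?_ h0.electric
      have : trC C ⬝ᵥ (v 0).E = ∑ i, ∑ k, C i i k * (v 0).E k := by
        simp only [dotProduct, trC, Finset.sum_mul]
        exact Finset.sum_comm
      rw [electricDefect, this]) hs
  have hM : ∀ s, 0 ≤ s → (v s).momentumDefect C = 0 := fun s hs => funext fun j =>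
    eq_zero_of_linear_ode (y := fun s => (v s).momentumDefect C j) hv.H_continuousOn
      (fun s hs => hv.momentumDefect_eq hC hs (hB s hs) (hE s hs) j) (by
      rw [momentumDefect, ← divergence_eq hC (hv.regular le_rfl), h0.momentum, current]
      ring) hs
  refine eq_zero_of_linear_ode (y := fun s => (v s).hamiltonianDefect C m Λ)
    (a := fun s => 2 * (v s).H) (continuousOn_const.mul hv.H_continuousOn) (fun s hs => ?_) ?_ ht
  · have := hv.hamiltonianDefect_eq hC hs
    rw [hM s hs] at this
    simpa using this
  · rw [hamiltonianDefect, h0.hamiltonian, energy]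
    ring

/-- The square of the shear and the matter terms, expressed by the Hamiltonian constraint. -/
def excess (m Λ : ℝ) (v : State) : ℝ :=
  2 / 3 * v.H ^ 2 - 2 * (Λ + 4 * Real.pi * m ^ 2 * v.Φ ^ 2)

lemma excess_eq (hC : IsLie C) (hv : IsGlobalSolution C m Λ v)
    (h0 : (v 0).Constraints C m Λ) (ht : 0 ≤ t) : excess m Λ (v t)
      = ((v t).normSqK - (v t).H ^ 2 / 3) - scalarCurv C (v t).g
        + 16 * Real.pi * ((v t).U + (v t).τ00 + (v t).ρ * (v t).u0 ^ 2) := by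
  have := hv.hamiltonianDefect_eq_zero hC h0 ht
  rw [hamiltonianDefect, energy, T00] at this
  rw [excess]
  linear_combination this

/-- The Hamiltonian constraint eliminates R, leaving a sum in which every term will turn out
nonnegative. -/
lemma H_deriv (hC : IsLie C) (hv : IsGlobalSolution C m Λ v)
    (h0 : (v 0).Constraints C m Λ) (ht : 0 ≤ t) :
    HasDerivWithinAt (fun s => (v s).H) (excess m Λ (v t) / 2 + ((v t).normSqK - (v t).H ^ 2 / 3)
      + 16 * Real.pi * (v t).U + 8 * Real.pi * (v t).τ00
      + 4 * Real.pi * (v t).ρ * ((v t).u0 ^ 2 + (v t).normSqU)) (Ici 0) t := by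
  refine (hv.H_eq ht).congr_deriv ?_
  have := hv.hamiltonianDefect_eq_zero hC h0 ht
  rw [hamiltonianDefect, energy, T00] at this
  rw [traceCoeff, (hv.regular ht).trace_stress, energy, T00, excess]
  linear_combination this

lemma Φ_monotone (hv : IsGlobalSolution C m Λ v) : MonotoneOn (fun t => (v t).Φ) (Ici 0) :=
  monotoneOn_of_hasDerivWithinAt (convex_Ici 0) (fun t ht => hv.Φ_eq t ht)
    (fun _ _ => Real.sqrt_nonneg _)

end IsGlobalSolution

/-- The hypotheses on the initial data and on the Lie algebra. -/
structure Expanding (C : StructConst) (m Λ : ℝ) (v : ℝ → State) : Prop where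
  isLie : IsLie C
  not_so3 : ¬ IsSO3 C
  sol : IsGlobalSolution C m Λ v
  init : (v 0).IsInitialData C m Λ
  lam : -(4 * Real.pi * m ^ 2 * (v 0).Φ ^ 2) < Λ
  H_neg : (v 0).H < 0

/-! ### Sign and bounds of the mean curvature, exponential decay of the excess -/

namespace Expanding

open State IsGlobalSolution

variable {C : StructConst} {m Λ : ℝ} {v : ℝ → State} {t : ℝ}

/-- The only place where the Bianchi type enters: -R ≥ 0 is discarded together with the scalar and
matter energies. -/
lemma excess_bound (h : Expanding C m Λ v) (ht : 0 ≤ t) :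
    ((v t).normSqK - (v t).H ^ 2 / 3) + 16 * Real.pi * (v t).τ00 ≤ excess m Λ (v t) := by
  rw [excess_eq h.isLie h.sol h.init.constraints ht]
  have hR := scalarCurv_nonpos h.isLie h.not_so3 (h.sol.g_posDef t ht)
  have hU := h.sol.U_nonneg t ht
  have hρ := h.sol.ρ_pos t ht
  have : 0 ≤ 16 * Real.pi * ((v t).U + (v t).ρ * (v t).u0 ^ 2) := by positivity
  linarith

lemma excess_nonneg (h : Expanding C m Λ v) (ht : 0 ≤ t) : 0 ≤ excess m Λ (v t) := by
  refine le_trans ?_ (h.excess_bound ht)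
  have := (h.sol.regular ht).shear_nonneg
  have := (h.sol.regular ht).τ00_nonneg
  positivity

/-- The positive lower bound of the effective cosmological constant. -/
def gap (m Λ : ℝ) (v : ℝ → State) : ℝ := Λ + 4 * Real.pi * m ^ 2 * (v 0).Φ ^ 2

lemma gap_pos (h : Expanding C m Λ v) : 0 < gap m Λ v := by
  have := h.lam
  rw [gap]
  linarith

/-- Nonnegativity of the excess, with Φ ≥ Φ(0) > 0. -/
lemma H_sq_ge (h : Expanding C m Λ v) (ht : 0 ≤ t) : 3 * gap m Λ v ≤ (v t).H ^ 2 := by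
  have h1 := h.excess_nonneg ht
  have h2 : (v 0).Φ ≤ (v t).Φ := h.sol.Φ_monotone (mem_Ici.mpr le_rfl) ht ht
  have h3 : (v 0).Φ ^ 2 ≤ (v t).Φ ^ 2 := pow_le_pow_left₀ h.init.Φ_pos.le h2 2
  have h4 : 4 * Real.pi * m ^ 2 * (v 0).Φ ^ 2 ≤ 4 * Real.pi * m ^ 2 * (v t).Φ ^ 2 :=
    mul_le_mul_of_nonneg_left h3 (by positivity)
  rw [excess] at h1
  rw [gap]
  linarith

/-- A change of sign would produce a zero of H, against the positive lower bound of H². -/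
lemma H_lt_zero (h : Expanding C m Λ v) (ht : 0 ≤ t) : (v t).H < 0 := by
  by_contra! hn
  obtain ⟨s, hs, hs0⟩ := intermediate_value_Icc ht
    (h.sol.H_continuousOn.mono Icc_subset_Ici_self) ⟨h.H_neg.le, hn⟩
  have := h.H_sq_ge hs.1
  have hg := h.gap_pos
  simp only at hs0
  rw [hs0] at this
  norm_num at this
  linarith

lemma H_le (h : Expanding C m Λ v) (ht : 0 ≤ t) : (v t).H ≤ -Real.sqrt (3 * gap m Λ v) := by
  have := Real.sqrt_le_sqrt (h.H_sq_ge ht)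
  rw [Real.sqrt_sq_eq_abs, abs_of_neg (h.H_lt_zero ht)] at this
  linarith

lemma H_deriv_ge (h : Expanding C m Λ v) (ht : 0 ≤ t) :
    excess m Λ (v t) / 2 ≤ excess m Λ (v t) / 2 + ((v t).normSqK - (v t).H ^ 2 / 3)
      + 16 * Real.pi * (v t).U + 8 * Real.pi * (v t).τ00
      + 4 * Real.pi * (v t).ρ * ((v t).u0 ^ 2 + (v t).normSqU) := by
  have hr := h.sol.regular ht
  have h1 := hr.shear_nonneg
  have h2 := hr.τ00_nonneg
  have h3 := hr.normSqU_nonneg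
  have h4 := h.sol.U_nonneg t ht
  have h5 := (h.sol.ρ_pos t ht).le
  have : 0 ≤ 16 * Real.pi * (v t).U + 8 * Real.pi * (v t).τ00
      + 4 * Real.pi * (v t).ρ * ((v t).u0 ^ 2 + (v t).normSqU) := by positivity
  linarith

lemma H_ge (h : Expanding C m Λ v) (ht : 0 ≤ t) : (v 0).H ≤ (v t).H := by
  refine monotoneOn_of_hasDerivWithinAt (convex_Ici 0)
    (fun t ht => H_deriv h.isLie h.sol h.init.constraints ht) (fun t ht => ?_)
    (mem_Ici.mpr le_rfl) ht ht
  have := h.H_deriv_ge ht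
  have := h.excess_nonneg ht
  linarith

/-- Ż = (4/3)HḢ - 16πm²Φ√(2U), where the last term only helps as Φ ≥ 0. From Ḣ ≥ Z/2 and H ≤
-√(3·gap) follows Ż ≤ (2/3)HZ ≤ -(2/3)√(3·gap) Z. -/
lemma excess_decay (h : Expanding C m Λ v) (ht : 0 ≤ t) :
    excess m Λ (v t) ≤ excess m Λ (v 0) * Real.exp (-(2 / 3 * Real.sqrt (3 * gap m Λ v)) * t) := by
  set c := 2 / 3 * Real.sqrt (3 * gap m Λ v) with hc
  have hd : ∀ t ∈ Ici (0 : ℝ), HasDerivWithinAt (fun s => excess m Λ (v s) * Real.exp (c * s))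
      ((4 / 3 * (v t).H * (excess m Λ (v t) / 2 + ((v t).normSqK - (v t).H ^ 2 / 3)
        + 16 * Real.pi * (v t).U + 8 * Real.pi * (v t).τ00
        + 4 * Real.pi * (v t).ρ * ((v t).u0 ^ 2 + (v t).normSqU))
        - 16 * (Real.pi * m ^ 2 * ((v t).Φ * Real.sqrt (2 * (v t).U)))
        + excess m Λ (v t) * c) * Real.exp (c * t)) (Ici 0) t := by
    intro t ht
    have h1 := ((H_deriv h.isLie h.sol h.init.constraints ht).fun_pow 2).const_mul (2 / 3)
    have h2 := (((h.sol.Φ_eq t ht).fun_pow 2).const_mul (4 * Real.pi * m ^ 2)).const_add Λ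
      |>.const_mul 2
    have h3 := ((hasDerivAt_id t).const_mul c).exp.hasDerivWithinAt (s := Ici 0)
    refine ((h1.fun_sub h2).fun_mul h3).congr_deriv ?_
    simp only [mul_one, id_eq, excess]
    push_cast
    ring
  have key := antitoneOn_of_hasDerivWithinAt (convex_Ici 0) hd (fun t ht => ?_)
    (mem_Ici.mpr le_rfl) ht ht
  · simp only [mul_zero, Real.exp_zero, mul_one] at key
    rw [neg_mul, Real.exp_neg, ← div_eq_mul_inv, le_div_iff₀ (Real.exp_pos _)]
    exact key
  · have hΦ : 0 ≤ (v t).Φ := h.init.Φ_pos.le.trans (h.sol.Φ_monotone (mem_Ici.mpr le_rfl) ht ht)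
    have hU := Real.sqrt_nonneg (2 * (v t).U)
    have hH := h.H_le ht
    have hH0 := h.H_lt_zero ht
    have hg := h.H_deriv_ge ht
    have hZ := h.excess_nonneg ht
    set D := excess m Λ (v t) / 2 + ((v t).normSqK - (v t).H ^ 2 / 3)
      + 16 * Real.pi * (v t).U + 8 * Real.pi * (v t).τ00
      + 4 * Real.pi * (v t).ρ * ((v t).u0 ^ 2 + (v t).normSqU) with hD
    have e1 : 0 ≤ Real.pi * m ^ 2 * ((v t).Φ * Real.sqrt (2 * (v t).U)) := by positivity
    have e2 : (v t).H * D ≤ (v t).H * (excess m Λ (v t) / 2) :=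
      mul_le_mul_of_nonpos_left hg hH0.le
    have e3 : (v t).H * excess m Λ (v t) ≤ -Real.sqrt (3 * gap m Λ v) * excess m Λ (v t) :=
      mul_le_mul_of_nonneg_right hH hZ
    have e4 := Real.exp_pos (c * t)
    have e5 : 4 / 3 * (v t).H * D - 16 * (Real.pi * m ^ 2 * ((v t).Φ * Real.sqrt (2 * (v t).U)))
        + excess m Λ (v t) * c ≤ 0 := by
      rw [hc]
      nlinarith
    exact mul_nonpos_of_nonpos_of_nonneg e5 e4.le

end Expanding

end Bianchi
end

/-! ### Decay of the shear and of the electric field, bound on the matter velocity -/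

noncomputable section
namespace Bianchi

/-- A differential inequality with a coefficient that decays exponentially in the time `t`. -/
lemma antitoneOn_mul_exp_of_decay {S : Set ℝ} (hS : Convex ℝ S) {t t' y y' : ℝ → ℝ} {B c : ℝ}
    (hc : 0 < c) (ht : ∀ s ∈ S, HasDerivWithinAt t (t' s) S s)
    (hy : ∀ s ∈ S, HasDerivWithinAt y (y' s) S s)
    (hle : ∀ s ∈ S, y' s ≤ B * Real.exp (-c * t s) * t' s * y s) :
    AntitoneOn (fun s => y s * Real.exp (B / c * Real.exp (-c * t s))) S := by
  refine antitoneOn_of_hasDerivWithinAt hS (f' := fun s =>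
    (y' s - B * Real.exp (-c * t s) * t' s * y s) * Real.exp (B / c * Real.exp (-c * t s)))
    (fun s hs => ?_) fun s hs =>
      mul_nonpos_of_nonpos_of_nonneg (sub_nonpos.mpr (hle s hs)) (Real.exp_pos _).le
  refine ((hy s hs).fun_mul ((((ht s hs).const_mul (-c)).exp.const_mul (B / c)).exp)).congr_deriv ?_
  field_simp
  ring

/-- Grönwall with coefficient B e^{-ct} dt. From a nonnegative initial time the increment of
-(B/c)e^{-ct} is at most B/c, so the bound does not depend on the length of `S`. -/
lemma le_mul_exp_of_decay {S : Set ℝ} (hS : Convex ℝ S) {t t' y y' : ℝ → ℝ} {B c : ℝ}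
    (hc : 0 < c) (hB : 0 ≤ B) (ht : ∀ s ∈ S, HasDerivWithinAt t (t' s) S s)
    (hy : ∀ s ∈ S, HasDerivWithinAt y (y' s) S s) (hy0 : ∀ s ∈ S, 0 ≤ y s)
    (hle : ∀ s ∈ S, y' s ≤ B * Real.exp (-c * t s) * t' s * y s)
    {a s : ℝ} (ha : a ∈ S) (hs : s ∈ S) (has : a ≤ s) (hta : 0 ≤ t a) :
    y s ≤ y a * Real.exp (B / c) := by
  have h1 := antitoneOn_mul_exp_of_decay hS hc ht hy hle ha hs has
  have h2 : 0 ≤ B / c := by positivity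
  calc y s ≤ y s * Real.exp (B / c * Real.exp (-c * t s)) :=
        le_mul_of_one_le_right (hy0 s hs) (Real.one_le_exp (by positivity))
    _ ≤ y a * Real.exp (B / c * Real.exp (-c * t a)) := h1
    _ ≤ y a * Real.exp (B / c) := by
        refine mul_le_mul_of_nonneg_left (Real.exp_le_exp.mpr ?_) (hy0 a ha)
        refine mul_le_of_le_one_right h2 (Real.exp_le_one_iff.mpr ?_)
        nlinarith

/-- Exponential decay of the trace-free part of the second fundamental form and of the electric
field. -/
structure Decay (v : ℝ → State) (A c κ : ℝ) : Prop where
  A_nonneg : 0 ≤ A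
  c_pos : 0 < c
  κ_nonneg : 0 ≤ κ
  le : ∀ t, 0 ≤ t → ∀ w, w ⬝ᵥ ((v t).k *ᵥ w) ≤ A * Real.exp (-c * t) * (w ⬝ᵥ ((v t).g *ᵥ w))
  ge : ∀ t, 0 ≤ t → ∀ w, -(κ * (w ⬝ᵥ ((v t).g *ᵥ w))) ≤ w ⬝ᵥ ((v t).k *ᵥ w)
  normSqE_le : ∀ t, 0 ≤ t → (v t).normSqE ≤ (A * Real.exp (-c * t)) ^ 2

namespace Expanding

open State IsGlobalSolution

variable {C : StructConst} {m Λ : ℝ} {v : ℝ → State} {t : ℝ}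

/-- Shear and electric field enter the excess quadratically, so they decay at half its rate. -/
lemma exists_decay (h : Expanding C m Λ v) : ∃ A c κ, Decay v A c κ := by
  set A := Real.sqrt (excess m Λ (v 0)) with hA
  set c := Real.sqrt (3 * gap m Λ v) / 3 with hc
  have hc0 : 0 < c := div_pos (Real.sqrt_pos.mpr (by linarith [h.gap_pos])) (by norm_num)
  have hZ : ∀ t, 0 ≤ t → excess m Λ (v t) ≤ (A * Real.exp (-c * t)) ^ 2 := by
    intro t ht
    refine (h.excess_decay ht).trans_eq ?_
    rw [mul_pow, hA, Real.sq_sqrt (h.excess_nonneg le_rfl), ← Real.exp_nat_mul, hc]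
    congr 2
    push_cast
    ring
  have hsh : ∀ t, 0 ≤ t → ∀ w, |w ⬝ᵥ ((v t).k *ᵥ w) - (v t).H / 3 * (w ⬝ᵥ ((v t).g *ᵥ w))|
      ≤ A * Real.exp (-c * t) * (w ⬝ᵥ ((v t).g *ᵥ w)) := by
    intro t ht w
    have hr := h.sol.regular ht
    have hn := hr.metric_nonneg w
    refine abs_le_of_sq_le_sq ?_ (by positivity)
    rw [mul_pow]
    refine (hr.shear_bound w).trans (mul_le_mul_of_nonneg_right ?_ (sq_nonneg _))
    have := h.excess_bound ht
    have h3 := hr.τ00_nonneg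
    have : 0 ≤ 16 * Real.pi * (v t).τ00 := by positivity
    linarith [hZ t ht]
  -- The constant κ comes from k ≥ (H/3 - A e^{-ct}) g and the monotonicity of H. In the upper bound
  -- the negative term H/3 is dropped.
  refine ⟨A, c, A - (v 0).H / 3, Real.sqrt_nonneg _, hc0, ?_, fun t ht w => ?_, fun t ht w => ?_,
    fun t ht => (hZ t ht).trans' ?_⟩
  · linarith [h.H_neg, Real.sqrt_nonneg (excess m Λ (v 0))]
  · have h1 := (abs_le.mp (hsh t ht w)).2
    have h2 := (h.sol.regular ht).metric_nonneg w
    nlinarith [h.H_lt_zero ht]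
  · have h1 := (abs_le.mp (hsh t ht w)).1
    have h2 := (h.sol.regular ht).metric_nonneg w
    have h3 : Real.exp (-c * t) ≤ 1 := Real.exp_le_one_iff.mpr (by nlinarith)
    have h4 := mul_le_mul_of_nonneg_right h3 (mul_nonneg (Real.sqrt_nonneg (excess m Λ (v 0))) h2)
    have h5 := mul_le_mul_of_nonneg_right (h.H_ge ht) h2
    rw [← hA] at h4
    linarith
  · have hr := h.sol.regular ht
    have h1 := h.excess_bound ht
    have h2 := hr.normSqF_nonneg
    have h3 := hr.normSqE_nonneg
    have h4 := hr.shear_nonneg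
    -- The excess dominates 16πτ₀₀ ≥ 8π|E|², hence |E|².
    have h5 : 1 ≤ 8 * Real.pi := by linarith [Real.pi_gt_three]
    rw [τ00] at h1
    have h6 := mul_le_mul_of_nonneg_right h5 h3
    have h7 : 0 ≤ Real.pi * (v t).normSqF := by positivity
    linarith

/-- The spatial velocity of matter is bounded. -/
lemma normSqU_bounded (h : Expanding C m Λ v) : ∃ B, ∀ t, 0 ≤ t → (v t).normSqU ≤ B := by
  obtain ⟨A, c, κ, hd⟩ := h.exists_decay
  set q := 4 * Real.pi * ((v 0).e / (v 0).ρ) with hq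
  have hratio : ∀ t, 0 ≤ t → 4 * Real.pi * ((v t).e / (v t).ρ) = q := fun t ht =>
    congrArg (4 * Real.pi * ·) (le_antisymm (antitoneOn_of_hasDerivWithinAt (convex_Ici 0)
      (fun t ht => h.sol.charge_ratio_eq ht) (fun _ _ => le_rfl) (mem_Ici.mpr le_rfl) ht ht)
      (monotoneOn_of_hasDerivWithinAt (convex_Ici 0)
      (fun t ht => h.sol.charge_ratio_eq ht) (fun _ _ => le_rfl) (mem_Ici.mpr le_rfl) ht ht))
  have hA := hd.A_nonneg
  -- Grönwall is applied to 1 + |u|² because the electric force is only of order |u||E|, which is at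
  -- most A e^{-ct}(1 + |u|²).
  refine ⟨(1 + (v 0).normSqU) * Real.exp ((2 * A * (1 + |q|)) / c), fun t ht => ?_⟩
  have key := le_mul_exp_of_decay (convex_Ici 0) (t := fun s => s) (t' := fun _ => 1)
    (y := fun s => 1 + (v s).normSqU) (B := 2 * A * (1 + |q|)) hd.c_pos (by positivity)
    (fun s _ => hasDerivWithinAt_id s _) (fun s hs => (h.sol.normSqU_eq h.isLie hs).const_add 1)
    (fun s hs => by have := (h.sol.regular hs).normSqU_nonneg; positivity) (fun s hs => ?_)
    (mem_Ici.mpr le_rfl) ht ht le_rfl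
  · linarith
  · have hs0 : 0 ≤ s := hs
    have hr := h.sol.regular hs
    have hn := hr.normSqU_nonneg
    have h1 : (v s).kuu ≤ A * Real.exp (-c * s) * (v s).normSqU := by
      have := hd.le s hs (v s).u
      have e1 : (v s).u ⬝ᵥ ((v s).g *ᵥ (v s).u) = (v s).normSqU := u_dot_uLow
      have e2 : (v s).u ⬝ᵥ ((v s).k *ᵥ (v s).u) = (v s).kuu := by
        simp only [kuu, dotProduct, Matrix.mulVec, Fin.sum_univ_three]
        ring
      rwa [e1, e2] at this
    have h2 : |(v s).uE| ≤ A * Real.exp (-c * s) * (1 + (v s).normSqU) := by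
      refine abs_le_of_sq_le_sq (hr.uE_sq_le.trans ?_) (by positivity)
      rw [mul_pow, mul_comm]
      refine mul_le_mul (hd.normSqE_le s hs) ?_ hn (sq_nonneg _)
      nlinarith
    have h3 : -(q * (v s).uE) ≤ |q| * (A * Real.exp (-c * s) * (1 + (v s).normSqU)) := by
      refine (neg_le_abs _).trans ?_
      rw [abs_mul]
      exact mul_le_mul_of_nonneg_left h2 (abs_nonneg _)
    have h4 : 0 ≤ A * Real.exp (-c * s) := by positivity
    rw [hratio s hs]
    linarith

end Expanding

end Bianchi
end

/-! ### A priori estimates for the velocity of a causal geodesic -/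

noncomputable section
namespace Bianchi

lemma sum_option {f : Option (Fin 3) → ℝ} : ∑ α, f α = f none + ∑ i, f (some i) :=
  Fintype.sum_option f

/-- The coefficients of the space-time connection over a slice, in terms of its second
fundamental form. -/
def stateConn (C : StructConst) (v : State) :
    Option (Fin 3) → Option (Fin 3) → Option (Fin 3) → ℝ
  | some l, some i, some j => connCoeff C v.g l i j
  | none, some i, some j => -v.k i j
  | some j, some i, none => -∑ p, v.g⁻¹ j p * v.k i p
  | some j, none, some i => -∑ p, v.g⁻¹ j p * v.k i p
  | _, _, _ => 0

lemma IsGlobalSolution.sndFundForm_eq {C : StructConst} {m Λ : ℝ} {v : ℝ → State}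
    (hv : IsGlobalSolution C m Λ v) {t : ℝ} (ht : 0 ≤ t) :
    sndFundForm (fun r => (v r).g) t = (v t).k := by
  ext i j
  rw [sndFundForm, Matrix.of_apply,
    (hv.g_eq t ht i j).derivWithin (uniqueDiffOn_Ici 0 t ht)]
  ring

lemma IsGlobalSolution.spacetimeConn_eq {C : StructConst} {m Λ : ℝ} {v : ℝ → State}
    (hv : IsGlobalSolution C m Λ v) {t : ℝ} (ht : 0 ≤ t) :
    spacetimeConn C (fun r => (v r).g) t = stateConn C (v t) := by
  funext l α β
  cases l <;> cases α <;> cases β <;> simp only [spacetimeConn, stateConn, hv.sndFundForm_eq ht]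

/-- The acceleration of a geodesic with velocity `w`. -/
def accel (C : StructConst) (v : State) (w : Option (Fin 3) → ℝ) (l : Option (Fin 3)) : ℝ :=
  -∑ α, ∑ β, stateConn C v l α β * w α * w β

/-- The spatial part of a velocity. -/
def spatial (w : Option (Fin 3) → ℝ) : Fin 3 → ℝ := fun i => w (some i)

lemma accel_none (C : StructConst) (v : State) (w : Option (Fin 3) → ℝ) :
    accel C v w none = spatial w ⬝ᵥ (v.k *ᵥ spatial w) := by
  simp only [accel, sum_option, stateConn, spatial, dotProduct, Matrix.mulVec, Fin.sum_univ_three]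
  ring

lemma spatial_accel (C : StructConst) {v : State} (hv : v.Regular) (w : Option (Fin 3) → ℝ) :
    spatial (accel C v w)
      = -app (connCoeff C v.g) (spatial w) (spatial w) + (2 * w none) • (v.K *ᵥ spatial w) := by
  have hk := fun i j => hv.k_symm.apply i j
  funext i
  simp only [spatial, accel, sum_option, stateConn, dotProduct, Matrix.mulVec, app,
    Pi.add_apply, Pi.neg_apply, Pi.smul_apply, smul_eq_mul, State.K, Matrix.mul_apply,
    Fin.sum_univ_three, hk 0 1, hk 0 2, hk 1 2]
  ring

/-- All brackets in the Koszul formula are [x, x]; the intrinsic geometry of the slice therefore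
does not affect the speed. -/
lemma metric_connCoeff_self {C : StructConst} (hC : IsLie C) {v : State} (hv : v.Regular)
    (x : Fin 3 → ℝ) : x ⬝ᵥ (v.g *ᵥ app (connCoeff C v.g) x x) = 0 := by
  have h0 : app C x x = 0 := by
    have := hC.antisymm x x
    rwa [self_eq_neg] at this
  rw [koszul C hv.isUnit_det, h0]
  simp

/-- A future-directed solution `(t, w)` of the geodesic equations for the time coordinate and the
velocity. -/
structure IsGeodesicVelocityOn (C : StructConst) (v : ℝ → State) (S : Set ℝ) (t : ℝ → ℝ)
    (w : ℝ → Option (Fin 3) → ℝ) : Prop where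
  time_nonneg : ∀ s ∈ S, 0 ≤ t s
  time_deriv : ∀ s ∈ S, HasDerivWithinAt t (w s none) S s
  geodesic : ∀ s ∈ S, ∀ l, HasDerivWithinAt (fun r => w r l) (accel C (v (t s)) (w s) l) S s
  future : ∀ s ∈ S, 0 < w s none

/-- The square of the spatial velocity. -/
def speedSq (v : State) (w : Option (Fin 3) → ℝ) : ℝ := spatial w ⬝ᵥ (v.g *ᵥ spatial w)

lemma speedSq_eq_sum (v : State) (w : Option (Fin 3) → ℝ) :
    speedSq v w = ∑ i, ∑ j, v.g i j * w (some i) * w (some j) := by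
  simp only [speedSq, spatial, dotProduct, Matrix.mulVec, Fin.sum_univ_three]
  ring

namespace IsGeodesicVelocityOn

variable {C : StructConst} {m Λ : ℝ} {v : ℝ → State} {S : Set ℝ} {t : ℝ → ℝ}
  {w : ℝ → Option (Fin 3) → ℝ}

lemma mono {S' : Set ℝ} (h : IsGeodesicVelocityOn C v S t w) (hS : S' ⊆ S) :
    IsGeodesicVelocityOn C v S' t w :=
  ⟨fun s hs => h.time_nonneg s (hS hs), fun s hs => (h.time_deriv s (hS hs)).mono hS,
    fun s hs l => (h.geodesic s (hS hs) l).mono hS, fun s hs => h.future s (hS hs)⟩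

lemma metric_deriv (h : IsGeodesicVelocityOn C v S t w) (hv : IsGlobalSolution C m Λ v) {s : ℝ}
    (hs : s ∈ S) (i j : Fin 3) : HasDerivWithinAt (fun r => (v (t r)).g i j)
      (-2 * (v (t s)).k i j * w s none) S s :=
  (hv.g_eq (t s) (h.time_nonneg s hs) i j).comp s (h.time_deriv s hs) fun r hr => h.time_nonneg r hr

/-- The change of the metric contributes -2k(w,w)w⁰ and the acceleration 4k(w,w)w⁰. -/
lemma speedSq_deriv (hC : IsLie C) (h : IsGeodesicVelocityOn C v S t w)
    (hv : IsGlobalSolution C m Λ v) {s : ℝ} (hs : s ∈ S) :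
    HasDerivWithinAt (fun r => speedSq (v (t r)) (w r))
      (2 * (spatial (w s) ⬝ᵥ ((v (t s)).k *ᵥ spatial (w s))) * w s none) S s := by
  have hr := hv.regular (h.time_nonneg s hs)
  have h1 : HasDerivWithinAt (fun r => ∑ i, ∑ j, (v (t r)).g i j * w r (some i) * w r (some j))
      (∑ i, ∑ j, ((-2 * (v (t s)).k i j * w s none * w s (some i)
        + (v (t s)).g i j * accel C (v (t s)) (w s) (some i)) * w s (some j)
        + (v (t s)).g i j * w s (some i) * accel C (v (t s)) (w s) (some j))) S s :=
    HasDerivWithinAt.fun_sum fun i _ => HasDerivWithinAt.fun_sum fun j _ =>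
      ((h.metric_deriv hv hs i j).mul (h.geodesic s hs _)).mul (h.geodesic s hs _)
  simp only [← speedSq_eq_sum] at h1
  refine h1.congr_deriv ?_
  have h2 : spatial (w s) ⬝ᵥ ((v (t s)).g *ᵥ spatial (accel C (v (t s)) (w s)))
      = 2 * w s none * (spatial (w s) ⬝ᵥ ((v (t s)).k *ᵥ spatial (w s))) := by
    rw [spatial_accel C hr, Matrix.mulVec_add, dotProduct_add, Matrix.mulVec_neg, dotProduct_neg,
      metric_connCoeff_self hC hr, Matrix.mulVec_smul, Matrix.mulVec_mulVec, hr.g_mul_K,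
      dotProduct_smul]
    simp
  have hg := fun i j => hr.g_symm.apply i j
  simp only [spatial, dotProduct, Matrix.mulVec, Fin.sum_univ_three, hg 0 1, hg 0 2, hg 1 2]
    at h2 ⊢
  linear_combination 2 * h2

lemma speedSq_nonneg (h : IsGeodesicVelocityOn C v S t w) (hv : IsGlobalSolution C m Λ v) {s : ℝ}
    (hs : s ∈ S) : 0 ≤ speedSq (v (t s)) (w s) :=
  (hv.regular (h.time_nonneg s hs)).metric_nonneg _

/-- The length of the velocity is conserved. -/
lemma sub_speedSq_eq (hC : IsLie C) (h : IsGeodesicVelocityOn C v S t w)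
    (hv : IsGlobalSolution C m Λ v) (hS : Convex ℝ S) {a s : ℝ} (ha : a ∈ S) (hs : s ∈ S)
    (has : a ≤ s) : w s none ^ 2 - speedSq (v (t s)) (w s)
      = w a none ^ 2 - speedSq (v (t a)) (w a) := by
  have hd : ∀ s ∈ S, HasDerivWithinAt
      (fun s => w s none ^ 2 - speedSq (v (t s)) (w s)) 0 S s := fun s hs => by
    refine (((h.geodesic s hs none).fun_pow 2).fun_sub (h.speedSq_deriv hC hv hs)).congr_deriv ?_
    rw [accel_none]
    push_cast
    ring
  exact le_antisymm (antitoneOn_of_hasDerivWithinAt hS hd (fun _ _ => le_rfl) ha hs has)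
    (monotoneOn_of_hasDerivWithinAt hS hd (fun _ _ => le_rfl) ha hs has)

variable {A c κ : ℝ}

lemma speedSq_le (hC : IsLie C) (h : IsGeodesicVelocityOn C v S t w)
    (hv : IsGlobalSolution C m Λ v) (hd : Decay v A c κ) (hS : Convex ℝ S) {a s : ℝ} (ha : a ∈ S)
    (hs : s ∈ S) (has : a ≤ s) :
    speedSq (v (t s)) (w s) ≤ speedSq (v (t a)) (w a) * Real.exp (2 * A / c) := by
  refine le_mul_exp_of_decay hS hd.c_pos (mul_nonneg two_pos.le hd.A_nonneg) h.time_deriv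
    (fun s hs => h.speedSq_deriv hC hv hs) (fun s hs => h.speedSq_nonneg hv hs) (fun s hs => ?_)
    ha hs has (h.time_nonneg a ha)
  have h1 := mul_le_mul_of_nonneg_right (hd.le (t s) (h.time_nonneg s hs) (spatial (w s)))
    (h.future s hs).le
  rw [speedSq]
  linarith

lemma velocity_le (hC : IsLie C) (h : IsGeodesicVelocityOn C v S t w)
    (hv : IsGlobalSolution C m Λ v) (hd : Decay v A c κ) (hS : Convex ℝ S) {a s : ℝ} (ha : a ∈ S)
    (hs : s ∈ S) (has : a ≤ s) (hca : speedSq (v (t a)) (w a) ≤ w a none ^ 2) :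
    w s none ≤ w a none * Real.exp (A / c) := by
  have h1 := h.speedSq_le hC hv hd hS ha hs has
  have h2 := h.sub_speedSq_eq hC hv hS ha hs has
  have h3 : Real.exp (2 * A / c) = Real.exp (A / c) ^ 2 := by
    rw [← Real.exp_nat_mul]
    congr 1
    push_cast
    ring
  have h4 : 1 ≤ Real.exp (2 * A / c) := Real.one_le_exp
    (div_nonneg (mul_nonneg two_pos.le hd.A_nonneg) hd.c_pos.le)
  have h5 : 0 ≤ w a none * Real.exp (A / c) := mul_nonneg (h.future a ha).le (Real.exp_pos _).le
  refine le_of_sq_le_sq ?_ h5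
  rw [mul_pow, ← h3]
  -- The conserved difference (w⁰)² - |w|² is nonnegative, so it too may be multiplied by the
  -- exponential, which is at least 1.
  nlinarith [mul_le_mul_of_nonneg_left h4 (sub_nonneg.mpr hca)]

lemma time_le (hC : IsLie C) (h : IsGeodesicVelocityOn C v S t w)
    (hv : IsGlobalSolution C m Λ v) (hd : Decay v A c κ) (hS : Convex ℝ S) {a s : ℝ} (ha : a ∈ S)
    (hs : s ∈ S) (has : a ≤ s) (hca : speedSq (v (t a)) (w a) ≤ w a none ^ 2) :
    t s ≤ t a + w a none * Real.exp (A / c) * (s - a) := by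
  have hS' : Convex ℝ (S ∩ Ici a) := hS.inter (convex_Ici a)
  have := antitoneOn_of_hasDerivWithinAt hS' (f := fun s => t s - w a none * Real.exp (A / c) * s)
    (fun s hs => ((h.time_deriv s hs.1).mono inter_subset_left).fun_sub
      ((hasDerivWithinAt_id s _).const_mul (w a none * Real.exp (A / c))))
    (fun s hs => by linarith [h.velocity_le hC hv hd hS ha hs.1 hs.2 hca])
    ⟨ha, mem_Ici.mpr le_rfl⟩ ⟨hs, has⟩ has
  simp only at this
  linarith

/-- With W the upper bound of w⁰ and |w| ≤ w⁰, the derivative k(w,w) of w⁰ is at least -κ|w|² ≥ -κW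
w⁰. Thus w⁰ cannot reach zero in bounded parameter time. -/
lemma velocity_ge (hC : IsLie C) (h : IsGeodesicVelocityOn C v S t w)
    (hv : IsGlobalSolution C m Λ v) (hd : Decay v A c κ) (hS : Convex ℝ S) {a s : ℝ} (ha : a ∈ S)
    (hs : s ∈ S) (has : a ≤ s) (hca : speedSq (v (t a)) (w a) ≤ w a none ^ 2) :
    w a none * Real.exp (-(κ * (w a none * Real.exp (A / c))) * (s - a)) ≤ w s none := by
  set L := κ * (w a none * Real.exp (A / c)) with hL
  have hS' : Convex ℝ (S ∩ Ici a) := hS.inter (convex_Ici a)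
  have key := monotoneOn_of_hasDerivWithinAt hS'
    (f := fun s => w s none * Real.exp (L * (s - a)))
    (fun s hs => ((h.geodesic s hs.1 none).mono inter_subset_left).fun_mul
      (((hasDerivAt_id s).sub_const a).const_mul L).exp.hasDerivWithinAt) (fun s hs => ?_)
    ⟨ha, mem_Ici.mpr le_rfl⟩ ⟨hs, has⟩ has
  · simp only [sub_self, mul_zero, Real.exp_zero, mul_one] at key
    rw [neg_mul, Real.exp_neg, ← div_eq_mul_inv, div_le_iff₀ (Real.exp_pos _)]
    exact key
  · have h1 := hd.ge (t s) (h.time_nonneg s hs.1) (spatial (w s))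
    have h2 := h.velocity_le hC hv hd hS ha hs.1 hs.2 hca
    have h3 := h.sub_speedSq_eq hC hv hS ha hs.1 hs.2
    have h4 : speedSq (v (t s)) (w s) ≤ w s none ^ 2 := by linarith
    have h5 := (h.future s hs.1).le
    have h6 : κ * speedSq (v (t s)) (w s) ≤ L * w s none := by
      rw [hL, mul_assoc]
      refine mul_le_mul_of_nonneg_left (h4.trans ?_) hd.κ_nonneg
      rw [sq]
      exact mul_le_mul_of_nonneg_right h2 h5
    rw [accel_none]
    have h7 : 0 ≤ (spatial (w s) ⬝ᵥ ((v (t s)).k *ᵥ spatial (w s)) + L * w s none)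
        * Real.exp (L * (s - a)) := by
      refine mul_nonneg ?_ (Real.exp_pos _).le
      rw [speedSq] at h6
      linarith
    refine h7.trans_eq ?_
    simp only [id_eq]
    ring

end IsGeodesicVelocityOn

/-- Cauchy-Schwarz in an orthonormal frame; it turns a bound on the speed into bounds on the frame
components. -/
lemma State.Regular.sq_le {v : State} (hv : v.Regular) (x : Fin 3 → ℝ) (i : Fin 3) :
    x i ^ 2 ≤ v.g⁻¹ i i * (x ⬝ᵥ (v.g *ᵥ x)) := by
  obtain ⟨P, Q, hPQ, -, hg, hi⟩ := exists_frame hv.g_posDef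
  have h1 : x i = P i ⬝ᵥ (Q *ᵥ x) := by
    have : (P *ᵥ (Q *ᵥ x)) i = x i := by rw [Matrix.mulVec_mulVec, hPQ, Matrix.one_mulVec]
    exact this.symm
  have h2 : v.g⁻¹ i i = P i ⬝ᵥ P i := by rw [hi]; rfl
  rw [h1, h2, hg, dotProduct_frame]
  exact dotProduct_sq_le _ _

end Bianchi
end

noncomputable section
namespace Bianchi

open scoped NNReal

/-! ### Bounded Lipschitz functions -/

/-- Bounded and Lipschitz continuous real functions. -/
def BddLip {X : Type*} [PseudoMetricSpace X] (f : X → ℝ) : Prop :=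
  (∃ K : ℝ≥0, LipschitzWith K f) ∧ ∃ B : ℝ, ∀ x, |f x| ≤ B

namespace BddLip

variable {X : Type*} [PseudoMetricSpace X] {f g : X → ℝ}

lemma const (a : ℝ) : BddLip fun _ : X => a := ⟨⟨0, LipschitzWith.const a⟩, |a|, fun _ => le_rfl⟩

lemma neg (hf : BddLip f) : BddLip fun x => -f x := by
  obtain ⟨⟨K, hK⟩, B, hB⟩ := hf
  exact ⟨⟨K, hK.neg⟩, B, fun x => by simpa using hB x⟩

lemma add (hf : BddLip f) (hg : BddLip g) : BddLip fun x => f x + g x := by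
  obtain ⟨⟨K, hK⟩, B, hB⟩ := hf
  obtain ⟨⟨K', hK'⟩, B', hB'⟩ := hg
  exact ⟨⟨K + K', hK.add hK'⟩, B + B',
    fun x => (abs_add_le _ _).trans (add_le_add (hB x) (hB' x))⟩

lemma mul (hf : BddLip f) (hg : BddLip g) : BddLip fun x => f x * g x := by
  obtain ⟨⟨K, hK⟩, B, hB⟩ := hf
  obtain ⟨⟨K', hK'⟩, B', hB'⟩ := hg
  refine ⟨⟨_, LipschitzWith.of_dist_le' (K := B * K' + K * B') fun x y => ?_⟩, B * B',
    fun x => ?_⟩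
  · have h1 := hK.dist_le_mul x y
    have h2 := hK'.dist_le_mul x y
    rw [Real.dist_eq] at h1 h2 ⊢
    have e : f x * g x - f y * g y = f x * (g x - g y) + (f x - f y) * g y := by ring
    rw [e]
    refine (abs_add_le _ _).trans ?_
    rw [abs_mul, abs_mul]
    have h3 := mul_le_mul (hB x) h2 (abs_nonneg _) ((abs_nonneg _).trans (hB x))
    have h4 := mul_le_mul h1 (hB' y) (abs_nonneg _) (by positivity)
    linarith
  · rw [abs_mul]
    exact mul_le_mul (hB x) (hB' x) (abs_nonneg _) ((abs_nonneg _).trans (hB x))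

lemma sum {ι : Type*} (s : Finset ι) {f : ι → X → ℝ} (hf : ∀ i, BddLip (f i)) :
    BddLip fun x => ∑ i ∈ s, f i x := by
  classical
  induction s using Finset.induction_on with
  | empty => simpa using const 0
  | insert a s ha ih => simpa [Finset.sum_insert ha] using (hf a).add ih

end BddLip

/-- The nearest point of the interval `[a, b]`. -/
def clamp (a b x : ℝ) : ℝ := max a (min b x)

lemma clamp_mem {a b : ℝ} (h : a ≤ b) (x : ℝ) : clamp a b x ∈ Icc a b :=
  ⟨le_max_left _ _, max_le h (min_le_left _ _)⟩

lemma clamp_eq {a b x : ℝ} (h : x ∈ Icc a b) : clamp a b x = x := by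
  rw [clamp, min_eq_right h.2, max_eq_right h.1]

lemma lipschitzWith_clamp (a b : ℝ) : LipschitzWith 1 (clamp a b) :=
  (LipschitzWith.id.const_min b).const_max a

lemma bddLip_clamp {X : Type*} [PseudoMetricSpace X] {a b : ℝ} (h : a ≤ b) {f : X → ℝ}
    (hf : LipschitzWith 1 f) : BddLip fun x => clamp a b (f x) := by
  refine ⟨⟨1 * 1, (lipschitzWith_clamp a b).comp hf⟩, max |a| |b|, fun x => ?_⟩
  have := clamp_mem h (f x)
  exact abs_le_max_abs_abs this.1 this.2

/-- A C¹ function is bounded and Lipschitz on the compact interval [0, T], and clamping carries this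
over to all arguments. -/
lemma bddLip_comp_clamp {X : Type*} [PseudoMetricSpace X] {T : ℝ} (hT : 0 ≤ T) {a a' : ℝ → ℝ}
    (ha : ∀ t, 0 ≤ t → HasDerivWithinAt a (a' t) (Ici 0) t) (ha' : ContinuousOn a' (Ici 0))
    {f : X → ℝ} (hf : LipschitzWith 1 f) : BddLip fun x => a (clamp 0 T (f x)) := by
  have hsub : Icc 0 T ⊆ Ici 0 := Icc_subset_Ici_self
  obtain ⟨B, hB⟩ := isCompact_Icc.exists_bound_of_continuousOn (ha'.mono hsub)
  obtain ⟨B', hB'⟩ := isCompact_Icc.exists_bound_of_continuousOn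
    (fun t ht => (ha t (hsub ht)).continuousWithinAt.mono hsub : ContinuousOn a (Icc 0 T))
  have hL : LipschitzOnWith B.toNNReal a (Icc 0 T) :=
    (convex_Icc 0 T).lipschitzOnWith_of_nnnorm_hasDerivWithin_le
      (fun t ht => (ha t (hsub ht)).mono hsub) fun t ht => by
        rw [← NNReal.coe_le_coe, coe_nnnorm]
        exact (hB t ht).trans (Real.le_coe_toNNReal B)
  have hc : LipschitzWith (1 * 1) fun x => clamp 0 T (f x) := (lipschitzWith_clamp 0 T).comp hf
  refine ⟨⟨B.toNNReal * (1 * 1), ?_⟩, B', fun x => hB' _ (clamp_mem hT _)⟩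
  rw [← lipschitzOnWith_univ]
  exact hL.comp hc.lipschitzOnWith fun x _ => clamp_mem hT _

/-! ### Continuity of the coefficients of the geodesic equations -/

namespace IsGlobalSolution

open State

variable {C : StructConst} {m Λ : ℝ} {v : ℝ → State}

lemma ricci_continuousOn (hv : IsGlobalSolution C m Λ v) (i j : Fin 3) :
    ContinuousOn (fun t => ricci C (v t).g i j) (Ici 0) := fun t ht =>
  (hasDerivWithinAt_ricci C (g := fun t => (v t).g)
    (fun l i j => hasDerivWithinAt_connCoeff C (g := fun t => (v t).g)
      (g' := Matrix.of fun i j => -2 * (v t).k i j)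
      (fun i j => hv.g_eq t ht i j) (fun i j => hv.inv_eq ht i j) l i j) i j).continuousWithinAt

/-- k enters the geodesic equations as a coefficient; continuity of its derivative makes it
Lipschitz on compact time intervals. -/
lemma kDot_continuousOn (hv : IsGlobalSolution C m Λ v) (i j : Fin 3) :
    ContinuousOn (fun t => (v t).kDot C m Λ i j) (Ici 0) := by
  have hg := fun i j t ht => (hv.g_eq t ht i j).continuousWithinAt
  have hi := fun i j t (ht : t ∈ Ici 0) => (hv.inv_eq (t := t) ht i j).continuousWithinAt
  have hk := fun i j t ht => (hv.k_eq t ht i j).continuousWithinAt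
  have hE := fun i t ht => (hv.E_eq t ht i).continuousWithinAt
  have hF := fun i j t ht => (hv.F_eq t ht i j).continuousWithinAt
  have hu := fun i t ht => (hv.u_eq t ht i).continuousWithinAt
  have hΦ := fun t ht => (hv.Φ_eq t ht).continuousWithinAt
  have hU := fun t ht => (hv.U_eq t ht).continuousWithinAt
  have hρ := fun t ht => (hv.ρ_eq t ht).continuousWithinAt
  have hH := hv.H_continuousOn
  have hR := hv.ricci_continuousOn i j
  change ∀ i j, ContinuousOn _ (Ici 0) at hg hi hk hF
  change ∀ i, ContinuousOn _ (Ici 0) at hE hu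
  change ContinuousOn _ (Ici 0) at hΦ hU hρ
  have sum {f : Fin 3 → ℝ → ℝ} (hf : ∀ i, ContinuousOn (f i) (Ici 0)) :
      ContinuousOn (fun t => ∑ i, f i t) (Ici 0) := continuousOn_finsetSum _ fun i _ => hf i
  have c (a : ℝ) : ContinuousOn (fun _ : ℝ => a) (Ici 0) := continuousOn_const
  have hEL : ∀ i, ContinuousOn (fun t => (v t).ELow i) (Ici 0) := fun i =>
    sum fun j => (hg i j).mul (hE j)
  have huL : ∀ i, ContinuousOn (fun t => (v t).uLow i) (Ici 0) := fun i =>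
    sum fun j => (hg i j).mul (hu j)
  have hNE : ContinuousOn (fun t => (v t).normSqE) (Ici 0) := sum fun i => (hE i).mul (hEL i)
  have hNU : ContinuousOn (fun t => (v t).normSqU) (Ici 0) :=
    sum fun i => sum fun j => ((hg i j).mul (hu i)).mul (hu j)
  have hFU : ∀ i j, ContinuousOn (fun t => (v t).FUp i j) (Ici 0) := fun i j =>
    sum fun a => sum fun b => ((hi i a).mul (hi j b)).mul (hF a b)
  have hNF : ContinuousOn (fun t => (v t).normSqF) (Ici 0) :=
    sum fun i => sum fun j => (hFU i j).mul (hF i j)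
  have hτ : ∀ i j, ContinuousOn (fun t => (v t).τ i j) (Ici 0) := fun i j =>
    (((((c _).mul (hg i j)).mul hNE).sub ((hEL i).mul (hEL j))).sub
      (((c _).mul (hg i j)).mul hNF)).add
      (sum fun a => sum fun b => ((hi a b).mul (hF i a)).mul (hF j b))
  have hT : ∀ i j, ContinuousOn (fun t => (v t).T m i j) (Ici 0) := fun i j =>
    ((c _).mul (hg i j)).mul (((c _).mul hU).sub ((c _).mul (hΦ.pow 2)))
  have hT0 : ContinuousOn (fun t => (v t).T00 m) (Ici 0) := hU.add ((c _).mul (hΦ.pow 2))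
  have hu0 : ContinuousOn (fun t => (v t).u0) (Ici 0) := ((c _).add hNU).sqrt
  have hS : ∀ i j, ContinuousOn (fun t => (v t).ρ * (v t).uLow i * (v t).uLow j) (Ici 0) :=
    fun i j => (hρ.mul (huL i)).mul (huL j)
  exact ((((hR.add (hH.mul (hk i j))).sub ((c _).mul
    (sum fun l => sum fun n => ((hi l n).mul (hk j n)).mul (hk i l)))).sub
    ((c _).mul (((hT i j).add (hτ i j)).add (hS i j)))).add
    (((c _).mul ((hT0.neg.sub (hρ.mul (hu0.pow 2))).add
      (sum fun a => sum fun b => (hi a b).mul ((hT a b).add (hS a b))))).mul (hg i j))).sub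
    ((c _).mul (hg i j))

variable {X : Type*} [PseudoMetricSpace X] {f : X → ℝ}

lemma bddLip_inv (hv : IsGlobalSolution C m Λ v) {T : ℝ} (hT : 0 ≤ T) (hf : LipschitzWith 1 f)
    (i j : Fin 3) : BddLip fun x => (v (clamp 0 T (f x))).g⁻¹ i j := by
  refine bddLip_comp_clamp (a := fun t => (v t).g⁻¹ i j) hT (fun t ht => hv.inv_eq ht i j) ?_ hf
  have hi : ∀ i j, ContinuousOn (fun t => (v t).g⁻¹ i j) (Ici 0) :=
    fun i j t ht => (hv.inv_eq (t := t) ht i j).continuousWithinAt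
  have hK : ∀ i j, ContinuousOn (fun t => (v t).K i j) (Ici 0) :=
    fun i j t ht => (hv.K_eq (t := t) ht i j).continuousWithinAt
  simp only [Matrix.mul_apply]
  exact continuousOn_const.mul (continuousOn_finsetSum _ fun a _ => (hK i a).mul (hi a j))

lemma bddLip_k (hv : IsGlobalSolution C m Λ v) {T : ℝ} (hT : 0 ≤ T) (hf : LipschitzWith 1 f)
    (i j : Fin 3) : BddLip fun x => (v (clamp 0 T (f x))).k i j :=
  bddLip_comp_clamp (a := fun t => (v t).k i j) hT (fun t ht => hv.k_eq t ht i j)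
    (hv.kDot_continuousOn i j) hf

lemma bddLip_g (hv : IsGlobalSolution C m Λ v) {T : ℝ} (hT : 0 ≤ T) (hf : LipschitzWith 1 f)
    (i j : Fin 3) : BddLip fun x => (v (clamp 0 T (f x))).g i j :=
  bddLip_comp_clamp (a := fun t => (v t).g i j) hT (fun t ht => hv.g_eq t ht i j)
    (continuousOn_const.mul fun t ht => (hv.k_eq t ht i j).continuousWithinAt) hf

lemma bddLip_stateConn (hv : IsGlobalSolution C m Λ v) {T : ℝ} (hT : 0 ≤ T)
    (hf : LipschitzWith 1 f) (l α β : Option (Fin 3)) :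
    BddLip fun x => stateConn C (v (clamp 0 T (f x))) l α β := by
  have hi := hv.bddLip_inv hT hf
  have hk := hv.bddLip_k hT hf
  have hg := hv.bddLip_g hT hf
  have hK : ∀ i j, BddLip fun x => -∑ p, (v (clamp 0 T (f x))).g⁻¹ j p
      * (v (clamp 0 T (f x))).k i p := fun i j =>
    (BddLip.sum _ fun p => (hi j p).mul (hk i p)).neg
  rcases l with _ | l <;> rcases α with _ | α <;> rcases β with _ | β <;> simp only [stateConn]
  · exact .const 0
  · exact .const 0
  · exact .const 0
  · exact (hk _ _).neg
  · exact .const 0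
  · exact hK _ _
  · exact hK _ _
  · unfold connCoeff
    exact (BddLip.const _).mul (.sum _ fun k => (hi _ _).mul (.sum _ fun m =>
      ((((BddLip.const _).mul (hg _ _)).neg.add ((BddLip.const _).mul (hg _ _))).add
        ((BddLip.const _).mul (hg _ _)))))

end IsGlobalSolution

/-! ### The geodesic equations with truncated coefficients -/

/-- The geodesic vector field, with the time restricted to `[0, T]` and the velocity to the box with
corners `lo` and `hi`. -/
def clampedField (C : StructConst) (v : ℝ → State) (T : ℝ) (lo hi : Option (Fin 3) → ℝ)
    (z : ℝ × (Option (Fin 3) → ℝ)) : ℝ × (Option (Fin 3) → ℝ) :=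
  (clamp (lo none) (hi none) (z.2 none),
    accel C (v (clamp 0 T z.1)) fun l => clamp (lo l) (hi l) (z.2 l))

lemma clampedField_eq (C : StructConst) (v : ℝ → State) {T : ℝ} {lo hi : Option (Fin 3) → ℝ}
    {z : ℝ × (Option (Fin 3) → ℝ)} (h1 : z.1 ∈ Icc 0 T) (h2 : z.2 ∈ Icc lo hi) :
    clampedField C v T lo hi z = (z.2 none, accel C (v z.1) z.2) := by
  have : (fun l => clamp (lo l) (hi l) (z.2 l)) = z.2 :=
    funext fun l => clamp_eq ⟨h2.1 l, h2.2 l⟩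
  rw [clampedField, clamp_eq h1, this, clamp_eq ⟨h2.1 none, h2.2 none⟩]

/-- The components are polynomials in bounded Lipschitz functions, a class closed under sums and
products. -/
lemma clampedField_lipschitz {C : StructConst} {m Λ : ℝ} {v : ℝ → State}
    (hv : IsGlobalSolution C m Λ v) {T : ℝ} (hT : 0 ≤ T) {lo hi : Option (Fin 3) → ℝ}
    (hb : lo ≤ hi) : (∃ K, LipschitzWith K (clampedField C v T lo hi)) ∧
      ∃ B : ℝ≥0, ∀ z, ‖clampedField C v T lo hi z‖ ≤ B := by
  have h2 : ∀ l, LipschitzWith 1 fun z : ℝ × (Option (Fin 3) → ℝ) => z.2 l := fun l => by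
    have := (LipschitzWith.eval l).comp
      (LipschitzWith.prod_snd (α := ℝ) (β := Option (Fin 3) → ℝ))
    rw [mul_one] at this
    exact this
  have hw : ∀ l, BddLip fun z : ℝ × (Option (Fin 3) → ℝ) => clamp (lo l) (hi l) (z.2 l) :=
    fun l => bddLip_clamp (hb l) (h2 l)
  have ha : ∀ l, BddLip fun z => (clampedField C v T lo hi z).2 l := fun l =>
    (BddLip.sum _ fun α => .sum _ fun β => ((hv.bddLip_stateConn hT
      LipschitzWith.prod_fst l α β).mul (hw α)).mul (hw β)).neg
  obtain ⟨⟨K0, hK0⟩, B0, hB0⟩ := hw none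
  choose K hK using fun l => (ha l).1
  choose B hB using fun l => (ha l).2
  refine ⟨⟨max K0 (∑ l, K l), hK0.prodMk ?_⟩, (|B0| + ∑ l, |B l|).toNNReal, fun z => ?_⟩
  · refine LipschitzWith.of_dist_le_mul fun x y => (dist_pi_le_iff (by positivity)).mpr fun l => ?_
    refine ((hK l).dist_le_mul x y).trans (mul_le_mul_of_nonneg_right ?_ dist_nonneg)
    exact_mod_cast Finset.single_le_sum (f := K) (fun _ _ => zero_le) (Finset.mem_univ l)
  · have h0 : 0 ≤ ∑ l, |B l| := Finset.sum_nonneg fun _ _ => abs_nonneg _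
    rw [Real.coe_toNNReal _ (by positivity), Prod.norm_def]
    refine max_le ?_ ?_
    · exact (hB0 z).trans ((le_abs_self _).trans (by linarith))
    · refine ((pi_norm_le_iff_of_nonneg h0).mpr fun l => ?_).trans
        (le_add_of_nonneg_left (abs_nonneg B0))
      refine (hB l z).trans ((le_abs_self _).trans ?_)
      exact Finset.single_le_sum (f := fun l => |B l|) (fun _ _ => abs_nonneg _)
        (Finset.mem_univ l)

/-- Global existence for autonomous equations with a bounded Lipschitz right-hand side. -/
lemma exists_solution_of_lipschitz {E : Type*} [NormedAddCommGroup E] [NormedSpace ℝ E]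
    [CompleteSpace E] {f : E → E} {K B : ℝ≥0} (hK : LipschitzWith K f) (hB : ∀ z, ‖f z‖ ≤ B)
    {N : ℝ} (hN : 0 ≤ N) (z₀ : E) :
    ∃ z : ℝ → E, z 0 = z₀ ∧ ∀ s ∈ Icc 0 N, HasDerivWithinAt z (f (z s)) (Icc 0 N) s := by
  have hp : IsPicardLindelof (fun _ => f) (⟨0, ⟨le_rfl, hN⟩⟩ : Icc (0 : ℝ) N) z₀
      -- In time `N` a curve of speed at most `B` stays in the ball of radius B·N, so
      -- Picard-Lindelöf applies on all of [0, N].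
      (B * N.toNNReal) 0 B K :=
    { lipschitzOnWith := fun _ _ => hK.lipschitzOnWith
      continuousOn := fun _ _ => continuousOn_const
      norm_le := fun _ _ z _ => hB z
      mul_max_le := by simp [hN] }
  exact hp.exists_eq_forall_mem_Icc_hasDerivWithinAt₀

end Bianchi
end

/-! ### Global existence and uniqueness of causal geodesic velocities -/

noncomputable section
namespace Bianchi

open scoped NNReal

namespace Decay

variable {C : StructConst} {m Λ : ℝ} {v : ℝ → State} {A c κ : ℝ}

/-- A priori bounds for the velocities of future-directed causal geodesics. -/
lemma exists_box (hd : Decay v A c κ) (hC : IsLie C) (hv : IsGlobalSolution C m Λ v)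
    {N t₀ : ℝ} (hN : 0 ≤ N) (ht₀ : 0 ≤ t₀) {w₀ : Option (Fin 3) → ℝ} (hpos : 0 < w₀ none)
    (hca : speedSq (v t₀) w₀ ≤ w₀ none ^ 2) :
    ∃ (T : ℝ) (lo hi : Option (Fin 3) → ℝ), 0 < lo none ∧ t₀ + hi none * N ≤ T ∧ ∀ s t w, s ≤ N →
      IsGeodesicVelocityOn C v (Icc 0 s) t w → t 0 = t₀ → w 0 = w₀ →
      ∀ r ∈ Icc 0 s, ∀ l, w r l ∈ Ioo (lo l) (hi l) := by
  set W := w₀ none * Real.exp (A / c) with hW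
  have hW0 : 0 < W := by positivity
  obtain ⟨G, hG⟩ : ∃ G, ∀ i, ∀ t ∈ Icc 0 (t₀ + (W + 1) * N), (v t).g⁻¹ i i ≤ G := by
    have h1 : ∀ i, ∃ B, ∀ t ∈ Icc 0 (t₀ + (W + 1) * N), ‖(v t).g⁻¹ i i‖ ≤ B := fun i =>
      isCompact_Icc.exists_bound_of_continuousOn fun t ht =>
        (hv.inv_eq ht.1 i i).continuousWithinAt.mono Icc_subset_Ici_self
    choose B hB using h1
    refine ⟨∑ i, |B i|, fun i t ht => (le_abs_self _).trans ((hB i t ht).trans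
      ((le_abs_self _).trans ?_))⟩
    exact Finset.single_le_sum (f := fun i => |B i|) (fun _ _ => abs_nonneg _) (Finset.mem_univ i)
  set M := |G| * (speedSq (v t₀) w₀ * Real.exp (2 * A / c)) + 1 with hM
  -- Halving the lower bound here, and adding 1 in `W + 1` and `M`, makes the box inequalities
  -- strict; the bootstrap below needs an open box.
  set δ := w₀ none * Real.exp (-(κ * W) * N) / 2 with hδ
  have hδ0 : 0 < δ := by positivity
  refine ⟨t₀ + (W + 1) * N, fun l => l.elim δ fun _ => -M, fun l => l.elim (W + 1) fun _ => M,
    hδ0, le_rfl, ?_⟩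
  rintro s t w hs h rfl rfl r hr
  have h0 : (0 : ℝ) ∈ Icc 0 s := ⟨le_rfl, hr.1.trans hr.2⟩
  have hrN : r ≤ N := hr.2.trans hs
  have e1 := h.velocity_le hC hv hd (convex_Icc 0 s) h0 hr hr.1 hca
  have e2 := h.velocity_ge hC hv hd (convex_Icc 0 s) h0 hr hr.1 hca
  have e3 := h.time_le hC hv hd (convex_Icc 0 s) h0 hr hr.1 hca
  have e4 := h.speedSq_le hC hv hd (convex_Icc 0 s) h0 hr hr.1
  have e5 := h.speedSq_nonneg hv hr
  rw [← hW, sub_zero] at e2 e3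
  have hκ := hd.κ_nonneg
  rintro (_ | i)
  · refine ⟨?_, by change w r none < W + 1; linarith⟩
    change δ < w r none
    refine lt_of_lt_of_le ?_ e2
    have h1 : Real.exp (-(κ * W) * N) ≤ Real.exp (-(κ * W) * r) := by
      refine Real.exp_le_exp.mpr ?_
      nlinarith [mul_nonneg hκ hW0.le]
    have h2 := mul_le_mul_of_nonneg_left h1 hpos.le
    linarith
  · change w r (some i) ∈ Ioo (-M) M
    refine abs_lt.mp ?_
    have hT : t r ∈ Icc 0 (t 0 + (W + 1) * N) := ⟨h.time_nonneg r hr, e3.trans (by nlinarith)⟩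
    have h1 := (hv.regular hT.1).sq_le (spatial (w r)) i
    have h2 : w r (some i) ^ 2 ≤ |G| * (speedSq (v (t 0)) (w 0) * Real.exp (2 * A / c)) := by
      refine h1.trans ((mul_le_mul_of_nonneg_right ((hG i _ hT).trans (le_abs_self G)) e5).trans ?_)
      exact mul_le_mul_of_nonneg_left e4 (abs_nonneg G)
    refine abs_lt_of_sq_lt_sq ?_ ?_
    · nlinarith [sq_nonneg (w r (some i))]
    · nlinarith [sq_nonneg (w r (some i))]

/-- Existence of geodesic velocities on every compact interval. -/
lemma exists_geodesicVelocity (hd : Decay v A c κ) (hC : IsLie C) (hv : IsGlobalSolution C m Λ v)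
    {N t₀ : ℝ} (hN : 0 ≤ N) (ht₀ : 0 ≤ t₀) {w₀ : Option (Fin 3) → ℝ} (hpos : 0 < w₀ none)
    (hca : speedSq (v t₀) w₀ ≤ w₀ none ^ 2) :
    ∃ t w, t 0 = t₀ ∧ w 0 = w₀ ∧ IsGeodesicVelocityOn C v (Icc 0 N) t w := by
  obtain ⟨T, lo, hi, hlo, hT, hbox⟩ := hd.exists_box hC hv hN ht₀ hpos hca
  -- The a priori bound is applied to a constant curve on the degenerate interval [0, 0], where the
  -- differential equations are vacuous.
  have hw₀ : ∀ l, w₀ l ∈ Ioo (lo l) (hi l) := by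
    refine hbox 0 (fun _ => t₀) (fun _ => w₀) hN ?_ rfl rfl 0 ⟨le_rfl, le_rfl⟩
    rw [Icc_self]
    exact ⟨fun _ _ => ht₀, fun _ _ => HasFDerivWithinAt.of_subsingleton subsingleton_singleton,
      fun _ _ _ => HasFDerivWithinAt.of_subsingleton subsingleton_singleton, fun _ _ => hpos⟩
  have hlh : lo ≤ hi := fun l => ((hw₀ l).1.trans (hw₀ l).2).le
  have hhi : 0 < hi none := hlo.trans_le (hlh none)
  have hT0 : 0 ≤ T := le_trans (by positivity) hT
  obtain ⟨⟨K, hK⟩, B, hB⟩ := clampedField_lipschitz hv hT0 hlh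
  obtain ⟨z, hz0, hz⟩ := exists_solution_of_lipschitz hK hB hN (t₀, w₀)
  have hz1 : ∀ s ∈ Icc 0 N, HasDerivWithinAt (fun s => (z s).1)
      (clamp (lo none) (hi none) ((z s).2 none)) (Icc 0 N) s := fun s hs => (hz s hs).fst
  have hz2 : ∀ s ∈ Icc 0 N, ∀ l, HasDerivWithinAt (fun s => (z s).2 l)
      ((clampedField C v T lo hi (z s)).2 l) (Icc 0 N) s := fun s hs =>
    hasDerivWithinAt_pi.mp (hz s hs).snd
  -- The truncated dt/ds lies between `lo none > 0` and `hi none`, so the truncation of the time is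
  -- never active, whatever the velocity does.
  have htime : ∀ s ∈ Icc 0 N, (z s).1 ∈ Icc 0 T := by
    intro s hs
    have h0 : (0 : ℝ) ∈ Icc 0 N := ⟨le_rfl, hN⟩
    have h1 := monotoneOn_of_hasDerivWithinAt (convex_Icc 0 N) hz1
      (fun s hs => hlo.le.trans (clamp_mem (hlh none) _).1) h0 hs hs.1
    have h2 := antitoneOn_of_hasDerivWithinAt (convex_Icc 0 N)
      (f := fun s => (z s).1 - hi none * s)
      (fun s hs => (hz1 s hs).fun_sub ((hasDerivWithinAt_id s _).const_mul (hi none)))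
      (fun s hs => by have := (clamp_mem (hlh none) ((z s).2 none)).2; linarith) h0 hs hs.1
    simp only [hz0] at h1 h2
    refine ⟨ht₀.trans h1, ?_⟩
    have := mul_le_mul_of_nonneg_left hs.2 hhi.le
    linarith
  have hgeo : ∀ s, s ≤ N → (∀ r ∈ Icc 0 s, (z r).2 ∈ Icc lo hi) →
      IsGeodesicVelocityOn C v (Icc 0 s) (fun s => (z s).1) (fun s => (z s).2) := by
    intro s hs hin
    have hsub : Icc 0 s ⊆ Icc 0 N := Icc_subset_Icc_right hs
    have heq : ∀ r ∈ Icc 0 s, clampedField C v T lo hi (z r)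
        = ((z r).2 none, accel C (v (z r).1) (z r).2) := fun r hr =>
      clampedField_eq C v (htime r (hsub hr)) (hin r hr)
    refine ⟨fun r hr => (htime r (hsub hr)).1, fun r hr => ?_, fun r hr l => ?_,
      fun r hr => hlo.trans_le ((hin r hr).1 none)⟩
    · have h1 : clamp (lo none) (hi none) ((z r).2 none) = (z r).2 none :=
        congrArg Prod.fst (heq r hr)
      exact h1 ▸ (hz1 r (hsub hr)).mono hsub
    · have := (hz2 r (hsub hr) l).mono hsub
      rwa [heq r hr] at this
  have hzc : ∀ l, ContinuousOn (fun s => (z s).2 l) (Icc 0 N) := fun l s hs =>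
    (hz2 s hs l).continuousWithinAt
  -- Bootstrap: up to the first exit from the open box the velocity lies in the closed box, where
  -- the truncated and true equations agree. The a priori bound then puts the exit point inside the
  -- open box, a contradiction.
  have hin : ∀ s ∈ Icc 0 N, ∀ l, (z s).2 l ∈ Ioo (lo l) (hi l) := by
    by_contra hcon
    have hU : IsOpen (univ.pi fun l => Ioo (lo l) (hi l)) :=
      isOpen_set_pi finite_univ fun _ _ => isOpen_Ioo
    have hcl : IsClosed (Icc 0 N ∩ (fun s => (z s).2) ⁻¹' (univ.pi fun l => Ioo (lo l) (hi l))ᶜ) :=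
      (continuousOn_pi.mpr hzc).preimage_isClosed_of_isClosed isClosed_Icc hU.isClosed_compl
    have hne : (Icc 0 N ∩ (fun s => (z s).2) ⁻¹'
        (univ.pi fun l => Ioo (lo l) (hi l))ᶜ).Nonempty := by
      by_contra hne
      rw [not_nonempty_iff_eq_empty] at hne
      refine hcon fun s hs l => ?_
      by_contra hl
      exact (hne ▸ ⟨hs, fun h => hl (h l (mem_univ l))⟩ : s ∈ (∅ : Set ℝ))
    obtain ⟨s, ⟨hs, hsn⟩, hleast⟩ :=
      (isCompact_Icc.of_isClosed_subset hcl inter_subset_left).exists_isLeast hne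
    have hlt : ∀ r ∈ Ico 0 s, ∀ l, (z r).2 l ∈ Ioo (lo l) (hi l) := by
      intro r hr l
      by_contra hl
      exact absurd (hleast ⟨⟨hr.1, hr.2.le.trans hs.2⟩, fun h => hl (h l (mem_univ l))⟩)
        (not_le.mpr hr.2)
    have hs0 : 0 ≠ s := by
      rintro rfl
      refine hsn fun l _ => ?_
      simpa only [hz0] using hw₀ l
    have hin : ∀ r ∈ Icc 0 s, ∀ l, (z r).2 l ∈ Icc (lo l) (hi l) := by
      intro r hr l
      have hm : MapsTo (fun s => (z s).2 l) (Ico 0 s) (Ioo (lo l) (hi l)) := fun r hr => hlt r hr l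
      have := hm.closure_of_continuousOn (by
        rw [closure_Ico hs0]
        exact (hzc l).mono (Icc_subset_Icc_right hs.2))
      rw [closure_Ico hs0, closure_Ioo ((hw₀ l).1.trans (hw₀ l).2).ne] at this
      exact this hr
    refine hsn fun l _ => ?_
    exact hbox s _ _ hs.2 (hgeo s hs.2 fun r hr => ⟨fun l => (hin r hr l).1,
      fun l => (hin r hr l).2⟩) (by simp [hz0]) (by simp [hz0]) s ⟨hs.1, le_rfl⟩ l
  exact ⟨_, _, by simp [hz0], by simp [hz0], hgeo N le_rfl fun r hr => ⟨fun l => (hin r hr l).1.le,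
    fun l => (hin r hr l).2.le⟩⟩

/-- Uniqueness of geodesic velocities. -/
lemma geodesicVelocity_unique (hd : Decay v A c κ) (hC : IsLie C) (hv : IsGlobalSolution C m Λ v)
    {N : ℝ} (hN : 0 ≤ N) {t t' : ℝ → ℝ} {w w' : ℝ → Option (Fin 3) → ℝ}
    (h : IsGeodesicVelocityOn C v (Icc 0 N) t w) (h' : IsGeodesicVelocityOn C v (Icc 0 N) t' w')
    (hca : speedSq (v (t 0)) (w 0) ≤ w 0 none ^ 2) (ht : t' 0 = t 0) (hw : w' 0 = w 0) :
    ∀ s ∈ Icc 0 N, t s = t' s ∧ w s = w' s := by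
  have h0 : (0 : ℝ) ∈ Icc 0 N := ⟨le_rfl, hN⟩
  obtain ⟨T, lo, hi, hlo, hT, hbox⟩ :=
    hd.exists_box hC hv hN (h.time_nonneg 0 h0) (h.future 0 h0) hca
  -- Solutions with these initial values stay in the box, hence solve the truncated equation, whose
  -- field is globally Lipschitz.
  have key : ∀ t₁ w₁, IsGeodesicVelocityOn C v (Icc 0 N) t₁ w₁ → t₁ 0 = t 0 → w₁ 0 = w 0 →
      ∀ s ∈ Icc 0 N, HasDerivWithinAt (fun s => (t₁ s, w₁ s))
        (clampedField C v T lo hi (t₁ s, w₁ s)) (Icc 0 N) s := by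
    intro t₁ w₁ h₁ e1 e2 s hs
    have hb := hbox N t₁ w₁ le_rfl h₁ e1 e2
    have h2 := antitoneOn_of_hasDerivWithinAt (convex_Icc 0 N) (f := fun s => t₁ s - hi none * s)
      (fun s hs => (h₁.time_deriv s hs).fun_sub ((hasDerivWithinAt_id s _).const_mul (hi none)))
      (fun s hs => by linarith [(hb s hs none).2]) h0 hs hs.1
    have h3 : 0 < hi none := (h₁.future s hs).trans (hb s hs none).2
    have h4 := mul_le_mul_of_nonneg_left hs.2 h3.le
    rw [clampedField_eq (z := (t₁ s, w₁ s)) C v ⟨h₁.time_nonneg s hs, by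
      simp only [e1] at h2 ⊢
      linarith⟩ ⟨fun l => (hb s hs l).1.le, fun l => (hb s hs l).2.le⟩]
    exact (h₁.time_deriv s hs).prodMk (hasDerivWithinAt_pi.mpr (h₁.geodesic s hs))
  have hb := hbox N t w le_rfl h rfl rfl 0 h0
  have hlh : lo ≤ hi := fun l => ((hb l).1.trans (hb l).2).le
  have hhi : 0 < hi none := hlo.trans_le (hlh none)
  have hT0 : 0 ≤ T := by
    have := h.time_nonneg 0 h0
    exact le_trans (by positivity) hT
  obtain ⟨⟨K, hK⟩, -⟩ := clampedField_lipschitz hv (C := C) hT0 hlh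
  have mono : ∀ {f : ℝ → ℝ × (Option (Fin 3) → ℝ)} {f'}, ∀ s ∈ Ico 0 N,
      HasDerivWithinAt f f' (Icc 0 N) s → HasDerivWithinAt f f' (Ici s) s := fun s hs hf =>
    hf.mono_of_mem_nhdsWithin (Filter.mem_of_superset (Icc_mem_nhdsGE hs.2)
      (Icc_subset_Icc_left hs.1))
  have := ODE_solution_unique_of_mem_Icc_right (v := fun _ => clampedField C v T lo hi)
    (s := fun _ => univ) (K := K) (f := fun s => (t s, w s)) (g := fun s => (t' s, w' s))
    (a := 0) (b := N) (fun _ _ => hK.lipschitzOnWith)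
    (fun s hs => (key t w h rfl rfl s hs).continuousWithinAt)
    (fun s hs => mono s hs (key t w h rfl rfl s ⟨hs.1, hs.2.le⟩)) (fun _ _ => mem_univ _)
    (fun s hs => (key t' w' h' ht hw s hs).continuousWithinAt)
    (fun s hs => mono s hs (key t' w' h' ht hw s ⟨hs.1, hs.2.le⟩)) (fun _ _ => mem_univ _)
    (by simp [ht, hw])
  intro s hs
  have e := this hs
  exact ⟨congrArg Prod.fst e, congrArg Prod.snd e⟩

/-- Global existence of geodesic velocities. -/
lemma exists_global_geodesicVelocity (hd : Decay v A c κ) (hC : IsLie C)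
    (hv : IsGlobalSolution C m Λ v) {t₀ : ℝ} (ht₀ : 0 ≤ t₀) {w₀ : Option (Fin 3) → ℝ}
    (hpos : 0 < w₀ none) (hca : speedSq (v t₀) w₀ ≤ w₀ none ^ 2) :
    ∃ t w, t 0 = t₀ ∧ w 0 = w₀ ∧ IsGeodesicVelocityOn C v (Ici 0) t w := by
  choose! t w ht hw h using fun (n : ℕ) =>
    hd.exists_geodesicVelocity hC hv (N := n) n.cast_nonneg ht₀ hpos hca
  -- The global curve uses at `s` the solution with index ⌊s⌋ + 1, whose interval contains a
  -- neighbourhood of `s` in [0, ∞); by uniqueness it agrees there with every other index.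
  have heq : ∀ (n : ℕ) (s : ℝ), s ∈ Icc (0 : ℝ) n →
      t (⌊s⌋₊ + 1) s = t n s ∧ w (⌊s⌋₊ + 1) s = w n s := by
    intro n s hs
    have hs1 : s ∈ Icc (0 : ℝ) ((⌊s⌋₊ + 1 : ℕ) : ℝ) :=
      ⟨hs.1, by push_cast; exact (Nat.lt_floor_add_one s).le⟩
    refine hd.geodesicVelocity_unique hC hv hs.1 ((h _).mono (Icc_subset_Icc_right hs1.2))
      ((h n).mono (Icc_subset_Icc_right hs.2)) ?_ ?_ ?_ s ⟨hs.1, le_rfl⟩ <;>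
      simp only [ht, hw, hca]
  have hev : ∀ s, 0 ≤ s → Icc 0 ((⌊s⌋₊ + 1 : ℕ) : ℝ) ∈ nhdsWithin s (Ici 0) := fun s hs => by
    rw [← Ici_inter_Iic]
    exact Filter.inter_mem self_mem_nhdsWithin (mem_nhdsWithin_of_mem_nhds
      (Iic_mem_nhds (by push_cast; exact Nat.lt_floor_add_one s)))
  have hmem : ∀ s, 0 ≤ s → s ∈ Icc 0 ((⌊s⌋₊ + 1 : ℕ) : ℝ) := fun s hs =>
    ⟨hs, by push_cast; exact (Nat.lt_floor_add_one s).le⟩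
  refine ⟨fun s => t (⌊s⌋₊ + 1) s, fun s => w (⌊s⌋₊ + 1) s, ht _, hw _,
    fun s hs => (h _).time_nonneg s (hmem s hs), fun s hs => ?_, fun s hs l => ?_,
    fun s hs => (h _).future s (hmem s hs)⟩
  · refine (((h _).time_deriv s (hmem s hs)).congr_of_mem (fun r hr => ?_)
      (hmem s hs)).mono_of_mem_nhdsWithin (hev s hs)
    exact (heq _ r hr).1
  · refine (((h _).geodesic s (hmem s hs) l).congr_of_mem (fun r hr => ?_)
      (hmem s hs)).mono_of_mem_nhdsWithin (hev s hs)
    exact congrFun (heq _ r hr).2 l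

end Decay

end Bianchi
end

noncomputable section
namespace Bianchi

open scoped NNReal Topology

/-! ### Time-dependent combinations of vector fields on a manifold -/

lemma clm_sum_smul {E F : Type*} [NormedAddCommGroup E] [NormedSpace ℝ E] [NormedAddCommGroup F]
    [NormedSpace ℝ F] (L : E →L[ℝ] F) (b : Fin 3 → ℝ) (V : Fin 3 → E) :
    L (∑ i, b i • V i) = ∑ i, b i • L (V i) := by
  simp only [map_sum, map_smul]

section Manifold

variable {E M : Type*} [NormedAddCommGroup E] [NormedSpace ℝ E] [TopologicalSpace M]
  [ChartedSpace E M]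

/-- `x` has velocity `∑ a^i(s) X_i(x(s))` on `S`. -/
def IsFlowOn (X : Fin 3 → (x : M) → TangentSpace 𝓘(ℝ, E) x) (a : ℝ → Fin 3 → ℝ) (S : Set ℝ)
    (x : ℝ → M) : Prop :=
  ∀ s ∈ S, HasMFDerivWithinAt 𝓘(ℝ, ℝ) 𝓘(ℝ, E) x S s
    ((1 : ℝ →L[ℝ] ℝ).smulRight (∑ i, a s i • X i (x s) : TangentSpace 𝓘(ℝ, E) (x s)))

lemma IsFlowOn.mono {X : Fin 3 → (x : M) → TangentSpace 𝓘(ℝ, E) x} {a : ℝ → Fin 3 → ℝ}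
    {S S' : Set ℝ} {x : ℝ → M} (h : IsFlowOn X a S x) (hS : S' ⊆ S) : IsFlowOn X a S' x :=
  fun s hs => (h s (hS hs)).mono hS

lemma IsFlowOn.congr {X : Fin 3 → (x : M) → TangentSpace 𝓘(ℝ, E) x} {a : ℝ → Fin 3 → ℝ}
    {S : Set ℝ} {x z : ℝ → M} (h : IsFlowOn X a S x) (he : ∀ s ∈ S, z s = x s) :
    IsFlowOn X a S z := by
  intro s hs
  let F : M → ℝ →L[ℝ] E := fun p => (1 : ℝ →L[ℝ] ℝ).smulRight
    (∑ i, a s i • X i p : TangentSpace 𝓘(ℝ, E) p)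
  have hF : F (x s) = F (z s) := by rw [he s hs]
  exact ((h s hs).congr_of_eventuallyEq (Filter.eventually_of_mem self_mem_nhdsWithin he)
    (he s hs)).congr_mfderiv hF

lemma IsFlowOn.union_Icc {X : Fin 3 → (x : M) → TangentSpace 𝓘(ℝ, E) x} {a : ℝ → Fin 3 → ℝ}
    {x : ℝ → M} {s₀ s₁ s₂ : ℝ} (h : IsFlowOn X a (Icc s₀ s₁) x) (h' : IsFlowOn X a (Icc s₁ s₂) x) :
    IsFlowOn X a (Icc s₀ s₂) x := by
  intro s hs
  rcases lt_trichotomy s s₁ with hlt | rfl | hlt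
  · refine (h s ⟨hs.1, hlt.le⟩).mono_of_mem_nhdsWithin (Filter.mem_of_superset
      (Filter.inter_mem self_mem_nhdsWithin (mem_nhdsWithin_of_mem_nhds (Iio_mem_nhds hlt)))
      fun r hr => ⟨hr.1.1, (mem_Iio.mp hr.2).le⟩)
  · rw [← Icc_union_Icc_eq_Icc hs.1 hs.2]
    exact (h s ⟨hs.1, le_rfl⟩).union (h' s ⟨le_rfl, hs.2⟩)
  · refine (h' s ⟨hlt.le, hs.2⟩).mono_of_mem_nhdsWithin (Filter.mem_of_superset
      (Filter.inter_mem self_mem_nhdsWithin (mem_nhdsWithin_of_mem_nhds (Ioi_mem_nhds hlt)))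
      fun r hr => ⟨(mem_Ioi.mp hr.2).le, hr.1.2⟩)

lemma IsFlowOn.congr_coeff {X : Fin 3 → (x : M) → TangentSpace 𝓘(ℝ, E) x} {a b : ℝ → Fin 3 → ℝ}
    {S : Set ℝ} {x : ℝ → M} (h : IsFlowOn X a S x) (hab : ∀ s ∈ S, b s = a s) :
    IsFlowOn X b S x := fun s hs => by
  rw [hab s hs]
  exact h s hs

/-- A vector field in the chart at `x₀`. -/
def chartField (x₀ : M) [IsManifold 𝓘(ℝ, E) 1 M] (X : (x : M) → TangentSpace 𝓘(ℝ, E) x)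
    (y : E) : E :=
  tangentCoordChange 𝓘(ℝ, E) ((extChartAt 𝓘(ℝ, E) x₀).symm y) x₀
    ((extChartAt 𝓘(ℝ, E) x₀).symm y) (X ((extChartAt 𝓘(ℝ, E) x₀).symm y))

variable [IsManifold 𝓘(ℝ, E) 1 M] {X : Fin 3 → (x : M) → TangentSpace 𝓘(ℝ, E) x}
  {a : ℝ → Fin 3 → ℝ} {S : Set ℝ} {x : ℝ → M}

lemma contDiffAt_chartField {x₀ : M} {X : (x : M) → TangentSpace 𝓘(ℝ, E) x}
    (hX : ContMDiffAt 𝓘(ℝ, E) 𝓘(ℝ, E).tangent 1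
      (fun x => (⟨x, X x⟩ : TangentBundle 𝓘(ℝ, E) M)) x₀) :
    ContDiffAt ℝ 1 (chartField x₀ X) (extChartAt 𝓘(ℝ, E) x₀ x₀) := by
  rw [contMDiffAt_iff] at hX
  exact (hX.2.contDiffAt (by simp)).snd

lemma chartField_extChartAt {x₀ x : M} {X : (x : M) → TangentSpace 𝓘(ℝ, E) x}
    (hx : x ∈ (extChartAt 𝓘(ℝ, E) x₀).source) :
    chartField x₀ X (extChartAt 𝓘(ℝ, E) x₀ x) = tangentCoordChange 𝓘(ℝ, E) x x₀ x (X x) := by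
  have h := PartialEquiv.left_inv _ hx
  rw [chartField]
  generalize (extChartAt 𝓘(ℝ, E) x₀).symm (extChartAt 𝓘(ℝ, E) x₀ x) = z at h ⊢
  subst h
  rfl

/-- In a chart the flow equation becomes an ordinary differential equation in a vector space, to
which the uniqueness theorem applies. -/
lemma IsFlowOn.hasDerivWithinAt (h : IsFlowOn X a S x) {x₀ : M} {s : ℝ} (hs : s ∈ S)
    (hsrc : x s ∈ (extChartAt 𝓘(ℝ, E) x₀).source) :
    HasDerivWithinAt (extChartAt 𝓘(ℝ, E) x₀ ∘ x)
      (∑ i, a s i • chartField x₀ (X i) (extChartAt 𝓘(ℝ, E) x₀ (x s))) S s := by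
  have hsrc' : x s ∈ (chartAt E x₀).source := by rwa [extChartAt_source] at hsrc
  have h1 := HasMFDerivWithinAt.comp s (hasMFDerivWithinAt_extChartAt (I := 𝓘(ℝ, E)) hsrc') (h s hs)
    (Set.subset_preimage_image _ _)
  have h2 := hasMFDerivWithinAt_iff_hasFDerivWithinAt.mp h1
  have hsum : ∑ i, a s i • chartField x₀ (X i) (extChartAt 𝓘(ℝ, E) x₀ (x s))
      = tangentCoordChange 𝓘(ℝ, E) (x s) x₀ (x s) (∑ i, a s i • X i (x s) : E) := by
    simp only [chartField_extChartAt hsrc]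
    exact (clm_sum_smul (tangentCoordChange 𝓘(ℝ, E) (x s) x₀ (x s)) (a s) fun i => X i (x s)).symm
  have h3 : HasFDerivWithinAt (𝕜 := ℝ) (E := ℝ) (F := E) (extChartAt 𝓘(ℝ, E) x₀ ∘ x)
    ((1 : ℝ →L[ℝ] ℝ).smulRight (∑ i, a s i • chartField x₀ (X i) (extChartAt 𝓘(ℝ, E) x₀ (x s)))) S s := by
    refine HasFDerivWithinAt.congr_fderiv h2 ?_
    rw [hsum, mfderiv_chartAt_eq_tangentCoordChange hsrc']
    refine ContinuousLinearMap.ext fun r => ?_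
    exact (tangentCoordChange 𝓘(ℝ, E) (x s) x₀ (x s)).map_smul (r : ℝ) (∑ i, a s i • X i (x s) : E)
  simpa using h3.hasDerivWithinAt

/-- The converse of `IsFlowOn.hasDerivWithinAt`: a solution in a chart gives a curve. -/
lemma hasMFDerivAt_extChartAt_symm_comp {x₀ : M} {f : ℝ → E} {b : Fin 3 → ℝ} {s : ℝ}
    (hf : HasDerivAt f (∑ i, b i • chartField x₀ (X i) (f s)) s)
    (hmem : f s ∈ (extChartAt 𝓘(ℝ, E) x₀).target) :
    HasMFDerivAt 𝓘(ℝ, ℝ) 𝓘(ℝ, E) ((extChartAt 𝓘(ℝ, E) x₀).symm ∘ f) s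
      ((1 : ℝ →L[ℝ] ℝ).smulRight (∑ i, b i • X i ((extChartAt 𝓘(ℝ, E) x₀).symm (f s)) :
        TangentSpace 𝓘(ℝ, E) ((extChartAt 𝓘(ℝ, E) x₀).symm (f s)))) := by
  set xₛ : M := (extChartAt 𝓘(ℝ, E) x₀).symm (f s) with hxₛ
  have hft1 : xₛ ∈ (extChartAt 𝓘(ℝ, E) x₀).source := PartialEquiv.map_target _ hmem
  have hft2 := mem_extChartAt_source (I := 𝓘(ℝ, E)) xₛ
  have hsum : ∑ i, b i • chartField x₀ (X i) (f s)
      = tangentCoordChange 𝓘(ℝ, E) xₛ x₀ xₛ (∑ i, b i • X i xₛ : E) :=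
    (clm_sum_smul (tangentCoordChange 𝓘(ℝ, E) xₛ x₀ xₛ) b fun i => X i xₛ).symm
  rw [hsum] at hf
  refine ⟨(continuousAt_extChartAt_symm'' hmem).comp hf.continuousAt, ?_⟩
  have hT : HasFDerivAt (extChartAt 𝓘(ℝ, E) xₛ ∘ (extChartAt 𝓘(ℝ, E) x₀).symm)
      (tangentCoordChange 𝓘(ℝ, E) x₀ xₛ xₛ) (f s) := by
    have := hasFDerivWithinAt_tangentCoordChange (I := 𝓘(ℝ, E)) (x := x₀) (y := xₛ) (z := xₛ)
      ⟨hft1, hft2⟩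
    rw [hxₛ, (extChartAt 𝓘(ℝ, E) x₀).right_inv hmem, ← hxₛ] at this
    simpa using this
  have h2 := hT.comp_hasDerivAt s hf
  rw [tangentCoordChange_comp (x := x₀) ⟨⟨hft2, hft1⟩, hft2⟩, tangentCoordChange_self hft2] at h2
  have h3 := h2.hasFDerivAt.hasFDerivWithinAt (s := range 𝓘(ℝ, ℝ))
  simp only [ContinuousLinearMap.smulRight_one_eq_toSpanSingleton]
  exact h3

end Manifold

end Bianchi
end

/-! ### Local existence and uniqueness of flows on a manifold -/

noncomputable section
namespace Bianchi

open scoped NNReal Topology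

lemma lipschitzOnWith_sum_smul {E F : Type*} [PseudoMetricSpace F] [NormedAddCommGroup E]
    [NormedSpace ℝ E] {K A : ℝ≥0} {V : Fin 3 → F → E} {s : Set F}
    (hV : ∀ i, LipschitzOnWith K (V i) s) {b : Fin 3 → ℝ} (hb : ‖b‖ ≤ A) :
    LipschitzOnWith (3 * (A * K)) (fun y => ∑ i, b i • V i y) s := by
  refine LipschitzOnWith.of_dist_le_mul fun y hy z hz => ?_
  rw [dist_eq_norm, ← Finset.sum_sub_distrib]
  refine (norm_sum_le_of_le (f := fun i => b i • V i y - b i • V i z) Finset.univ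
    (n := fun _ => A * K * dist y z) fun i _ => ?_).trans_eq ?_
  · rw [← smul_sub, norm_smul, ← dist_eq_norm, mul_assoc]
    exact mul_le_mul ((norm_le_pi_norm b i).trans hb) ((hV i).dist_le_mul y hy z hz) dist_nonneg
      A.coe_nonneg
  · rw [Fin.sum_const, nsmul_eq_mul]
    push_cast
    ring

section Manifold

variable {E M : Type*} [NormedAddCommGroup E] [NormedSpace ℝ E] [TopologicalSpace M]
  [ChartedSpace E M] [IsManifold 𝓘(ℝ, E) 1 M] {X : Fin 3 → (x : M) → TangentSpace 𝓘(ℝ, E) x}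
  {a : ℝ → Fin 3 → ℝ}

/-- C¹ fields are locally Lipschitz; one ball and one pair of constants serve all three fields,
independently of the time-dependent coefficients. -/
lemma exists_chartField_bounds (hX : ∀ i, ContMDiff 𝓘(ℝ, E) 𝓘(ℝ, E).tangent 1
      (fun x => (⟨x, X i x⟩ : TangentBundle 𝓘(ℝ, E) M))) (x₀ : M) :
    ∃ r > 0, ∃ K B : ℝ≥0, ∀ i,
      LipschitzOnWith K (chartField x₀ (X i)) (Metric.closedBall (extChartAt 𝓘(ℝ, E) x₀ x₀) r) ∧
      ∀ y ∈ Metric.closedBall (extChartAt 𝓘(ℝ, E) x₀ x₀) r, ‖chartField x₀ (X i) y‖ ≤ B := by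
  have h1 : ∀ i, ∃ K, ∃ s ∈ 𝓝 (extChartAt 𝓘(ℝ, E) x₀ x₀),
      LipschitzOnWith K (chartField x₀ (X i)) s := fun i =>
    (contDiffAt_chartField (hX i).contMDiffAt).exists_lipschitzOnWith
  choose K s hs hK using h1
  obtain ⟨r, hr, hrs⟩ := Metric.nhds_basis_closedBall.mem_iff.mp (Filter.iInter_mem.mpr hs)
  refine ⟨r, hr, ∑ i, K i, ∑ i, (‖chartField x₀ (X i) (extChartAt 𝓘(ℝ, E) x₀ x₀)‖₊
    + K i * r.toNNReal), fun i => ?_⟩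
  have hl := (hK i).mono (hrs.trans (iInter_subset s i))
  refine ⟨hl.weaken (Finset.single_le_sum (f := K) (fun _ _ => zero_le) (Finset.mem_univ i)),
    fun y hy => ?_⟩
  have h2 := hl.dist_le_mul y hy _ (Metric.mem_closedBall_self hr.le)
  have h3 : ‖chartField x₀ (X i) y‖₊ ≤ ‖chartField x₀ (X i) (extChartAt 𝓘(ℝ, E) x₀ x₀)‖₊
      + K i * r.toNNReal := by
    rw [← NNReal.coe_le_coe]
    push_cast
    rw [Real.coe_toNNReal r hr.le]
    rw [dist_eq_norm] at h2
    have h4 := norm_le_norm_add_norm_sub' (chartField x₀ (X i) y)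
      (chartField x₀ (X i) (extChartAt 𝓘(ℝ, E) x₀ x₀))
    have h5 := mul_le_mul_of_nonneg_left (Metric.mem_closedBall.mp hy) (K i).coe_nonneg
    linarith
  exact_mod_cast h3.trans (Finset.single_le_sum (f := fun i =>
    ‖chartField x₀ (X i) (extChartAt 𝓘(ℝ, E) x₀ x₀)‖₊ + K i * r.toNNReal)
    (fun _ _ => zero_le) (Finset.mem_univ i))

/-- Local existence of curves with prescribed velocity. -/
lemma exists_local_flow [CompleteSpace E] (hX : ∀ i, ContMDiff 𝓘(ℝ, E) 𝓘(ℝ, E).tangent 1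
      (fun x => (⟨x, X i x⟩ : TangentBundle 𝓘(ℝ, E) M))) (ha : Continuous a) (s₀ : ℝ) (x₀ : M) :
    ∃ ε > 0, ∃ γ : ℝ → M, γ s₀ = x₀ ∧ ∀ s ∈ Ioo (s₀ - ε) (s₀ + ε),
      HasMFDerivAt 𝓘(ℝ, ℝ) 𝓘(ℝ, E) γ s
        ((1 : ℝ →L[ℝ] ℝ).smulRight (∑ i, a s i • X i (γ s) : TangentSpace 𝓘(ℝ, E) (γ s))) := by
  obtain ⟨r, hr, K, B, hKB⟩ := exists_chartField_bounds hX x₀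
  obtain ⟨A', hA'⟩ := (isCompact_Icc (a := s₀ - 1) (b := s₀ + 1)).exists_bound_of_continuousOn
    ha.continuousOn
  set A := A'.toNNReal with hA
  have hbd : ∀ s ∈ Icc (s₀ - 1) (s₀ + 1), ‖a s‖ ≤ A := fun s hs =>
    (hA' s hs).trans (Real.le_coe_toNNReal A')
  set L : ℝ≥0 := 3 * (A * B) with hL
  -- `L` bounds the speed in the chart, so L·δ ≤ r keeps the solution in the ball; δ ≤ 1 keeps the
  -- time where the coefficients are bounded by `A`.
  set δ := min 1 (r / (L + 1)) with hδ
  have hδ0 : 0 < δ := by positivity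
  have hδ1 : δ ≤ 1 := min_le_left _ _
  have hsub : Icc (s₀ - δ) (s₀ + δ) ⊆ Icc (s₀ - 1) (s₀ + 1) :=
    Icc_subset_Icc (by linarith) (by linarith)
  have hp : IsPicardLindelof (fun s y => ∑ i, a s i • chartField x₀ (X i) y)
      (⟨s₀, by constructor <;> linarith⟩ : Icc (s₀ - δ) (s₀ + δ)) (extChartAt 𝓘(ℝ, E) x₀ x₀)
      r.toNNReal 0 L (3 * (A * K)) :=
    { lipschitzOnWith := fun s hs => by
        rw [Real.coe_toNNReal r hr.le]
        exact lipschitzOnWith_sum_smul (fun i => (hKB i).1) (hbd s (hsub hs))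
      continuousOn := fun y _ => by fun_prop
      norm_le := fun s hs y hy => by
        rw [Real.coe_toNNReal r hr.le] at hy
        refine (norm_sum_le_of_le Finset.univ (n := fun _ => (A * B : ℝ)) fun i _ => ?_).trans_eq ?_
        · rw [norm_smul]
          exact mul_le_mul ((norm_le_pi_norm (a s) i).trans (hbd s (hsub hs))) ((hKB i).2 y hy)
            (norm_nonneg _) A.coe_nonneg
        · rw [Fin.sum_const, nsmul_eq_mul, hL]
          push_cast
          ring
      mul_max_le := by
        simp only [add_sub_cancel_left, sub_sub_cancel, max_self, NNReal.coe_zero, sub_zero]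
        rw [Real.coe_toNNReal r hr.le]
        have h1 : δ ≤ r / (L + 1) := min_le_right _ _
        rw [le_div_iff₀ (by positivity)] at h1
        linarith }
  obtain ⟨f, hf0, hf⟩ := hp.exists_eq_forall_mem_Icc_hasDerivWithinAt₀
  have hf' : ∀ s ∈ Ioo (s₀ - δ) (s₀ + δ), HasDerivAt f (∑ i, a s i • chartField x₀ (X i) (f s)) s :=
    fun s hs => (hf s (Ioo_subset_Icc_self hs)).hasDerivAt (Icc_mem_nhds hs.1 hs.2)
  have hc : ContinuousAt f s₀ := (hf' s₀ (by constructor <;> linarith)).continuousAt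
  have hnh : ∀ᶠ s in 𝓝 s₀, f s ∈ (extChartAt 𝓘(ℝ, E) x₀).target := by
    refine hc.eventually ?_
    change (extChartAt 𝓘(ℝ, E) x₀).target ∈ 𝓝 (f s₀)
    rw [show f s₀ = _ from hf0]
    exact extChartAt_target_mem_nhds x₀
  obtain ⟨ε, hε, hεs⟩ := Metric.eventually_nhds_iff_ball.mp hnh
  rw [Real.ball_eq_Ioo] at hεs
  refine ⟨min δ ε, by positivity, (extChartAt 𝓘(ℝ, E) x₀).symm ∘ f, ?_, fun s hs => ?_⟩
  · rw [Function.comp_apply, show f s₀ = _ from hf0, extChartAt_to_inv]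
  · have h1 := min_le_left δ ε
    have h2 := min_le_right δ ε
    exact hasMFDerivAt_extChartAt_symm_comp (hf' s ⟨by linarith [hs.1], by linarith [hs.2]⟩)
      (hεs s ⟨by linarith [hs.1], by linarith [hs.2]⟩)

/-- Uniqueness of curves with prescribed velocity. -/
lemma IsFlowOn.eqOn [T2Space M] (hX : ∀ i, ContMDiff 𝓘(ℝ, E) 𝓘(ℝ, E).tangent 1
      (fun x => (⟨x, X i x⟩ : TangentBundle 𝓘(ℝ, E) M))) (ha : Continuous a) {N : ℝ}
    {x x' : ℝ → M} (h : IsFlowOn X a (Icc 0 N) x) (h' : IsFlowOn X a (Icc 0 N) x')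
    (h0 : x 0 = x' 0) : EqOn x x' (Icc 0 N) := by
  have hc : ContinuousOn x (Icc 0 N) := fun s hs => (h s hs).continuousWithinAt
  have hc' : ContinuousOn x' (Icc 0 N) := fun s hs => (h' s hs).continuousWithinAt
  have hcl : IsClosed ({s | x s = x' s} ∩ Icc 0 N) := by
    rw [inter_comm]
    exact (hc.prodMk hc').preimage_isClosed_of_isClosed isClosed_Icc isClosed_diagonal
  -- The coincidence set is closed, the target being Hausdorff. It contains 0, so it suffices to
  -- continue it to the right of each of its points, where both curves lie in one chart.
  refine fun s hs => hcl.Icc_subset_of_forall_mem_nhdsWithin h0 (fun s₁ hs₁ => ?_) hs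
  obtain ⟨hs₁, hs₁N⟩ := hs₁
  obtain ⟨r, hr, K, B, hK⟩ := exists_chartField_bounds hX (x s₁)
  obtain ⟨A', hA'⟩ := (isCompact_Icc (a := 0) (b := N)).exists_bound_of_continuousOn
    ha.continuousOn
  have hnear : ∀ y : ℝ → M, ContinuousOn y (Icc 0 N) → y s₁ = x s₁ → ∀ᶠ s in 𝓝[≥] s₁,
      y s ∈ (extChartAt 𝓘(ℝ, E) (x s₁)).source ∧ extChartAt 𝓘(ℝ, E) (x s₁) (y s)
        ∈ Metric.closedBall (extChartAt 𝓘(ℝ, E) (x s₁) (x s₁)) r := by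
    intro y hy he
    have hcw : ContinuousWithinAt y (Ici s₁) s₁ := (hy s₁ ⟨hs₁N.1, hs₁N.2.le⟩).mono_of_mem_nhdsWithin
      (Filter.mem_of_superset (Icc_mem_nhdsGE hs₁N.2) (Icc_subset_Icc_left hs₁N.1))
    refine (hcw.eventually_mem (s := (extChartAt 𝓘(ℝ, E) (x s₁)).source) ?_).and
      (hcw.eventually (p := fun z => extChartAt 𝓘(ℝ, E) (x s₁) z
        ∈ Metric.closedBall (extChartAt 𝓘(ℝ, E) (x s₁) (x s₁)) r) ?_)
    · rw [he]
      exact extChartAt_source_mem_nhds _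
    · rw [he]
      exact (continuousAt_extChartAt (x s₁)).eventually (Metric.closedBall_mem_nhds _ hr)
  obtain ⟨u, hu, hsub⟩ := (mem_nhdsGE_iff_exists_Icc_subset).mp
    (((hnear x hc rfl).and (hnear x' hc' (Eq.symm hs₁))).and (Icc_mem_nhdsGE hs₁N.2))
  have hsubN : Icc s₁ u ⊆ Icc 0 N := fun s hs => ⟨hs₁N.1.trans hs.1, (hsub hs).2.2⟩
  have mono : ∀ {f : ℝ → E} {f'}, ∀ s ∈ Ico s₁ u,
      HasDerivWithinAt f f' (Icc 0 N) s → HasDerivWithinAt f f' (Ici s) s := fun s hs hf => by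
    have hsN : s < N := hs.2.trans_le (hsubN ⟨hu.le, le_rfl⟩).2
    exact hf.mono_of_mem_nhdsWithin (Filter.mem_of_superset (Icc_mem_nhdsGE hsN)
      (Icc_subset_Icc_left (hsubN ⟨hs.1, hs.2.le⟩).1))
  have key := ODE_solution_unique_of_mem_Icc_right
    (v := fun s y => ∑ i, a s i • chartField (x s₁) (X i) y)
    (s := fun _ => Metric.closedBall (extChartAt 𝓘(ℝ, E) (x s₁) (x s₁)) r)
    (K := 3 * (A'.toNNReal * K)) (f := extChartAt 𝓘(ℝ, E) (x s₁) ∘ x)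
    (g := extChartAt 𝓘(ℝ, E) (x s₁) ∘ x') (a := s₁) (b := u)
    (fun s hs => lipschitzOnWith_sum_smul (fun i => (hK i).1)
      ((hA' s (hsubN ⟨hs.1, hs.2.le⟩)).trans (Real.le_coe_toNNReal A')))
    (fun s hs => ((h.hasDerivWithinAt (hsubN hs) (hsub hs).1.1.1).continuousWithinAt.mono hsubN))
    (fun s hs => mono s hs (h.hasDerivWithinAt (hsubN ⟨hs.1, hs.2.le⟩)
      (hsub ⟨hs.1, hs.2.le⟩).1.1.1))
    (fun s hs => (hsub ⟨hs.1, hs.2.le⟩).1.1.2)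
    (fun s hs => ((h'.hasDerivWithinAt (hsubN hs) (hsub hs).1.2.1).continuousWithinAt.mono hsubN))
    (fun s hs => mono s hs (h'.hasDerivWithinAt (hsubN ⟨hs.1, hs.2.le⟩)
      (hsub ⟨hs.1, hs.2.le⟩).1.2.1))
    (fun s hs => (hsub ⟨hs.1, hs.2.le⟩).1.2.2)
    (congrArg (extChartAt 𝓘(ℝ, E) (x s₁)) hs₁)
  refine Filter.mem_of_superset (Ioc_mem_nhdsGT hu) fun s hs => ?_
  have hs' : s ∈ Icc s₁ u := ⟨hs.1.le, hs.2⟩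
  exact (extChartAt 𝓘(ℝ, E) (x s₁)).injOn (hsub hs').1.1.1 (hsub hs').1.2.1 (key hs')

end Manifold

end Bianchi
end

/-! ### Global flows of time-dependent left-invariant fields -/

noncomputable section
namespace Bianchi

open scoped NNReal Topology

section LieGroup

variable {G : Type*} [TopologicalSpace G] [ChartedSpace E3 G] [Group G]
  [LieGroup 𝓘(ℝ, E3) ∞ G]

lemma mdifferentiable_mul_left (h : G) : MDifferentiable 𝓘(ℝ, E3) 𝓘(ℝ, E3) fun x : G => h * x :=
  (contMDiff_mul_left (I := 𝓘(ℝ, E3)) (n := ∞) (a := h)).mdifferentiable (by simp)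

lemma mfderiv_mul_left_mulInvariantVectorField (v : LieAlg G) (h g : G) :
    mfderiv 𝓘(ℝ, E3) 𝓘(ℝ, E3) (fun x : G => h * x) g (mulInvariantVectorField v g)
      = mulInvariantVectorField v (h * g) := by
  have D : (fun x : G => h * g * x) = (fun x => h * x) ∘ fun x => g * x :=
    funext fun x => mul_assoc _ _ _
  have h1 : mfderiv 𝓘(ℝ, E3) 𝓘(ℝ, E3) (fun x : G => h * g * x) 1
      = (mfderiv 𝓘(ℝ, E3) 𝓘(ℝ, E3) (fun x : G => h * x) (g * 1)).comp
        (mfderiv 𝓘(ℝ, E3) 𝓘(ℝ, E3) (fun x : G => g * x) 1) := by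
    rw [D]
    exact mfderiv_comp 1 (mdifferentiable_mul_left h _) (mdifferentiable_mul_left g _)
  -- All tangent spaces are identified with the model space, so that `g * 1` can be replaced by `g`
  -- without obstruction from dependent types.
  let F : G → E3 →L[ℝ] E3 := fun z => mfderiv 𝓘(ℝ, E3) 𝓘(ℝ, E3) (fun x : G => h * x) z
  let L : E3 →L[ℝ] E3 := mfderiv 𝓘(ℝ, E3) 𝓘(ℝ, E3) (fun x : G => g * x) 1
  have h2 : (F g).comp L = (F (g * 1)).comp L := by rw [mul_one]
  exact congrArg (fun T : E3 →L[ℝ] E3 => T v) (h2.trans h1.symm)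

/-- The left-invariant vector fields of a frame. -/
def frameField (e : Module.Basis (Fin 3) ℝ (LieAlg G)) (i : Fin 3) (g : G) :
    TangentSpace 𝓘(ℝ, E3) g := mulInvariantVectorField (e i) g

lemma contMDiff_frameField (e : Module.Basis (Fin 3) ℝ (LieAlg G)) (i : Fin 3) :
    ContMDiff 𝓘(ℝ, E3) 𝓘(ℝ, E3).tangent 1
      (fun g => (⟨g, frameField e i g⟩ : TangentBundle 𝓘(ℝ, E3) G)) := by
  have : LieGroup 𝓘(ℝ, E3) (minSmoothness ℝ 3) G := lieGroup_minSmoothness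
  refine (contMDiff_mulInvariantVectorField (e i)).of_le ?_
  rw [minSmoothness_of_isRCLikeNormedField]
  norm_num

/-- Left translates of solutions solve the same equation, with the same coefficients at the same
times. Hence the local existence time does not depend on the starting point. -/
lemma hasMFDerivWithinAt_mul_left {e : Module.Basis (Fin 3) ℝ (LieAlg G)} {b : Fin 3 → ℝ}
    {γ : ℝ → G} {s : ℝ} {S : Set ℝ}
    (hγ : HasMFDerivWithinAt 𝓘(ℝ, ℝ) 𝓘(ℝ, E3) γ S s ((1 : ℝ →L[ℝ] ℝ).smulRight
      (∑ i, b i • frameField e i (γ s) : TangentSpace 𝓘(ℝ, E3) (γ s)))) (h : G) :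
    HasMFDerivWithinAt 𝓘(ℝ, ℝ) 𝓘(ℝ, E3) (fun r => h * γ r) S s ((1 : ℝ →L[ℝ] ℝ).smulRight
      (∑ i, b i • frameField e i (h * γ s) : TangentSpace 𝓘(ℝ, E3) (h * γ s))) := by
  have h1 := (mdifferentiable_mul_left h (γ s)).hasMFDerivAt.comp_hasMFDerivWithinAt s hγ
  have h2 : (∑ i, b i • frameField e i (h * γ s) : TangentSpace 𝓘(ℝ, E3) (h * γ s))
      = mfderiv 𝓘(ℝ, E3) 𝓘(ℝ, E3) (fun x : G => h * x) (γ s) (∑ i, b i • frameField e i (γ s)) := by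
    have h3 := clm_sum_smul (E := E3) (F := E3)
      (mfderiv 𝓘(ℝ, E3) 𝓘(ℝ, E3) (fun x : G => h * x) (γ s)) b fun i => frameField e i (γ s)
    refine Eq.trans ?_ h3.symm
    exact Finset.sum_congr rfl fun i _ => congrArg (fun z : E3 => b i • z)
      (mfderiv_mul_left_mulInvariantVectorField (e i) h (γ s)).symm
  refine h1.congr_mfderiv ?_
  rw [h2]
  refine ContinuousLinearMap.ext fun r => ?_
  let L : E3 →L[ℝ] E3 := mfderiv 𝓘(ℝ, E3) 𝓘(ℝ, E3) (fun x : G => h * x) (γ s)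
  let y : E3 := ∑ i, b i • frameField e i (γ s)
  exact L.map_smul (show ℝ from r) y

/-- A curve can be prolonged by a left translate of another curve. -/
lemma IsFlowOn.glue {e : Module.Basis (Fin 3) ℝ (LieAlg G)} {a : ℝ → Fin 3 → ℝ} {s₁ s₂ : ℝ}
    {x y : ℝ → G} (h0 : 0 ≤ s₁) (h12 : s₁ ≤ s₂) (hx : IsFlowOn (frameField e) a (Icc 0 s₁) x)
    (hy : IsFlowOn (frameField e) a (Icc s₁ s₂) y) :
    ∃ z, z 0 = x 0 ∧ IsFlowOn (frameField e) a (Icc 0 s₂) z := by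
  -- The translation by `c` moves `y s₁` to `x s₁`.
  set c := x s₁ * (y s₁)⁻¹ with hc
  set z : ℝ → G := fun s => if s ≤ s₁ then x s else c * y s with hz
  have e1 : ∀ s ∈ Icc 0 s₁, z s = x s := fun s hs => if_pos hs.2
  have e2 : ∀ s ∈ Icc s₁ s₂, z s = c * y s := by
    intro s hs
    by_cases h : s ≤ s₁
    · obtain rfl := le_antisymm h hs.1
      simp [hz, hc]
    · exact if_neg h
  have d2 : IsFlowOn (frameField e) a (Icc s₁ s₂) fun s => c * y s := fun s hs =>
    hasMFDerivWithinAt_mul_left (hy s hs) c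
  exact ⟨z, e1 0 ⟨le_rfl, h0⟩, (hx.congr e1).union_Icc (d2.congr e2)⟩

/-- Global existence of curves with prescribed velocity in a left-invariant frame. -/
lemma exists_flow_Icc (e : Module.Basis (Fin 3) ℝ (LieAlg G)) {a : ℝ → Fin 3 → ℝ}
    (ha : Continuous a) (x₀ : G) {N : ℝ} (hN : 0 ≤ N) :
    ∃ x : ℝ → G, x 0 = x₀ ∧ IsFlowOn (frameField e) a (Icc 0 N) x := by
  have : IsManifold 𝓘(ℝ, E3) 1 G := IsManifold.of_le (n := ∞) (by simp)
  have hloc := fun s₀ => exists_local_flow (contMDiff_frameField e) ha s₀ (1 : G)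
  set P : Set ℝ := {s | 0 ≤ s ∧ ∃ x : ℝ → G, x 0 = x₀ ∧ IsFlowOn (frameField e) a (Icc 0 s) x}
    with hP
  have hdown : ∀ s ∈ P, ∀ r, 0 ≤ r → r ≤ s → r ∈ P := fun s hs r hr hrs => by
    obtain ⟨-, x, hx0, hx⟩ := hs
    exact ⟨hr, x, hx0, hx.mono (Icc_subset_Icc_right hrs)⟩
  have h0 : (0 : ℝ) ∈ P := by
    obtain ⟨ε, hε, γ, -, hγ⟩ := hloc 0
    refine ⟨le_rfl, fun s => x₀ * (γ 0)⁻¹ * γ s, by simp, fun s hs => ?_⟩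
    have hs' : s = 0 := le_antisymm hs.2 hs.1
    refine hasMFDerivWithinAt_mul_left (hγ s ?_).hasMFDerivWithinAt _
    rw [hs']
    constructor <;> linarith
  -- If `N` is not reached, the reachable times are bounded. A local solution around their supremum,
  -- left-translated to continue a curve ending just before it, passes beyond the supremum.
  by_contra hcon
  have hbdd : BddAbove P := ⟨N, fun s hs => by
    by_contra! h
    exact hcon (hdown s hs N hN h.le).2⟩
  obtain ⟨ε, hε, γ, -, hγ⟩ := hloc (sSup P)
  obtain ⟨s₁, hs₁, hlt⟩ := exists_lt_of_lt_csSup ⟨0, h0⟩ (sub_lt_self (sSup P) hε)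
  have hle := le_csSup hbdd hs₁
  obtain ⟨hs₁0, x, hx0, hx⟩ := hs₁
  obtain ⟨z, hz0, hz⟩ := hx.glue (s₂ := sSup P + ε / 2) hs₁0 (by linarith) (y := γ) fun s hs =>
    (hγ s ⟨by linarith [hs.1], by linarith [hs.2]⟩).hasMFDerivWithinAt
  have := le_csSup hbdd (⟨by linarith, z, hz0.trans hx0, hz⟩ : sSup P + ε / 2 ∈ P)
  linarith

lemma exists_global_flow [T2Space G] (e : Module.Basis (Fin 3) ℝ (LieAlg G)) {a : ℝ → Fin 3 → ℝ}
    (ha : Continuous a) (x₀ : G) :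
    ∃ x : ℝ → G, x 0 = x₀ ∧ IsFlowOn (frameField e) a (Ici 0) x := by
  have : IsManifold 𝓘(ℝ, E3) 1 G := IsManifold.of_le (n := ∞) (by simp)
  choose x hx0 hx using fun n : ℕ => exists_flow_Icc e ha x₀ (N := n) n.cast_nonneg
  have hmem : ∀ s, 0 ≤ s → s ∈ Icc 0 ((⌊s⌋₊ + 1 : ℕ) : ℝ) := fun s hs =>
    ⟨hs, by push_cast; exact (Nat.lt_floor_add_one s).le⟩
  have heq : ∀ (n : ℕ) (s : ℝ), s ∈ Icc (0 : ℝ) n → x (⌊s⌋₊ + 1) s = x n s := fun n s hs =>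
    IsFlowOn.eqOn (contMDiff_frameField e) ha
      ((hx _).mono (Icc_subset_Icc_right (hmem s hs.1).2))
      ((hx n).mono (Icc_subset_Icc_right hs.2)) ((hx0 _).trans (hx0 n).symm) ⟨hs.1, le_rfl⟩
  refine ⟨fun s => x (⌊s⌋₊ + 1) s, hx0 _, fun s hs => ?_⟩
  refine ((hx _).congr (heq _) s (hmem s hs)).mono_of_mem_nhdsWithin ?_
  rw [← Ici_inter_Iic]
  exact Filter.inter_mem self_mem_nhdsWithin (mem_nhdsWithin_of_mem_nhds
    (Iic_mem_nhds (by push_cast; exact Nat.lt_floor_add_one s)))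

end LieGroup

end Bianchi
end

/-! ### Geodesic completeness and bounds along geodesics -/

noncomputable section
namespace Bianchi

section Completeness

variable {G : Type*} [TopologicalSpace G] [ChartedSpace E3 G] [Group G]
  {e : Module.Basis (Fin 3) ℝ (LieAlg G)} {m Λ : ℝ} {v : ℝ → State} {S : Set ℝ} {t : ℝ → ℝ}
  {x : ℝ → G} {w : ℝ → Option (Fin 3) → ℝ}

namespace IsFutureCausalGeodesicOn

lemma isGeodesicVelocityOn (hv : IsGlobalSolution (structConst e) m Λ v)
    (h : IsFutureCausalGeodesicOn e (fun r => (v r).g) S t x w) :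
    IsGeodesicVelocityOn (structConst e) v S t w where
  time_nonneg := h.time_nonneg
  time_deriv := h.time_deriv
  geodesic s hs l := by
    have := h.geodesic s hs l
    rwa [hv.spacetimeConn_eq (h.time_nonneg s hs)] at this
  future := h.future

lemma speedSq_le (h : IsFutureCausalGeodesicOn e (fun r => (v r).g) S t x w) {s : ℝ} (hs : s ∈ S) :
    speedSq (v (t s)) (w s) ≤ w s none ^ 2 := by
  rw [speedSq_eq_sum]
  exact h.causal s hs

lemma isFlowOn (h : IsFutureCausalGeodesicOn e (fun r => (v r).g) S t x w) :
    IsFlowOn (frameField e) (fun s => spatial (w s)) S x := h.space_deriv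

lemma of_isGeodesicVelocityOn (hv : IsGlobalSolution (structConst e) m Λ v)
    (h : IsGeodesicVelocityOn (structConst e) v S t w)
    (hx : IsFlowOn (frameField e) (fun s => spatial (w s)) S x)
    (hc : ∀ s ∈ S, speedSq (v (t s)) (w s) ≤ w s none ^ 2) :
    IsFutureCausalGeodesicOn e (fun r => (v r).g) S t x w where
  time_nonneg := h.time_nonneg
  time_deriv := h.time_deriv
  space_deriv := hx
  geodesic s hs l := by
    rw [hv.spacetimeConn_eq (h.time_nonneg s hs)]
    exact h.geodesic s hs l
  causal s hs := by
    have := hc s hs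
    rwa [speedSq_eq_sum] at this
  future := h.future

end IsFutureCausalGeodesicOn

/-- The lower bound for s inverts t ≤ t(0) + W s, where W = w⁰(0) e^{A/c} bounds dt/ds. -/
lemma Expanding.geodesic_bounds (h : Expanding (structConst e) m Λ v)
    (hgeo : IsFutureCausalGeodesicOn e (fun r => (v r).g) (Ici 0) t x w) :
    (∃ B : ℝ, ∀ s, 0 ≤ s →
      (∑ i, ∑ j, (v (t s)).g i j * w s (some i) * w s (some j)) ≤ B) ∧
      ∃ A D : ℝ, 0 < A ∧ ∀ s, 0 ≤ s → A * t s + D ≤ s := by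
  obtain ⟨A, c, κ, hd⟩ := h.exists_decay
  have hvel := hgeo.isGeodesicVelocityOn h.sol
  have h0 : (0 : ℝ) ∈ Ici 0 := mem_Ici.mpr le_rfl
  have hca := hgeo.speedSq_le h0
  have hW : 0 < w 0 none * Real.exp (A / c) := mul_pos (hvel.future 0 h0) (Real.exp_pos _)
  refine ⟨⟨speedSq (v (t 0)) (w 0) * Real.exp (2 * A / c), fun s hs => ?_⟩,
    (w 0 none * Real.exp (A / c))⁻¹, -((w 0 none * Real.exp (A / c))⁻¹ * t 0), inv_pos.mpr hW,
    fun s hs => ?_⟩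
  · rw [← speedSq_eq_sum]
    exact hvel.speedSq_le h.isLie h.sol hd (convex_Ici 0) h0 hs hs
  · have h1 := hvel.time_le h.isLie h.sol hd (convex_Ici 0) h0 hs hs hca
    rw [← sub_eq_add_neg, ← mul_sub, inv_mul_le_iff₀ hW]
    linarith

variable [LieGroup 𝓘(ℝ, E3) ∞ G]

/-- In a left-invariant frame the connection depends only on t, so (t, w) is solved first and the
position afterwards. Conservation of (w⁰)² - |w|² keeps the curve causal, and uniqueness for both
systems shows that it extends the given geodesic. -/
lemma Expanding.futureGeodesicallyComplete [T2Space G]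
    (h : Expanding (structConst e) m Λ v) : FutureGeodesicallyComplete e fun t => (v t).g := by
  intro b t x w hb hgeo
  obtain ⟨A, c, κ, hd⟩ := h.exists_decay
  have : IsManifold 𝓘(ℝ, E3) 1 G := IsManifold.of_le (n := ∞) (by simp)
  have hmem : (0 : ℝ) ∈ Ico 0 b := ⟨le_rfl, hb⟩
  have hvel := hgeo.isGeodesicVelocityOn h.sol
  have hca := hgeo.speedSq_le hmem
  obtain ⟨t', w', ht', hw', hglob⟩ := hd.exists_global_geodesicVelocity h.isLie h.sol
    (hvel.time_nonneg 0 hmem) (hvel.future 0 hmem) hca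
  -- The velocity is frozen for s < 0 because the flow theorems take coefficients continuous on the
  -- whole line.
  have hcont : Continuous fun s => spatial (w' (max s 0)) := by
    refine continuous_pi fun i => ?_
    have hc : ContinuousOn (fun s => w' s (some i)) (Ici 0) := fun s hs =>
      (hglob.geodesic s hs (some i)).continuousWithinAt
    exact hc.comp_continuous (by fun_prop) fun s => le_max_right s 0
  obtain ⟨x', hx0, hx'⟩ := exists_global_flow e hcont (x 0)
  have hcausal : ∀ s ∈ Ici (0 : ℝ), speedSq (v (t' s)) (w' s) ≤ w' s none ^ 2 := fun s hs => by
    have := hglob.sub_speedSq_eq h.isLie h.sol (convex_Ici 0) (mem_Ici.mpr le_rfl) hs hs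
    rw [ht', hw'] at this
    linarith
  refine ⟨t', x', w', .of_isGeodesicVelocityOn h.sol hglob (hx'.congr_coeff fun s hs => ?_) hcausal,
    fun s hs => ?_⟩
  · simp only [max_eq_left (mem_Ici.mp hs)]
  · have hsub : Icc 0 s ⊆ Ico 0 b := fun r hr => ⟨hr.1, hr.2.trans_lt hs.2⟩
    have heq := hd.geodesicVelocity_unique h.isLie h.sol hs.1 (hvel.mono hsub)
      (hglob.mono Icc_subset_Ici_self) hca ht' hw'
    have hs' : s ∈ Icc 0 s := ⟨hs.1, le_rfl⟩
    refine ⟨(heq s hs').1.symm, ?_⟩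
    refine IsFlowOn.eqOn (contMDiff_frameField e) hcont (hx'.mono Icc_subset_Ici_self)
      ((hgeo.isFlowOn.mono hsub).congr_coeff fun r hr => ?_) hx0 hs'
    simp only [max_eq_left hr.1, (heq r hr).2]

end Completeness

end Bianchi
end

theorem theorem5
    (G : Type*) [TopologicalSpace G] [T2Space G] [ChartedSpace Bianchi.E3 G] [Group G]
    [LieGroup 𝓘(ℝ, Bianchi.E3) ∞ G] [SimplyConnectedSpace G]
    (hG : ¬ Bianchi.IsTypeIX G)
    (e : Module.Basis (Fin 3) ℝ (Bianchi.LieAlg G))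
    (m Λ : ℝ) (hm : 0 < m) (v : ℝ → Bianchi.State)
    (h0 : (v 0).IsInitialData (Bianchi.structConst e) m Λ)
    (hΛ : -(4 * Real.pi * m ^ 2 * (v 0).Φ ^ 2) < Λ)
    (hH : (v 0).H < 0)
    (hv : Bianchi.IsGlobalSolution (Bianchi.structConst e) m Λ v) :
    Bianchi.FutureGeodesicallyComplete e (fun t => (v t).g) ∧
    (∀ (t : ℝ → ℝ) (x : ℝ → G) (w : ℝ → Option (Fin 3) → ℝ),
      Bianchi.IsFutureCausalGeodesicOn e (fun r => (v r).g) (Set.Ici 0) t x w →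
      (∃ B : ℝ, ∀ s, 0 ≤ s →
        (∑ i, ∑ j, (v (t s)).g i j * w s (some i) * w s (some j)) ≤ B) ∧
      ∃ A D : ℝ, 0 < A ∧ ∀ s, 0 ≤ s → A * t s + D ≤ s) ∧
    (∃ B : ℝ, ∀ t, 0 ≤ t → (v t).normSqU ≤ B) := by
  have h : Bianchi.Expanding (Bianchi.structConst e) m Λ v :=
    { isLie := Bianchi.isLie_structConst e
      not_so3 := fun h => hG (Bianchi.isTypeIX_of_isSO3 e h)
      sol := hv
      init := h0
      lam := hΛ
      H_neg := hH }
  exact ⟨h.futureGeodesicallyComplete, fun _ _ _ hgeo => h.geodesic_bounds hgeo, h.normSqU_bounded⟩
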